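/- Let $0<|q|<1$, let $a,b,c,d,e,f$ be non-zero complex numbers, put $s=\dfrac{a^3q^3}{bcdef}$, and suppose $s=q^m$ for some $m\in\{1,2,3,\dots\}$. Assume that neither $a$ nor any of $b/a,c/a,d/a,e/a,f/a$ is an integer power of $q$. Fix any logarithms of $q$ and of $s$, and let $q^x$, $s^x$ ($x\in\mathbb C$) and $\sqrt s=s^{1/2}$ be the corresponding powers. Write $(x)_k=\prod_{i=0}^{k-1}(1-xq^i)$, $(x)_\infty=\prod_{i\ge0}(1-xq^i)$, $(x,y,\dots)_\infty=(x)_\infty(y)_\infty\cdots$, and $$\phi(a;b,c,d,e,f,g,h)=\sum_{k\ge0}\frac{(a)_k}{(q)_k}\,\frac{1-aq^{2k}}{1-a}\prod_{x\in\{b,c,d,e,f,g,h\}}\frac{(x)_k}{(aq/x)_k}\;q^k$$ (the very-well-poised ${}_{10}\phi_9$ with argument $q$; the parameters $b,\dots,h$ are taken with multiplicity here and in all products below). Let $W(a;b,c,d,e,f)$ be the very-well-poised series $$\sum_{k\ge0}\frac{(a)_k}{(q)_k}\,\frac{1-aq^{2k}}{1-a}\prod_{x\in\{b,c,d,e,f\}}\frac{(x)_k}{(aq/x)_k}\;z^k={}_8\phi_7,\qquad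 z=\frac{a^2q^2}{bcdef},$$ when $|z|<1$, and its analytic continuation otherwise (the series has a unique analytic continuation in $z$ from $|z|<1$ to $\mathbb C\setminus\{1,q^{-1},q^{-2},\dots\}$, a set that contains the required values of $z$). Put $W_1=W(a;b,c,d,e,f)$ and $W_2=W\!\left(\frac qa;\frac qb,\frac qc,\frac qd,\frac qe,\frac qf\right)$. For a complex variable $n$ let $$a_n=\frac{1}{(1-sq^{2n-1})(1-\frac saq^{n-2})(1-aq^{n+1})}\Bigg[\frac{q^{-n+1/2}}{\sqrt s}\,\frac{(1-sq^{n-1})(1-\frac saq^{n-1})(1-\frac saq^{n-2})}{1-sq^{2n}}\prod_{x\in\{b,c,d,e,f\}}\!\!\Big(1-\frac axq^{n+1}\Big)$$ $$+\frac{q^{-n+3/2}}{\sqrt s}\,\frac{(1-q^n)(1-aq^n)(1-aq^{n+1})}{1-sq^{2n-2}}\prod_{x\in\{b,c,d,e,f\}}\!\!\Big(1-\frac{xs}aq^{n-2}\Big)+\frac{\sqrt s}{a}q^{n-1/2}(1-sq^{2n-1})\Big(1-\frac{s}{aq^2}\Big)\prod_{x\in\{b,c,d,e,f\}}\!\!(1-x)\Bigg],$$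 $$b_n=\frac{q^{-2n+3}}{s}\,\frac{(1-q^n)(1-sq^{n-2})}{(1-sq^{2n-1})(1-sq^{2n-2})^2(1-sq^{2n-3})}\prod_{x\in\{b,c,d,e,f\}}\!\!\Big(1-\frac axq^n\Big)\Big(1-\frac{xs}aq^{n-2}\Big),$$ $$X_n^{(1)}=\frac{q^{-n^2/2+n}}{s^{n/2}}\,\frac{(sq^{2n-1},\,aq^{n+1})_\infty}{(sq^{n-1},\,\frac saq^{n-1})_\infty\prod_{x\in\{b,c,d,e,f\}}(\frac{aq^{n+1}}x)_\infty}\;\phi(a;b,c,d,e,f,sq^{n-1},q^{-n}),$$ $$X_n^{(2)}=\frac{q^{-n^2/2+n}}{s^{n/2}}\,\frac{(\frac saq^n,\,sq^{2n-1})_\infty}{(q^{n+1},\,aq^n)_\infty\prod_{x\in\{b,c,d,e,f\}}(\frac{xs}aq^{n-1})_\infty}\;\phi\Big(\frac qa;\frac qb,\frac qc,\frac qd,\frac qe,\frac qf,\frac{q^{-n+2}}s,q^{n+1}\Big).$$ In the continued fraction below, $a_n$ ($n=0,1,2,\dots$) and $b_n$ ($n=1,2,\dots$) denote the limits of the above expressions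 as the complex variable tends to the integer $n$ (with $s=q^m$ fixed); these limits exist, and matter only where an expression is indeterminate, which happens only for $s=q,q^2$. Then $$\frac{1}{a_0}\;{\atop-}\;\frac{b_1}{a_1}\;{\atop-}\;\frac{b_2}{a_2}\;{\atop-\cdots}\;=\;\lim_{n\to0}\frac{W_2X_n^{(1)}-W_1X_n^{(2)}}{b_n\big(W_2X_{n-1}^{(1)}-W_1X_{n-1}^{(2)}\big)},$$ where the continued fraction converges and the limit over complex $n\to0$, $n\ne0$, exists, both in the Riemann sphere $\mathbb C\cup\{\infty\}$ (so that both sides may be $\infty$). -/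

import Mathlib

open Filter Topology

noncomputable section

namespace QCF

/-- The finite `q`-shifted factorial `(x; q)_k = (1 - x)(1 - x q) ⋯ (1 - x q ^ (k - 1))`. -/
def qPoch (q x : ℂ) (k : ℕ) : ℂ := ∏ i ∈ Finset.range k, (1 - x * q ^ i)

/-- The infinite product `(x; q)_∞ = (1 - x)(1 - x q)(1 - x q ^ 2) ⋯`. -/
def qPochInf (q x : ℂ) : ℂ := ∏' i : ℕ, (1 - x * q ^ i)

/-- The coefficient of `z ^ k` in the very-well-poised basic hypergeometric series
with numerator parameters `a, q √a, -q √a, p 0, p 1, …` and denominator parameters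
`√a, -√a, a q / p 0, a q / p 1, …`. The four parameters that contain `√a` contribute
`(q √a)_k (-q √a)_k / ((√a)_k (-√a)_k) = (1 - a q ^ (2 k)) / (1 - a)`
(see `qPoch_sqrt_quotient`). -/
def vwpCoeff {r : ℕ} (q a : ℂ) (p : Fin r → ℂ) (k : ℕ) : ℂ :=
  qPoch q a k * ((1 - a * q ^ (2 * k)) / (1 - a)) *
    (∏ i, qPoch q (p i) k / qPoch q (a * q / p i) k) / qPoch q q k

theorem qPoch_shift (q x : ℂ) (k : ℕ) :
    qPoch q (q * x) k * (1 - x) = qPoch q x k * (1 - x * q ^ k) := by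
  induction k with
  | zero => simp [qPoch]
  | succ n ih =>
    have h1 : qPoch q (q * x) (n + 1) = qPoch q (q * x) n * (1 - q * x * q ^ n) := by
      simp [qPoch, Finset.prod_range_succ]
    have h2 : qPoch q x (n + 1) = qPoch q x n * (1 - x * q ^ n) := by
      simp [qPoch, Finset.prod_range_succ]
    rw [h1, h2]
    linear_combination (1 - q * x * q ^ n) * ih

/-- The contribution of the parameters `q √a, -q √a` over `√a, -√a`; here `w = √a`. -/
theorem qPoch_sqrt_quotient (q a w : ℂ) (hw : w ^ 2 = a) (ha : ∀ i : ℕ, a * q ^ (2 * i) ≠ 1)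
    (k : ℕ) :
    qPoch q (q * w) k * qPoch q (q * -w) k / (qPoch q w k * qPoch q (-w) k) =
      (1 - a * q ^ (2 * k)) / (1 - a) := by
  have h1 := qPoch_shift q w k
  have h2 := qPoch_shift q (-w) k
  have hne : qPoch q w k * qPoch q (-w) k ≠ 0 := by
    unfold qPoch
    rw [← Finset.prod_mul_distrib, Finset.prod_ne_zero_iff]
    intro i _ h
    apply ha i
    rw [← hw]
    linear_combination -h
  have ha0 : (1 : ℂ) - a ≠ 0 := by
    intro h
    apply ha 0
    linear_combination -h
  rw [div_eq_div_iff hne ha0]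
  have e : (1 : ℂ) - a = (1 - w) * (1 - -w) := by rw [← hw]; ring
  have e2 : (1 : ℂ) - a * q ^ (2 * k) = (1 - w * q ^ k) * (1 - -w * q ^ k) := by
    rw [← hw, pow_mul']; ring
  rw [e, e2]
  calc _ = (qPoch q (q * w) k * (1 - w)) * (qPoch q (q * -w) k * (1 - -w)) := by ring
    _ = _ := by rw [h1, h2]; ring

/-- The very-well-poised series `₁₀φ₉` with argument `q`, that is
`φ(a; p 0, p 1, p 2, p 3, p 4, g, h)`. -/
def phi (q a : ℂ) (p : Fin 5 → ℂ) (g h : ℂ) : ℂ :=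
  ∑' k : ℕ, vwpCoeff q a (Matrix.vecCons g (Matrix.vecCons h p)) k * q ^ k

/-- `F` is the analytic continuation, in the argument `z`, of the very-well-poised series
`₈φ₇(a, q √a, -q √a, p 0, …, p 4; √a, -√a, a q / p 0, …, a q / p 4; q, z)`
from the unit disc to the connected open set `ℂ \ {1, q⁻¹, q⁻², …}`. -/
def IsContinuation (q a : ℂ) (p : Fin 5 → ℂ) (F : ℂ → ℂ) : Prop :=
  DifferentiableOn ℂ F {z | ∀ k : ℕ, z * q ^ k ≠ 1} ∧
    ∀ z : ℂ, ‖z‖ < 1 → HasSum (fun k : ℕ => vwpCoeff q a p k * z ^ k) (F z)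

/-- The argument `a² q² / (b c d e f)` of the very-well-poised series `W(a; b, c, d, e, f)`,
where `p = (b, c, d, e, f)`. -/
def wArg (q a : ℂ) (p : Fin 5 → ℂ) : ℂ := a ^ 2 * q ^ 2 / ∏ i, p i

/-! In the following definitions `ℓ` and `μ` are logarithms of `q` and `s`: they fix the branches
`q ^ x = exp (x ℓ)` and `s ^ x = exp (x μ)`. The index `n` is a complex variable, and
`p = (b, c, d, e, f)`. -/

/-- The coefficient `a_n` of the recurrence `X_{n+1} - a_n X_n + b_n X_{n-1} = 0`. -/
def aCoeff (ℓ μ a : ℂ) (p : Fin 5 → ℂ) (n : ℂ) : ℂ :=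
  let Q : ℂ → ℂ := fun x => Complex.exp (x * ℓ)
  let s : ℂ := Complex.exp μ
  let rs : ℂ := Complex.exp (μ / 2)
  (Q (-n + 1 / 2) / rs * (1 - s * Q (n - 1)) * (1 - s / a * Q (n - 1)) * (1 - s / a * Q (n - 2)) *
        (∏ i, (1 - a / p i * Q (n + 1))) / (1 - s * Q (2 * n)) +
      Q (-n + 3 / 2) / rs * (1 - Q n) * (1 - a * Q n) * (1 - a * Q (n + 1)) *
        (∏ i, (1 - p i * s / a * Q (n - 2))) / (1 - s * Q (2 * n - 2)) +
      rs / a * Q (n - 1 / 2) * (1 - s * Q (2 * n - 1)) * (1 - s / (a * Q 2)) * ∏ i, (1 - p i)) /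
    ((1 - s * Q (2 * n - 1)) * (1 - s / a * Q (n - 2)) * (1 - a * Q (n + 1)))

/-- The coefficient `b_n` of the recurrence `X_{n+1} - a_n X_n + b_n X_{n-1} = 0`. -/
def bCoeff (ℓ μ a : ℂ) (p : Fin 5 → ℂ) (n : ℂ) : ℂ :=
  let Q : ℂ → ℂ := fun x => Complex.exp (x * ℓ)
  let s : ℂ := Complex.exp μ
  Q (-2 * n + 3) / s * (1 - Q n) * (1 - s * Q (n - 2)) * (∏ i, (1 - a / p i * Q n)) *
      (∏ i, (1 - p i * s / a * Q (n - 2))) /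
    ((1 - s * Q (2 * n - 1)) * (1 - s * Q (2 * n - 2)) ^ 2 * (1 - s * Q (2 * n - 3)))

/-- The first solution `X_n^{(1)}`. -/
def X₁ (ℓ μ a : ℂ) (p : Fin 5 → ℂ) (n : ℂ) : ℂ :=
  let q : ℂ := Complex.exp ℓ
  let Q : ℂ → ℂ := fun x => Complex.exp (x * ℓ)
  let s : ℂ := Complex.exp μ
  Q (-n ^ 2 / 2 + n) / Complex.exp (n / 2 * μ) *
      (qPochInf q (s * Q (2 * n - 1)) * qPochInf q (a * Q (n + 1)) /
        (qPochInf q (s * Q (n - 1)) * qPochInf q (s / a * Q (n - 1)) *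
          ∏ i, qPochInf q (a * Q (n + 1) / p i))) *
    phi q a p (s * Q (n - 1)) (Q (-n))

/-- The second solution `X_n^{(2)}`. -/
def X₂ (ℓ μ a : ℂ) (p : Fin 5 → ℂ) (n : ℂ) : ℂ :=
  let q : ℂ := Complex.exp ℓ
  let Q : ℂ → ℂ := fun x => Complex.exp (x * ℓ)
  let s : ℂ := Complex.exp μ
  Q (-n ^ 2 / 2 + n) / Complex.exp (n / 2 * μ) *
      (qPochInf q (s / a * Q n) * qPochInf q (s * Q (2 * n - 1)) /
        (qPochInf q (Q (n + 1)) * qPochInf q (a * Q n) *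
          ∏ i, qPochInf q (p i * s / a * Q (n - 1)))) *
    phi q (q / a) (fun i => q / p i) (Q (-n + 2) / s) (Q (n + 1))

/-- The quotient `x / y` as a point of the Riemann sphere, for `x`, `y` not both zero. -/
def sphereQuot (x y : ℂ) : OnePoint ℂ :=
  open Classical in if y = 0 then OnePoint.infty else ((x / y : ℂ) : OnePoint ℂ)

/-- The continued fraction `1/α₀ - β₁/α₁ - β₂/α₂ - ⋯`, i.e.
`1 / (α₀ - β₁ / (α₁ - β₂ / (α₂ - ⋯)))`. -/
def contFrac (α β : ℕ → ℂ) : GenContFract ℂ where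
  h := 0
  s := Stream'.Seq.ofStream fun n => ⟨if n = 0 then 1 else -β n, α n⟩

/-- The continued fraction `1/α₀ - β₁/α₁ - β₂/α₂ - ⋯` converges to the point `L` of the
Riemann sphere: its approximants (quotients of its continuants) tend to `L`. -/
def ContFracConverges (α β : ℕ → ℂ) (L : OnePoint ℂ) : Prop :=
  Tendsto (fun N => sphereQuot ((contFrac α β).nums N) ((contFrac α β).dens N)) atTop (𝓝 L)

end QCF

end

/-! In the variable `x = q ^ n`, both `X_n^{(1)}` and `X_n^{(2)}` are an elementary factor times
functions `sol₁ x`, `sol₂ x` that are meromorphic in `x ≠ 0`. The continuants of the continued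
fraction solve the three-term recurrence `X_{n+1} - a_n X_n + b_n X_{n-1} = 0`, so they are
combinations of two known solutions, and the asymptotics of these solutions give the limit.

**The recurrence.** It comes from a contiguous relation for balanced very-well-poised `₁₀φ₉`
series (`phi_contiguous`). A partial-fraction type identity writes a combination of the summands
of three contiguous series as a difference of consecutive terms: the difference of the two
products that arise in telescoping is antisymmetric under `X ↦ 1 / (a X)`, hence `X (1 - a X²)`
times a quadratic in `a X + 1 / X`, and the quadratic is found by Lagrange interpolation
(`exists_quadratic_of_balanced`, `balanced_interpolation`). The series do not terminate for
generic `x`, so the telescoping leaves an inhomogeneous term (`sol₁_recurrence`,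
`sol₂_recurrence`). As `x → q ^ N` this term tends to zero, for the first solution because `(q ^
(-N - 1))_∞ = 0`, and for the second one because `s` is a power of `q` (`tendsto_tail₁`,
`tendsto_tail₂`). The limits of the coefficients and of the solutions at the points `q ^ N`
therefore satisfy the homogeneous recurrence. The two limiting solutions are linearly independent,
which is checked at `N = 0`, with the cases `s = q` and `s = q ^ 2` apart
(`exists_initial_values`).

**The asymptotics.** At `x = q ^ N` the series in both solutions terminate. As `N → ∞` their
summands tend to those of the `₈φ₇` series `W₁` and `W₂`, which may diverge. Summation by parts
replaces the argument `z` by `q z` and the coefficients `c k` by `(c k - c (k - 1)) / q ^ k`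
(`terminatingSum_eq`). The new coefficients are again bounded, since `c k` is an analytic function
of `q ^ k` (`UniformlyQAnalytic.qDiff`), so that after finitely many steps dominated convergence
applies. The same transformation of the power series constructs its analytic continuation
(`isContinuation_continuation`), and so the solutions tend to `W₁` and `W₂`
(`tendsto_terminatingSum`, `tendsto_sol₁_pow`, `tendsto_sol₂_pow`).

**Conclusion.** The quotients of continuants tend to a quotient of combinations of `W₁` and `W₂`
(`casoratian_mul_continuants`, `tendsto_sphereQuot`), and the limit `n → 0` on the other side is
the same quotient. It is a well-defined point of the Riemann sphere because `W₁` and `W₂` are not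
both zero: the limiting recurrence has characteristic roots `1` and `q`, and it does not have two
independent solutions that tend to zero (`casoratian_eq_zero`).
-/

namespace QCF

/-! ### `q`-shifted factorials -/

theorem qPoch_zero (q x : ℂ) : qPoch q x 0 = 1 := by simp [qPoch]

theorem qPoch_succ (q x : ℂ) (k : ℕ) : qPoch q x (k + 1) = qPoch q x k * (1 - x * q ^ k) := by
  simp [qPoch, Finset.prod_range_succ]

theorem qPoch_succ' (q x : ℂ) (k : ℕ) : qPoch q x (k + 1) = (1 - x) * qPoch q (x * q) k := by
  rw [qPoch_succ, ← qPoch_shift, mul_comm q x, mul_comm]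

theorem qPoch_one_left (q : ℂ) (k : ℕ) : qPoch q 1 (k + 1) = 0 := by
  rw [qPoch_succ', sub_self, zero_mul]

theorem qPoch_ne_zero {q x : ℂ} (h : ∀ j : ℕ, x * q ^ j ≠ 1) (k : ℕ) : qPoch q x k ≠ 0 :=
  Finset.prod_ne_zero_iff.2 fun i _ => sub_ne_zero.2 (h i).symm

theorem continuous_qPoch (q : ℂ) (k : ℕ) : Continuous fun x => qPoch q x k := by
  unfold qPoch
  fun_prop

section
variable {q : ℂ} (hq : ‖q‖ < 1)
include hq

theorem summable_norm_mul_pow (x : ℂ) : Summable fun i : ℕ => ‖x * q ^ i‖ := by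
  simp_rw [norm_mul, norm_pow]
  exact (summable_geometric_of_lt_one (norm_nonneg _) hq).mul_left _

theorem multipliable_qPochInf (x : ℂ) : Multipliable fun i : ℕ => 1 - x * q ^ i := by
  have := multipliable_one_add_of_summable (f := fun i : ℕ => -(x * q ^ i))
    (by simpa using summable_norm_mul_pow hq x)
  simpa [sub_eq_add_neg] using this

theorem tendsto_qPoch (x : ℂ) : Tendsto (qPoch q x) atTop (𝓝 (qPochInf q x)) :=
  (multipliable_qPochInf hq x).hasProd.tendsto_prod_nat

theorem qPochInf_eq_qPoch_mul (x : ℂ) (k : ℕ) :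
    qPochInf q x = qPoch q x k * qPochInf q (x * q ^ k) := by
  have h := multipliable_qPochInf hq (x * q ^ k)
  have := Multipliable.prod_mul_tprod_nat_mul' (f := fun i : ℕ => 1 - x * q ^ i) (k := k)
    (by simpa [pow_add, mul_assoc, mul_comm, mul_left_comm] using h)
  rw [qPochInf, ← this, qPoch, qPochInf]
  congr 1
  exact tprod_congr fun i => by ring

theorem qPochInf_eq (x : ℂ) : qPochInf q x = (1 - x) * qPochInf q (x * q) := by
  simpa [qPoch] using qPochInf_eq_qPoch_mul hq x 1

theorem qPochInf_ne_zero {x : ℂ} (h : ∀ j : ℕ, x * q ^ j ≠ 1) : qPochInf q x ≠ 0 := by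
  have := tprod_one_add_ne_zero_of_summable (f := fun i : ℕ => -(x * q ^ i))
    (fun i h0 => h i (by linear_combination -h0)) (by simpa using summable_norm_mul_pow hq x)
  simpa [qPochInf, sub_eq_add_neg] using this

theorem qPochInf_eq_zero {x : ℂ} {j : ℕ} (h : x * q ^ j = 1) : qPochInf q x = 0 := by
  rw [qPochInf_eq_qPoch_mul hq x (j + 1), qPoch_succ, h, sub_self, mul_zero, zero_mul]

theorem mul_pow_ne_one_of_qPochInf_ne_zero {x : ℂ} (h : qPochInf q x ≠ 0) (j : ℕ) :
    x * q ^ j ≠ 1 :=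
  fun h0 => h (qPochInf_eq_zero hq h0)

theorem norm_qPoch_le (x : ℂ) (k : ℕ) : ‖qPoch q x k‖ ≤ Real.exp (‖x‖ / (1 - ‖q‖)) := by
  have h1 : ‖qPoch q x k‖ ≤ ∏ i ∈ Finset.range k, Real.exp (‖x‖ * ‖q‖ ^ i) := by
    rw [qPoch, norm_prod]
    refine Finset.prod_le_prod (fun _ _ => norm_nonneg _) fun i _ => ?_
    have := norm_sub_le (1 : ℂ) (x * q ^ i)
    rw [norm_one, norm_mul, norm_pow] at this
    linarith [Real.add_one_le_exp (‖x‖ * ‖q‖ ^ i)]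
  refine h1.trans ?_
  rw [← Real.exp_sum, ← Finset.mul_sum, div_eq_mul_inv, ← tsum_geometric_of_lt_one (norm_nonneg _) hq]
  gcongr
  exact (summable_geometric_of_lt_one (norm_nonneg _) hq).sum_le_tsum _ fun _ _ => by positivity

theorem norm_qPochInf_le (x : ℂ) : ‖qPochInf q x‖ ≤ Real.exp (‖x‖ / (1 - ‖q‖)) :=
  le_of_tendsto (tendsto_qPoch hq x).norm (Eventually.of_forall (norm_qPoch_le hq x))

/-- A lower bound for finite products that does not depend on their length; it follows from
`(x)_∞ = (x)_k (x q ^ k)_∞`. -/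
theorem norm_qPochInf_le_mul_norm_qPoch (x : ℂ) (k : ℕ) :
    ‖qPochInf q x‖ ≤ Real.exp (‖x‖ / (1 - ‖q‖)) * ‖qPoch q x k‖ := by
  rw [qPochInf_eq_qPoch_mul hq x k, norm_mul, mul_comm]
  gcongr
  refine (norm_qPochInf_le hq _).trans ?_
  have h1 : 0 < 1 - ‖q‖ := by linarith
  gcongr
  rw [norm_mul, norm_pow]
  exact mul_le_of_le_one_right (norm_nonneg _) (pow_le_one₀ (norm_nonneg _) hq.le)

theorem differentiable_qPochInf : Differentiable ℂ (qPochInf q) := by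
  intro x₀
  have hU : IsOpen (Metric.ball (0 : ℂ) (‖x₀‖ + 1)) := Metric.isOpen_ball
  have h := Summable.hasProdLocallyUniformlyOn_nat_one_add hU
    (f := fun (i : ℕ) (x : ℂ) => -(x * q ^ i)) (u := fun i => (‖x₀‖ + 1) * ‖q‖ ^ i)
    ((summable_geometric_of_lt_one (norm_nonneg _) hq).mul_left _)
    (Eventually.of_forall fun i x hx => by
      rw [norm_neg, norm_mul, norm_pow]
      gcongr
      exact (mem_ball_zero_iff.1 hx).le)
    (fun i => by fun_prop)
  have h2 := h.tendstoLocallyUniformlyOn_finsetRange.differentiableOn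
    (Eventually.of_forall fun n => by fun_prop) hU
  have h3 : qPochInf q = fun x => ∏' i : ℕ, (1 + -(x * q ^ i)) := by
    funext x
    simp [qPochInf, sub_eq_add_neg]
  rw [h3]
  exact h2.differentiableAt (hU.mem_nhds (by simp))

theorem continuous_qPochInf : Continuous (qPochInf q) := (differentiable_qPochInf hq).continuous

omit hq in
theorem qPochInf_zero : qPochInf q 0 = 1 := by simp [qPochInf]

omit hq in
theorem tendsto_mul_pow_atTop (hq : ‖q‖ < 1) (x : ℂ) :
    Tendsto (fun N : ℕ => x * q ^ N) atTop (𝓝 0) := by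
  simpa using (tendsto_pow_atTop_nhds_zero_of_norm_lt_one hq).const_mul x

end

/-! ### The contiguous relation -/

/-- The elementary symmetric functions of five numbers, in terms of which the products
`∏ (1 - y p i)` and `∏ (1 - y / p i)` are polynomials in `y`. -/
theorem exists_esymm {p : Fin 5 → ℂ} (hp : ∀ i, p i ≠ 0) : ∃ e₁ e₂ e₃ e₄ : ℂ,
    (∀ y : ℂ, ∏ i, (1 - p i * y) =
      1 - e₁ * y + e₂ * y ^ 2 - e₃ * y ^ 3 + e₄ * y ^ 4 - (∏ i, p i) * y ^ 5) ∧
    ∀ y : ℂ, ∏ i, (1 - y / p i) = (∏ i, p i)⁻¹ * ((∏ i, p i) - e₄ * y +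
      e₃ * y ^ 2 - e₂ * y ^ 3 + e₁ * y ^ 4 - y ^ 5) := by
  have h0 := hp 0
  have h1 := hp 1
  have h2 := hp 2
  have h3 := hp 3
  have h4 := hp 4
  simp only [Fin.prod_univ_five]
  generalize p 0 = b at *
  generalize p 1 = c at *
  generalize p 2 = d at *
  generalize p 3 = e at *
  generalize p 4 = f at *
  refine ⟨b + c + d + e + f,
    b * (c + d + e + f) + c * (d + e + f) + d * (e + f) + e * f,
    b * (c * (d + e + f) + d * (e + f) + e * f) + c * (d * (e + f) + e * f) + d * e * f,
    b * (c * (d * (e + f) + e * f) + d * e * f) + c * d * e * f, fun y => by ring, fun y => ?_⟩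
  have hx : ∀ x : ℂ, x ≠ 0 → 1 - y / x = x⁻¹ * (x - y) := fun x hx => by field_simp
  rw [hx b h0, hx c h1, hx d h2, hx e h3, hx f h4]
  simp only [mul_inv]
  ring

/-- A very-well-poised summand is antisymmetric under `X ↦ 1 / (a X)`. For balanced parameters
this forces the difference of the two products, which is what a telescoping of the summands
produces, to be `X (1 - a X ^ 2)` times a quadratic polynomial in `a X + 1 / X`. -/
theorem exists_quadratic_of_balanced {a G H : ℂ} {p : Fin 5 → ℂ} (ha : a ≠ 0) (hp : ∀ i, p i ≠ 0)
    (hG : G ≠ 0) (hH : H ≠ 0) (hbal : G * H * ∏ i, p i = a ^ 3) :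
    ∃ P₀ P₁ P₂ : ℂ, ∀ X : ℂ,
      (1 - a * X) * (∏ i, (1 - p i * X)) * ((1 - G * X) * (1 - H * X)) -
        (1 - X) * (∏ i, (1 - a / p i * X)) * ((1 - a / G * X) * (1 - a / H * X)) =
      X * (1 - a * X ^ 2) *
        (P₀ * X ^ 2 + P₁ * (X * (1 + a * X ^ 2)) + P₂ * (1 + a * X ^ 2) ^ 2) := by
  obtain ⟨e₁, e₂, e₃, e₄, h1, h2⟩ := exists_esymm hp
  have hπ : (∏ i, p i) = a ^ 3 / (G * H) := by
    rw [eq_div_iff (mul_ne_zero hG hH), ← hbal]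
    ring
  -- the coefficients of `X`, `X ^ 2` and `X ^ 3` on the left determine the quadratic
  refine ⟨-(a * (G * H + e₁ * (G + H) + e₂)) - (e₁ * (G * H) + e₂ * (G + H) + e₃) +
      (e₃ * (G * H) / a + e₄ * (G * H) / a ^ 2 * (a * (G + H) / (G * H)) + a ^ 2 / (G * H) ) +
      (e₂ * (G * H) + e₃ * (G * H) / a * (a * (G + H) / (G * H)) +
        e₄ * (G * H) / a ^ 2 * (a ^ 2 / (G * H))) -
      a * (-a - e₁ - (G + H) + 1 + e₄ * (G * H) / a ^ 2 + a * (G + H) / (G * H)),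
    (G * H + e₁ * (G + H) + e₂) + a * (e₁ + (G + H)) -
      (e₃ * (G * H) / a + e₄ * (G * H) / a ^ 2 * (a * (G + H) / (G * H)) + a ^ 2 / (G * H)) -
      (e₄ * (G * H) / a ^ 2 + a * (G + H) / (G * H)),
    -a - e₁ - (G + H) + 1 + e₄ * (G * H) / a ^ 2 + a * (G + H) / (G * H), fun X => ?_⟩
  simp only [div_mul_eq_mul_div _ (p _)]
  rw [h1, h2, hπ]
  field_simp
  ring

/-- A polynomial of degree at most two with three distinct roots vanishes. -/
theorem quadratic_eq_zero {c₀ c₁ c₂ u v w : ℂ} (huv : u ≠ v) (huw : u ≠ w) (hvw : v ≠ w)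
    (hu : c₀ + c₁ * u + c₂ * u ^ 2 = 0) (hv : c₀ + c₁ * v + c₂ * v ^ 2 = 0)
    (hw : c₀ + c₁ * w + c₂ * w ^ 2 = 0) (t : ℂ) : c₀ + c₁ * t + c₂ * t ^ 2 = 0 := by
  have h1 : c₁ + c₂ * (u + v) = 0 :=
    mul_left_cancel₀ (sub_ne_zero.2 huv) (by linear_combination hu - hv)
  have h2 : c₁ + c₂ * (u + w) = 0 :=
    mul_left_cancel₀ (sub_ne_zero.2 huw) (by linear_combination hu - hw)
  have h3 : c₂ = 0 := mul_left_cancel₀ (sub_ne_zero.2 hvw) (by linear_combination h1 - h2)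
  have h4 : c₁ = 0 := by rw [h3] at h1; linear_combination h1
  rw [h3, h4] at hu ⊢
  linear_combination hu

/-- The factor `(1 - y X) (1 - a X / y)`; divided by `X` it depends on `X` only through
`a X + 1 / X`. -/
noncomputable def pairFactor (a y X : ℂ) : ℂ := (1 - y * X) * (1 - a / y * X)

theorem pairFactor_eq {a y : ℂ} (hy : y ≠ 0) (X : ℂ) :
    pairFactor a y X = 1 + a * X ^ 2 - X * (y + a / y) := by
  unfold pairFactor
  field_simp
  ring

/-- The quotient of one of the outer coefficients of the contiguous relation by its
`pairFactor`s. -/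
noncomputable def contigOuter (q a : ℂ) (p : Fin 5 → ℂ) (G H : ℂ) : ℂ :=
  -(H ^ 2 * (H - 1) * ∏ i, (1 - a / (p i * H))) / ((H - G) * (H - G * q) * (1 - a / (G * H * q)))

/-- Parameters for which the coefficients of the contiguous relation are defined. -/
structure ContigGeneric (q a G H : ℂ) : Prop where
  G_ne_zero : G ≠ 0
  H_ne_zero : H ≠ 0
  G_ne_one : G ≠ 1
  H_ne_one : H ≠ 1
  Gq_ne_one : G * q ≠ 1
  Hq_ne_one : H * q ≠ 1
  a_ne_Gq : a ≠ G * q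
  a_ne_Hq : a ≠ H * q
  a_ne_G : a ≠ G
  a_ne_H : a ≠ H
  a_ne_G_sq : a ≠ G ^ 2
  a_ne_H_sq : a ≠ H ^ 2
  a_ne_GH : a ≠ G * H
  a_ne_GHq : a ≠ G * H * q
  H_ne_G : H ≠ G
  H_ne_Gq : H ≠ G * q
  G_ne_Hq : G ≠ H * q

theorem ContigGeneric.symm {q a G H : ℂ} (h : ContigGeneric q a G H) : ContigGeneric q a H G :=
  ⟨h.H_ne_zero, h.G_ne_zero, h.H_ne_one, h.G_ne_one, h.Hq_ne_one, h.Gq_ne_one, h.a_ne_Hq,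
    h.a_ne_Gq, h.a_ne_H, h.a_ne_G, h.a_ne_H_sq, h.a_ne_G_sq, mul_comm G H ▸ h.a_ne_GH,
    mul_comm G H ▸ h.a_ne_GHq, h.H_ne_G.symm, h.G_ne_Hq, h.H_ne_Gq⟩

theorem pairFactor_one_ne_zero {a y : ℂ} (hy : y ≠ 0) (h1 : y ≠ 1) (h2 : a ≠ y) :
    pairFactor a y 1 ≠ 0 := by
  unfold pairFactor
  refine mul_ne_zero (sub_ne_zero.2 ?_) (sub_ne_zero.2 ?_)
  · simpa using h1.symm
  · rw [mul_one, ne_comm, Ne, div_eq_one_iff_eq hy]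
    exact h2

/-- Lagrange interpolation of the quadratic polynomial of `exists_quadratic_of_balanced` at the
values of `a X + 1 / X` for `X = 1 / G`, `X = 1 / H` and `X = 1`. -/
theorem balanced_interpolation {q a G H : ℂ} {p : Fin 5 → ℂ} (hq0 : q ≠ 0) (ha : a ≠ 0)
    (ha1 : a ≠ 1) (hp : ∀ i, p i ≠ 0) (hbal : G * H * ∏ i, p i = a ^ 3)
    (hgen : ContigGeneric q a G H) {X : ℂ} (hX : X ≠ 0) :
    (1 - a * X) * (∏ i, (1 - p i * X)) * ((1 - G * X) * (1 - H * X)) -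
        (1 - X) * (∏ i, (1 - a / p i * X)) * ((1 - a / G * X) * (1 - a / H * X)) =
      X * (1 - a * X ^ 2) *
        (contigOuter q a p G H * (pairFactor a G X * pairFactor a (G * q) X) +
          ((∏ i, (1 - p i)) * ((1 - G) * (1 - H)) -
            contigOuter q a p G H * (pairFactor a G 1 * pairFactor a (G * q) 1) -
            contigOuter q a p H G * (pairFactor a H 1 * pairFactor a (H * q) 1)) /
            (pairFactor a G 1 * pairFactor a H 1) * (pairFactor a G X * pairFactor a H X) +
          contigOuter q a p H G * (pairFactor a H X * pairFactor a (H * q) X)) := by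
  have hG := hgen.G_ne_zero
  have hH := hgen.H_ne_zero
  obtain ⟨P₀, P₁, P₂, hP⟩ := exists_quadratic_of_balanced ha hp hG hH hbal
  have hev : ∀ G H : ℂ, G ≠ 0 → H ≠ 0 → a ≠ H ^ 2 → (∀ X : ℂ,
      (1 - a * X) * (∏ i, (1 - p i * X)) * ((1 - G * X) * (1 - H * X)) -
        (1 - X) * (∏ i, (1 - a / p i * X)) * ((1 - a / G * X) * (1 - a / H * X)) =
      X * (1 - a * X ^ 2) *
        (P₀ * X ^ 2 + P₁ * (X * (1 + a * X ^ 2)) + P₂ * (1 + a * X ^ 2) ^ 2)) →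
      P₀ + P₁ * (H + a / H) + P₂ * (H + a / H) ^ 2 =
        -(H ^ 2 * (H - 1) * (∏ i, (1 - a / (p i * H))) * (1 - a / (G * H))) := by
    intro G H hG hH haH hP
    have h := hP (1 / H)
    have e : ∀ i, 1 - a / p i * (1 / H) = 1 - a / (p i * H) := fun i => by
      rw [div_mul_div_comm, mul_one]
    simp only [e] at h
    generalize (∏ i, (1 - a / (p i * H))) = t at h ⊢
    have h0 : H ^ 2 - a ≠ 0 := sub_ne_zero.2 haH.symm
    field_simp at h ⊢
    apply mul_left_cancel₀ h0
    linear_combination -h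
  have hα := hev G H hG hH hgen.a_ne_H_sq hP
  have hγ := hev H G hH hG hgen.a_ne_G_sq fun X => by rw [← hP X]; ring
  have h1 : P₀ + P₁ * (1 + a) + P₂ * (1 + a) ^ 2 = (∏ i, (1 - p i)) * ((1 - G) * (1 - H)) := by
    have h := hP 1
    have h0 : 1 - a ≠ 0 := sub_ne_zero.2 ha1.symm
    apply mul_left_cancel₀ h0
    simp only [mul_one] at h
    linear_combination -h
  rw [hP X]
  congr 1
  have hLG := pairFactor_one_ne_zero hG hgen.G_ne_one hgen.a_ne_G
  have hLH := pairFactor_one_ne_zero hH hgen.H_ne_one hgen.a_ne_H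
  set β := ((∏ i, (1 - p i)) * ((1 - G) * (1 - H)) -
            contigOuter q a p G H * (pairFactor a G 1 * pairFactor a (G * q) 1) -
            contigOuter q a p H G * (pairFactor a H 1 * pairFactor a (H * q) 1)) /
            (pairFactor a G 1 * pairFactor a H 1) with hβ
  have hβ' : β * (pairFactor a G 1 * pairFactor a H 1) =
      (∏ i, (1 - p i)) * ((1 - G) * (1 - H)) -
            contigOuter q a p G H * (pairFactor a G 1 * pairFactor a (G * q) 1) -
            contigOuter q a p H G * (pairFactor a H 1 * pairFactor a (H * q) 1) := by
    rw [hβ, div_mul_cancel₀ _ (mul_ne_zero hLG hLH)]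
  clear_value β
  have houter : ∀ G H : ℂ, ContigGeneric q a G H →
      contigOuter q a p G H * (((H + a / H) - (G + a / G)) * ((H + a / H) - (G * q + a / (G * q))))
        = -(H ^ 2 * (H - 1) * (∏ i, (1 - a / (p i * H))) * (1 - a / (G * H))) := by
    intro G H hgen
    have hG := hgen.G_ne_zero
    have hH := hgen.H_ne_zero
    have e1 : H + a / H - (G + a / G) = (H - G) * (1 - a / (G * H)) := by
      field_simp
      ring
    have e2 : (H + a / H) - (G * q + a / (G * q)) = (H - G * q) * (1 - a / (G * H * q)) := by
      field_simp
      ring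
    have n1 : H - G ≠ 0 := sub_ne_zero.2 hgen.H_ne_G
    have n2 : H - G * q ≠ 0 := sub_ne_zero.2 hgen.H_ne_Gq
    have n3 : 1 - a / (G * H * q) ≠ 0 := by
      rw [sub_ne_zero, ne_comm, Ne, div_eq_one_iff_eq (by positivity)]
      exact hgen.a_ne_GHq
    rw [e1, e2, contigOuter]
    generalize 1 - a / (G * H * q) = t at n3 ⊢
    generalize 1 - a / (G * H) = t'
    field_simp
  have hα' := houter G H hgen
  have hγ' := houter H G hgen.symm
  have hGq : G * q ≠ 0 := mul_ne_zero hG hq0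
  have hHq : H * q ≠ 0 := mul_ne_zero hH hq0
  rw [pairFactor_eq hG, pairFactor_eq hH, pairFactor_eq hGq, pairFactor_eq hHq] at hβ'
  rw [pairFactor_eq hG, pairFactor_eq hH, pairFactor_eq hGq, pairFactor_eq hHq]
  have d1 : G + a / G ≠ H + a / H := by
    have e1 : (G + a / G) - (H + a / H) = (G - H) * (1 - a / (G * H)) := by
      field_simp
      ring
    rw [← sub_ne_zero, e1]
    refine mul_ne_zero (sub_ne_zero.2 hgen.H_ne_G.symm) ?_
    rw [sub_ne_zero, ne_comm, Ne, div_eq_one_iff_eq (mul_ne_zero hG hH)]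
    exact hgen.a_ne_GH
  have d2 : G + a / G ≠ 1 + a := by
    intro h
    apply hLG
    rw [pairFactor_eq hG, h]
    ring
  have d3 : H + a / H ≠ 1 + a := by
    intro h
    apply hLH
    rw [pairFactor_eq hH, h]
    ring
  rw [← hα] at hα'
  rw [← hγ] at hγ'
  rw [← h1] at hβ'
  clear hα hγ h1 hβ houter hev hP
  generalize contigOuter q a p G H = α at *
  generalize contigOuter q a p H G = γ at *
  generalize G * q + a / (G * q) = eGq at *
  generalize H * q + a / (H * q) = eHq at *
  generalize G + a / G = eG at *
  generalize H + a / H = eH at *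
  have key := quadratic_eq_zero
    (c₀ := P₀ - α * (eG * eGq) - β * (eG * eH) - γ * (eH * eHq))
    (c₁ := P₁ + α * (eG + eGq) + β * (eG + eH) + γ * (eH + eHq))
    (c₂ := P₂ - α - β - γ) d1 d2 d3 (by linear_combination -hγ') (by linear_combination -hα')
    (by linear_combination -hβ') ((1 + a * X ^ 2) / X)
  field_simp at key
  linear_combination key

/-! ### Very-well-poised series with argument `q` -/

/-- The contribution `(x)_k / (a q / x)_k` of one parameter to a well-poised series. -/
noncomputable def wellPoised (q a x : ℂ) (k : ℕ) : ℂ := qPoch q x k / qPoch q (a * q / x) k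

theorem vwpCoeff_cons_cons (q a g h : ℂ) (p : Fin 5 → ℂ) (k : ℕ) :
    vwpCoeff q a (Matrix.vecCons g (Matrix.vecCons h p)) k =
      vwpCoeff q a p k * (wellPoised q a g k * wellPoised q a h k) := by
  unfold vwpCoeff wellPoised
  rw [Fin.prod_univ_succ, Fin.prod_univ_succ]
  simp only [Matrix.cons_val_zero, Matrix.cons_val_succ]
  ring

theorem phi_eq (q a : ℂ) (p : Fin 5 → ℂ) (g h : ℂ) :
    phi q a p g h =
      ∑' k : ℕ, vwpCoeff q a p k * (wellPoised q a g k * wellPoised q a h k) * q ^ k :=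
  tsum_congr fun k => by rw [vwpCoeff_cons_cons]

theorem phi_comm (q a : ℂ) (p : Fin 5 → ℂ) (g h : ℂ) : phi q a p g h = phi q a p h g := by
  rw [phi_eq, phi_eq]
  exact tsum_congr fun k => by ring

theorem vwpCoeff_zero {r : ℕ} (q : ℂ) {a : ℂ} (p : Fin r → ℂ) (ha1 : a ≠ 1) :
    vwpCoeff q a p 0 = 1 := by
  simp [vwpCoeff, qPoch_zero, div_self (sub_ne_zero.2 ha1.symm)]

theorem phi_one_left (q : ℂ) {a : ℂ} (p : Fin 5 → ℂ) (h : ℂ) (ha1 : a ≠ 1) :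
    phi q a p 1 h = 1 := by
  rw [phi_eq, tsum_eq_single 0]
  · simp [vwpCoeff_zero q p ha1, wellPoised, qPoch_zero]
  · intro k hk
    obtain ⟨j, rfl⟩ := Nat.exists_eq_succ_of_ne_zero hk
    simp [wellPoised, qPoch_one_left]

theorem phi_one_right (q : ℂ) {a : ℂ} (p : Fin 5 → ℂ) (g : ℂ) (ha1 : a ≠ 1) :
    phi q a p g 1 = 1 := by
  rw [phi_comm, phi_one_left q p g ha1]

theorem continuousAt_wellPoised {q a x : ℂ} (hx : x ≠ 0) (h : ∀ j : ℕ, a * q / x * q ^ j ≠ 1)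
    (k : ℕ) : ContinuousAt (fun y => wellPoised q a y k) x := by
  unfold wellPoised
  refine (continuous_qPoch q k).continuousAt.div ?_ (qPoch_ne_zero h k)
  exact ContinuousAt.comp (f := fun y => a * q / y) (g := fun y => qPoch q y k)
    (continuous_qPoch q k).continuousAt (continuousAt_const.div continuousAt_id hx)

section
variable {q : ℂ} (hq : ‖q‖ < 1)
include hq

theorem q_mul_pow_ne_one (j : ℕ) : q * q ^ j ≠ 1 := by
  intro h
  have := congrArg norm h
  rw [← pow_succ', norm_pow, norm_one] at this
  exact (pow_lt_one₀ (norm_nonneg _) hq j.succ_ne_zero).ne this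

theorem norm_wellPoised_le {a x : ℂ} (h : ∀ j : ℕ, a * q / x * q ^ j ≠ 1) (k : ℕ) :
    ‖wellPoised q a x k‖ ≤ Real.exp (‖x‖ / (1 - ‖q‖)) *
      (Real.exp (‖a * q / x‖ / (1 - ‖q‖)) / ‖qPochInf q (a * q / x)‖) := by
  have h0 := norm_pos_iff.2 (qPochInf_ne_zero hq h)
  have h1 := norm_pos_iff.2 (qPoch_ne_zero h k)
  rw [wellPoised, norm_div, div_eq_mul_inv]
  gcongr
  · exact norm_qPoch_le hq x k
  · rw [inv_le_comm₀ h1 (by positivity), inv_div, div_le_iff₀' (Real.exp_pos _)]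
    exact norm_qPochInf_le_mul_norm_qPoch hq _ k

/-- Locally uniform boundedness of `(x)_k / (a q / x)_k` in `x`, uniform in `k`. -/
theorem exists_eventually_norm_wellPoised_le {a x : ℂ} (hx : x ≠ 0)
    (h : ∀ j : ℕ, a * q / x * q ^ j ≠ 1) :
    ∃ B : ℝ, 0 ≤ B ∧ ∀ᶠ y in 𝓝 x, ∀ k, ‖wellPoised q a y k‖ ≤ B := by
  have h0 := qPochInf_ne_zero hq h
  have c1 : ContinuousAt (fun y => a * q / y) x := continuousAt_const.div continuousAt_id hx
  have c2 : ContinuousAt (fun y => qPochInf q (a * q / y)) x :=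
    ContinuousAt.comp (f := fun y => a * q / y) (continuous_qPochInf hq).continuousAt c1
  have c3 : ContinuousAt (fun y => Real.exp (‖y‖ / (1 - ‖q‖)) *
      (Real.exp (‖a * q / y‖ / (1 - ‖q‖)) / ‖qPochInf q (a * q / y)‖)) x := by
    refine ContinuousAt.mul (by fun_prop) (ContinuousAt.div ?_ c2.norm (norm_ne_zero_iff.2 h0))
    exact Real.continuous_exp.continuousAt.comp (c1.norm.div_const _)
  obtain ⟨B, hB⟩ : ∃ B : ℝ, ∀ᶠ y in 𝓝 x, ∀ k, ‖wellPoised q a y k‖ ≤ B := by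
    obtain ⟨B, hB⟩ := exists_gt (Real.exp (‖x‖ / (1 - ‖q‖)) *
      (Real.exp (‖a * q / x‖ / (1 - ‖q‖)) / ‖qPochInf q (a * q / x)‖))
    refine ⟨B, ?_⟩
    filter_upwards [c3.tendsto.eventually_lt_const hB, c2.eventually_ne h0] with y hy hy0 k
    exact (norm_wellPoised_le hq (mul_pow_ne_one_of_qPochInf_ne_zero hq hy0) k).trans hy.le
  exact ⟨B, (norm_nonneg _).trans (hB.self_of_nhds 0), hB⟩

theorem tendsto_wellPoised {a x : ℂ} (h : ∀ j : ℕ, a * q / x * q ^ j ≠ 1) :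
    Tendsto (wellPoised q a x) atTop (𝓝 (qPochInf q x / qPochInf q (a * q / x))) :=
  (tendsto_qPoch hq _).div (tendsto_qPoch hq _) (qPochInf_ne_zero hq h)

theorem tendsto_vwpCoeff {r : ℕ} {a : ℂ} {p : Fin r → ℂ}
    (h : ∀ i, ∀ j : ℕ, a * q / p i * q ^ j ≠ 1) :
    Tendsto (vwpCoeff q a p) atTop (𝓝 (qPochInf q a * ((1 - a * 0) / (1 - a)) *
      (∏ i, qPochInf q (p i) / qPochInf q (a * q / p i)) / qPochInf q q)) := by
  unfold vwpCoeff
  refine Tendsto.div (((tendsto_qPoch hq a).mul ?_).mul ?_) (tendsto_qPoch hq q)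
    (qPochInf_ne_zero hq (q_mul_pow_ne_one hq))
  · refine (Tendsto.sub tendsto_const_nhds (Tendsto.const_mul a ?_)).div_const _
    exact (tendsto_pow_atTop_nhds_zero_of_norm_lt_one hq).comp
      (tendsto_id.const_mul_atTop' (by norm_num))
  · exact tendsto_finsetProd _ fun i _ => tendsto_wellPoised hq (h i)

theorem exists_norm_vwpCoeff_le {r : ℕ} {a : ℂ} {p : Fin r → ℂ}
    (h : ∀ i, ∀ j : ℕ, a * q / p i * q ^ j ≠ 1) : ∃ B : ℝ, 0 ≤ B ∧ ∀ k, ‖vwpCoeff q a p k‖ ≤ B := by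
  obtain ⟨B, hB⟩ := (Metric.isBounded_range_of_tendsto _ (tendsto_vwpCoeff hq h)).exists_norm_le
  have h1 : ∀ k, ‖vwpCoeff q a p k‖ ≤ B := fun k => hB _ ⟨k, rfl⟩
  exact ⟨B, (norm_nonneg _).trans (h1 0), h1⟩

theorem hasSum_phi {a : ℂ} {p : Fin 5 → ℂ} {g h : ℂ}
    (hp : ∀ i, ∀ j : ℕ, a * q / p i * q ^ j ≠ 1) (hg : ∀ j : ℕ, a * q / g * q ^ j ≠ 1)
    (hh : ∀ j : ℕ, a * q / h * q ^ j ≠ 1) :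
    HasSum (fun k : ℕ => vwpCoeff q a p k * (wellPoised q a g k * wellPoised q a h k) * q ^ k)
      (phi q a p g h) := by
  obtain ⟨B, hB0, hB⟩ := exists_norm_vwpCoeff_le hq hp
  obtain ⟨B₁, hB₁⟩ : ∃ B, ∀ k, ‖wellPoised q a g k‖ ≤ B := ⟨_, norm_wellPoised_le hq hg⟩
  obtain ⟨B₂, hB₂⟩ : ∃ B, ∀ k, ‖wellPoised q a h k‖ ≤ B := ⟨_, norm_wellPoised_le hq hh⟩
  have hB₁0 := (norm_nonneg _).trans (hB₁ 0)
  rw [phi_eq]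
  refine (Summable.of_norm_bounded (g := fun k => B * (B₁ * B₂) * ‖q‖ ^ k)
    ((summable_geometric_of_lt_one (norm_nonneg _) hq).mul_left _) fun k => ?_).hasSum
  rw [norm_mul, norm_mul, norm_mul, norm_pow]
  gcongr
  · exact hB k
  · exact hB₁ k
  · exact hB₂ k

theorem tendsto_phi {a : ℂ} {p : Fin 5 → ℂ} {g h : ℂ} {ι : Type*} {l : Filter ι} {g' h' : ι → ℂ}
    (hp : ∀ i, ∀ j : ℕ, a * q / p i * q ^ j ≠ 1) (hg0 : g ≠ 0) (hh0 : h ≠ 0)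
    (hg : ∀ j : ℕ, a * q / g * q ^ j ≠ 1) (hh : ∀ j : ℕ, a * q / h * q ^ j ≠ 1)
    (hg' : Tendsto g' l (𝓝 g)) (hh' : Tendsto h' l (𝓝 h)) :
    Tendsto (fun x => phi q a p (g' x) (h' x)) l (𝓝 (phi q a p g h)) := by
  obtain ⟨B, hB0, hB⟩ := exists_norm_vwpCoeff_le hq hp
  obtain ⟨B₁, hB₁0, hB₁⟩ := exists_eventually_norm_wellPoised_le hq hg0 hg
  obtain ⟨B₂, hB₂0, hB₂⟩ := exists_eventually_norm_wellPoised_le hq hh0 hh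
  simp_rw [phi_eq]
  refine tendsto_tsum_of_dominated_convergence (bound := fun k => B * (B₁ * B₂) * ‖q‖ ^ k)
    ((summable_geometric_of_lt_one (norm_nonneg _) hq).mul_left _) (fun k => ?_) ?_
  · refine (((((continuousAt_wellPoised hg0 hg k).tendsto.comp hg').mul
      ((continuousAt_wellPoised hh0 hh k).tendsto.comp hh'))).const_mul _).mul_const _
  · filter_upwards [hg'.eventually hB₁, hh'.eventually hB₂] with x h1 h2 k
    rw [norm_mul, norm_mul, norm_mul, norm_pow]
    gcongr
    · exact hB k
    · exact h1 k
    · exact h2 k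

omit hq in
/-- Multiplying a parameter of a well-poised summand by `q` produces a `pairFactor`. -/
theorem wellPoised_mul_q {a y : ℂ} (hq0 : q ≠ 0) (hy : y ≠ 0) (hy1 : y ≠ 1)
    (h : ∀ j : ℕ, a / y * q ^ j ≠ 1) (k : ℕ) :
    wellPoised q a (y * q) k = wellPoised q a y k * (pairFactor a y (q ^ k) / pairFactor a y 1) := by
  have e1 : a * q / (y * q) = a / y := by field_simp
  have e2 : a * q / y = q * (a / y) := by ring
  have h1 := qPoch_shift q y k
  have h2 := qPoch_shift q (a / y) k
  have n1 : qPoch q (a / y) k ≠ 0 := qPoch_ne_zero h k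
  have n2 : qPoch q (q * (a / y)) k ≠ 0 :=
    qPoch_ne_zero (fun j => by
      have := h (j + 1)
      rwa [pow_succ', ← mul_assoc, mul_comm _ q] at this) k
  have n3 : 1 - y ≠ 0 := sub_ne_zero.2 hy1.symm
  have n4 : 1 - a / y ≠ 0 := sub_ne_zero.2 (by simpa using (h 0).symm)
  rw [wellPoised, wellPoised, e1, e2, mul_comm y q]
  unfold pairFactor
  rw [mul_one, mul_one, div_mul_div_comm, div_eq_div_iff n1 (by positivity)]
  linear_combination (qPoch q (q * (a / y)) k * (1 - a / y)) * h1 +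
    (qPoch q y k * (1 - y * q ^ k)) * h2

/-- The middle coefficient of the contiguous relation. -/
noncomputable def contigMiddle (q a : ℂ) (p : Fin 5 → ℂ) (G H : ℂ) : ℂ :=
  (∏ i, (1 - p i)) * ((1 - G) * (1 - H)) -
    contigOuter q a p G H * (pairFactor a G 1 * pairFactor a (G * q) 1) -
    contigOuter q a p H G * (pairFactor a H 1 * pairFactor a (H * q) 1)

/-- The inhomogeneous term of the contiguous relation: the limit of the telescoping terms. It
vanishes when one of the series terminates. -/
noncomputable def contigTail (q a : ℂ) (p : Fin 5 → ℂ) (G H : ℂ) : ℂ :=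
  qPochInf q a * (∏ i, qPochInf q (p i) / qPochInf q (a * q / p i)) / qPochInf q q *
    (qPochInf q G / qPochInf q (a * q / G) * (qPochInf q H / qPochInf q (a * q / H))) / (1 - a)

/-- The contiguous relation for balanced nonterminating very-well-poised `₁₀φ₉` series. By
`balanced_interpolation` the combination of the summands is a difference of consecutive terms. -/
theorem phi_contiguous {a G H : ℂ} {p : Fin 5 → ℂ} (hq0 : q ≠ 0) (ha : a ≠ 0) (ha1 : a ≠ 1)
    (hp : ∀ i, p i ≠ 0) (hbal : G * H * ∏ i, p i = a ^ 3) (hgen : ContigGeneric q a G H)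
    (hpa : ∀ i, ∀ j : ℕ, a * q / p i * q ^ j ≠ 1)
    (hG : ∀ j : ℕ, a / (G * q) * q ^ j ≠ 1) (hH : ∀ j : ℕ, a / (H * q) * q ^ j ≠ 1) :
    contigOuter q a p G H * (pairFactor a G 1 * pairFactor a (G * q) 1) *
        phi q a p (G * q * q) H +
      contigMiddle q a p G H * phi q a p (G * q) (H * q) +
      contigOuter q a p H G * (pairFactor a H 1 * pairFactor a (H * q) 1) *
        phi q a p G (H * q * q) = contigTail q a p G H := by
  have hG0 := hgen.G_ne_zero
  have hH0 := hgen.H_ne_zero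
  have step : ∀ y : ℂ, y ≠ 0 → (∀ j : ℕ, a / (y * q) * q ^ j ≠ 1) → ∀ j : ℕ, a / y * q ^ j ≠ 1 := by
    intro y hy h j
    convert h (j + 1) using 1
    field_simp
    ring
  have step' : ∀ y : ℂ, (∀ j : ℕ, a / y * q ^ j ≠ 1) → ∀ j : ℕ, a * q / y * q ^ j ≠ 1 := by
    intro y h j
    convert h (j + 1) using 1
    ring
  have hG1 := step G hG0 hG
  have hH1 := step H hH0 hH
  have hG2 := step' G hG1
  have hH2 := step' H hH1
  have hG3 := step' (G * q) hG
  have hH3 := step' (H * q) hH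
  have hG4 : ∀ j : ℕ, a * q / (G * q * q) * q ^ j ≠ 1 := fun j => by
    convert hG j using 2
    field_simp
  have hH4 : ∀ j : ℕ, a * q / (H * q * q) * q ^ j ≠ 1 := fun j => by
    convert hH j using 2
    field_simp
  set c' : ℕ → ℂ := fun k => qPoch q a k * (∏ i, wellPoised q a (p i) k) / qPoch q q k with hc'
  set T : ℕ → ℂ := fun k => c' k * (wellPoised q a G k * wellPoised q a H k) *
    ((1 - q ^ k) * (∏ i, (1 - a / p i * q ^ k)) *
      ((1 - a / G * q ^ k) * (1 - a / H * q ^ k))) / (1 - a) with hT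
  have h1a : 1 - a ≠ 0 := sub_ne_zero.2 ha1.symm
  have wp_succ : ∀ y : ℂ, (∀ j : ℕ, a * q / y * q ^ j ≠ 1) → ∀ k,
      wellPoised q a y (k + 1) * (1 - a / y * q ^ (k + 1)) =
        wellPoised q a y k * (1 - y * q ^ k) := by
    intro y hy k
    have n1 : qPoch q (a * q / y) k ≠ 0 := qPoch_ne_zero hy k
    have n2 : 1 - a * q / y * q ^ k ≠ 0 := sub_ne_zero.2 (hy k).symm
    rw [wellPoised, wellPoised, qPoch_succ, qPoch_succ,
      show 1 - a / y * q ^ (k + 1) = 1 - a * q / y * q ^ k by ring]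
    generalize 1 - a * q / y * q ^ k = t at n2 ⊢
    field_simp
  have c'_succ : ∀ k, c' (k + 1) * ((1 - q ^ (k + 1)) * ∏ i, (1 - a / p i * q ^ (k + 1))) =
      c' k * ((1 - a * q ^ k) * ∏ i, (1 - p i * q ^ k)) := by
    intro k
    have n1 : qPoch q q k ≠ 0 := qPoch_ne_zero (q_mul_pow_ne_one hq) k
    have n2 : 1 - q * q ^ k ≠ 0 := sub_ne_zero.2 (q_mul_pow_ne_one hq k).symm
    have e : (∏ i, wellPoised q a (p i) (k + 1)) * ∏ i, (1 - a / p i * q ^ (k + 1)) =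
        (∏ i, wellPoised q a (p i) k) * ∏ i, (1 - p i * q ^ k) := by
      rw [← Finset.prod_mul_distrib, ← Finset.prod_mul_distrib]
      exact Finset.prod_congr rfl fun i _ => wp_succ _ (hpa i) k
    simp only [hc']
    rw [qPoch_succ, qPoch_succ, pow_succ' q k]
    rw [pow_succ' q k] at e
    generalize 1 - q * q ^ k = t at n2 ⊢
    generalize ∏ i, (1 - a / p i * (q * q ^ k)) = t₁ at e ⊢
    generalize ∏ i, (1 - p i * q ^ k) = t₂ at e ⊢
    field_simp
    linear_combination qPoch q a k * (1 - a * q ^ k) * e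
  have hdiff : ∀ k, T (k + 1) - T k = c' k * (wellPoised q a G k * wellPoised q a H k) *
      ((1 - a * q ^ k) * (∏ i, (1 - p i * q ^ k)) * ((1 - G * q ^ k) * (1 - H * q ^ k)) -
        (1 - q ^ k) * (∏ i, (1 - a / p i * q ^ k)) *
          ((1 - a / G * q ^ k) * (1 - a / H * q ^ k))) / (1 - a) := by
    intro k
    have e : T (k + 1) = c' (k + 1) * ((1 - q ^ (k + 1)) * ∏ i, (1 - a / p i * q ^ (k + 1))) *
        ((wellPoised q a G (k + 1) * (1 - a / G * q ^ (k + 1))) *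
          (wellPoised q a H (k + 1) * (1 - a / H * q ^ (k + 1)))) / (1 - a) := by
      simp only [hT]
      ring
    rw [e, c'_succ, wp_succ G hG2, wp_succ H hH2]
    simp only [hT]
    ring
  have hsum := (((hasSum_phi hq hpa hG4 hH2).mul_left
      (contigOuter q a p G H * (pairFactor a G 1 * pairFactor a (G * q) 1))).add
    ((hasSum_phi hq hpa hG3 hH3).mul_left (contigMiddle q a p G H))).add
    ((hasSum_phi hq hpa hG2 hH4).mul_left
      (contigOuter q a p H G * (pairFactor a H 1 * pairFactor a (H * q) 1)))
  have hterm : ∀ k, T (k + 1) - T k =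
      contigOuter q a p G H * (pairFactor a G 1 * pairFactor a (G * q) 1) *
        (vwpCoeff q a p k * (wellPoised q a (G * q * q) k * wellPoised q a H k) * q ^ k) +
      contigMiddle q a p G H *
        (vwpCoeff q a p k * (wellPoised q a (G * q) k * wellPoised q a (H * q) k) * q ^ k) +
      contigOuter q a p H G * (pairFactor a H 1 * pairFactor a (H * q) 1) *
        (vwpCoeff q a p k * (wellPoised q a G k * wellPoised q a (H * q * q) k) * q ^ k) := by
    intro k
    have n1 := pairFactor_one_ne_zero hG0 hgen.G_ne_one hgen.a_ne_G
    have n2 := pairFactor_one_ne_zero hH0 hgen.H_ne_one hgen.a_ne_H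
    have n3 := pairFactor_one_ne_zero (mul_ne_zero hG0 hq0) hgen.Gq_ne_one hgen.a_ne_Gq
    have n4 := pairFactor_one_ne_zero (mul_ne_zero hH0 hq0) hgen.Hq_ne_one hgen.a_ne_Hq
    have e : vwpCoeff q a p k = c' k * (1 - a * (q ^ k) ^ 2) / (1 - a) := by
      simp only [hc', vwpCoeff, wellPoised, pow_mul']
      ring
    rw [hdiff, balanced_interpolation hq0 ha ha1 hp hbal hgen (pow_ne_zero k hq0),
      wellPoised_mul_q hq0 (mul_ne_zero hG0 hq0) hgen.Gq_ne_one hG,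
      wellPoised_mul_q hq0 (mul_ne_zero hH0 hq0) hgen.Hq_ne_one hH,
      wellPoised_mul_q hq0 hG0 hgen.G_ne_one hG1, wellPoised_mul_q hq0 hH0 hgen.H_ne_one hH1, e,
      ← contigMiddle]
    generalize contigMiddle q a p G H = β
    generalize pairFactor a G 1 = LG at *
    generalize pairFactor a H 1 = LH at *
    generalize pairFactor a (G * q) 1 = LGq at *
    generalize pairFactor a (H * q) 1 = LHq at *
    field_simp
  have hlim : Tendsto T atTop (𝓝 (contigTail q a p G H)) := by
    have hpow := tendsto_pow_atTop_nhds_zero_of_norm_lt_one hq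
    have l1 : Tendsto c' atTop (𝓝 (qPochInf q a *
        (∏ i, qPochInf q (p i) / qPochInf q (a * q / p i)) / qPochInf q q)) :=
      ((tendsto_qPoch hq a).mul (tendsto_finsetProd _ fun i _ => tendsto_wellPoised hq (hpa i))).div
        (tendsto_qPoch hq q) (qPochInf_ne_zero hq (q_mul_pow_ne_one hq))
    have l2 : Tendsto (fun k : ℕ => (1 - q ^ k) * (∏ i, (1 - a / p i * q ^ k)) *
      ((1 - a / G * q ^ k) * (1 - a / H * q ^ k))) atTop (𝓝 1) := by
      have hc : Continuous fun X : ℂ => (1 - X) * (∏ i, (1 - a / p i * X)) *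
        ((1 - a / G * X) * (1 - a / H * X)) := by fun_prop
      simpa [Function.comp_def] using (hc.tendsto 0).comp hpow
    have := ((l1.mul ((tendsto_wellPoised hq hG2).mul (tendsto_wellPoised hq hH2))).mul l2).div_const
      (1 - a)
    rwa [mul_one] at this
  have h0 : T 0 = 0 := by simp [hT]
  have h2 := hsum.tendsto_sum_nat
  simp only [← hterm, Finset.sum_range_sub, h0, sub_zero] at h2
  exact tendsto_nhds_unique h2 hlim

end

/-! ### The recurrence in the variable `x = q ^ n` -/

/-- `y` is not an integer power of `q`. -/
def NotPow (q y : ℂ) : Prop := ∀ k : ℤ, y * q ^ k ≠ 1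

theorem NotPow.ne {q y u v : ℂ} (h : NotPow q y) (k : ℤ) (hu : u ≠ 0) (e : v = y * q ^ k * u) :
    u ≠ v := by
  rintro rfl
  exact h k (mul_right_cancel₀ hu (by rw [one_mul]; exact e.symm))

theorem NotPow.one_sub_ne_zero {q y v : ℂ} (h : NotPow q y) (k : ℤ) (e : v = y * q ^ k) :
    1 - v ≠ 0 :=
  sub_ne_zero.2 (h.ne k one_ne_zero (by rw [e, mul_one]))

theorem NotPow.sub_ne_zero {q y u v : ℂ} (h : NotPow q y) (k : ℤ) (hu : u ≠ 0)
    (e : v = y * q ^ k * u) : u - v ≠ 0 :=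
  _root_.sub_ne_zero.2 (h.ne k hu e)

theorem NotPow.mul_pow_ne_one {q y v : ℂ} (hq0 : q ≠ 0) (h : NotPow q y) (k : ℤ)
    (e : v = y * q ^ k) (j : ℕ) : v * q ^ j ≠ 1 := by
  have := h (k + j)
  rwa [zpow_add₀ hq0, zpow_natCast, ← mul_assoc, ← e] at this

theorem NotPow.inv {q y : ℂ} (h : NotPow q y) : NotPow q y⁻¹ := by
  intro k hk
  apply h (-k)
  rw [zpow_neg, ← inv_inj, mul_inv, inv_inv, inv_one]
  exact hk

theorem NotPow.mul_zpow {q y : ℂ} (hq0 : q ≠ 0) (h : NotPow q y) (j : ℤ) :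
    NotPow q (y * q ^ j) := by
  intro k
  rw [mul_assoc, ← zpow_add₀ hq0]
  exact h _

/-- The standing assumptions on the parameters of the continued fraction, where `s` is nonzero
but need not be a power of `q`. -/
structure Params (q s a : ℂ) (p : Fin 5 → ℂ) : Prop where
  norm_q : ‖q‖ < 1
  q_ne_zero : q ≠ 0
  s_ne_zero : s ≠ 0
  a_ne_zero : a ≠ 0
  p_ne_zero : ∀ i, p i ≠ 0
  a_notPow : NotPow q a
  sa_notPow : NotPow q (s / a)
  p_notPow : ∀ i, NotPow q (p i / a)
  balanced : s * ∏ i, p i = a ^ 3 * q ^ 3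

theorem Params.a_ne_one {q s a : ℂ} {p : Fin 5 → ℂ} (P : Params q s a p) : a ≠ 1 := by
  simpa using P.a_notPow 0

theorem Params.prod_eq {q s a : ℂ} {p : Fin 5 → ℂ} (P : Params q s a p) :
    ∏ i, p i = a ^ 3 * q ^ 3 / s := by
  rw [eq_div_iff P.s_ne_zero, ← P.balanced, mul_comm]

theorem Params.well_poised {q s a : ℂ} {p : Fin 5 → ℂ} (P : Params q s a p) (i : Fin 5) (j : ℕ) :
    a * q / p i * q ^ j ≠ 1 := by
  have h1 := P.a_ne_zero
  have h2 := P.p_ne_zero i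
  exact (P.p_notPow i).inv.mul_pow_ne_one P.q_ne_zero 1 (by rw [zpow_one]; field_simp) j

/-- The assumptions are invariant under the involution that relates the two solutions of the
recurrence. -/
theorem Params.dual {q s a : ℂ} {p : Fin 5 → ℂ} (P : Params q s a p) :
    Params q (q ^ 4 / s) (q / a) (fun i => q / p i) := by
  have hq0 := P.q_ne_zero
  have hs := P.s_ne_zero
  have ha := P.a_ne_zero
  refine ⟨P.norm_q, hq0, by positivity, by positivity,
    fun i => div_ne_zero hq0 (P.p_ne_zero i), ?_, ?_, fun i => ?_, ?_⟩
  · have := P.a_notPow.inv.mul_zpow hq0 1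
    rwa [zpow_one, inv_mul_eq_div] at this
  · have := P.sa_notPow.inv.mul_zpow hq0 3
    convert this using 1
    field_simp
  · have := (P.p_notPow i).inv
    have h2 := P.p_ne_zero i
    convert this using 1
    field_simp
  · rw [Finset.prod_div_distrib, P.prod_eq]
    simp only [Finset.prod_const, Finset.card_univ, Fintype.card_fin]
    field_simp

/-- Values of `x = q ^ n` at which none of the factors of the recurrence vanishes. -/
structure Generic (q s a : ℂ) (p : Fin 5 → ℂ) (x : ℂ) : Prop where
  ne_zero : x ≠ 0
  x_notPow : NotPow q x
  sx_notPow : NotPow q (s * x)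
  sxx_notPow : NotPow q (s * x ^ 2)
  ax_notPow : NotPow q (a * x)
  sxa_notPow : NotPow q (s * x / a)
  axx_notPow : NotPow q (a * x ^ 2)
  ssxxa_notPow : NotPow q (s ^ 2 * x ^ 2 / a)
  axp_notPow : ∀ i, NotPow q (a * x / p i)
  psxa_notPow : ∀ i, NotPow q (p i * s * x / a)

/-- The coefficient `a_n`, up to a factor, as a rational function of `x = q ^ n`. -/
noncomputable def recA (q s a : ℂ) (p : Fin 5 → ℂ) (x : ℂ) : ℂ :=
  ((1 - s * x / q) * (1 - s * x / (a * q)) * (1 - s * x / (a * q ^ 2)) *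
        (∏ i, (1 - a * q * x / p i)) / (1 - s * x ^ 2) +
      q * (1 - x) * (1 - a * x) * (1 - a * q * x) * (∏ i, (1 - p i * (s * x / (a * q ^ 2)))) /
        (1 - s * x ^ 2 / q ^ 2) +
      s * x ^ 2 / (a * q) * (1 - s * x ^ 2 / q) * (1 - s / (a * q ^ 2)) * ∏ i, (1 - p i)) /
    ((1 - s * x ^ 2 / q) * (1 - s * x / (a * q ^ 2)) * (1 - a * q * x))

/-- The coefficient `b_n`, up to a factor, as a rational function of `x = q ^ n`. -/
noncomputable def recB (q s a : ℂ) (p : Fin 5 → ℂ) (x : ℂ) : ℂ :=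
  (1 - x) * (1 - s * x / q ^ 2) * (∏ i, (1 - a * x / p i)) *
      (∏ i, (1 - p i * (s * x / (a * q ^ 2)))) /
    ((1 - s * x ^ 2 / q) * (1 - s * x ^ 2 / q ^ 2) ^ 2 * (1 - s * x ^ 2 / q ^ 3))

/-- The infinite products in the first solution. -/
noncomputable def factor₁ (q s a : ℂ) (p : Fin 5 → ℂ) (x : ℂ) : ℂ :=
  qPochInf q (s * x ^ 2 / q) * qPochInf q (a * q * x) /
    (qPochInf q (s * x / q) * qPochInf q (s * x / (a * q)) * ∏ i, qPochInf q (a * q * x / p i))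

/-- The infinite products in the second solution. -/
noncomputable def factor₂ (q s a : ℂ) (p : Fin 5 → ℂ) (x : ℂ) : ℂ :=
  qPochInf q (s * x / a) * qPochInf q (s * x ^ 2 / q) /
    (qPochInf q (q * x) * qPochInf q (a * x) * ∏ i, qPochInf q (p i * (s * x / (a * q))))

/-- The first solution `X_n^{(1)}`, without its elementary factor, as a function of `x = q ^ n`. -/
noncomputable def sol₁ (q s a : ℂ) (p : Fin 5 → ℂ) (x : ℂ) : ℂ :=
  factor₁ q s a p x * phi q a p (s * x / q) (1 / x)

/-- The second solution `X_n^{(2)}`, without its elementary factor, as a function of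
`x = q ^ n`. -/
noncomputable def sol₂ (q s a : ℂ) (p : Fin 5 → ℂ) (x : ℂ) : ℂ :=
  factor₂ q s a p x * phi q (q / a) (fun i => q / p i) (q ^ 2 / (s * x)) (q * x)

/-- The two solutions lead to different expressions for `recA`. That they agree is an identity
linear in the elementary symmetric functions of the five parameters. -/
theorem middle_identity {q s a x e₁ e₂ e₃ e₄ e₅ : ℂ} (hq : q ≠ 0) (hs : s ≠ 0) (ha : a ≠ 0)
    (h5 : e₅ = a ^ 3 * q ^ 3 / s)
    (d1 : 1 - s * x ^ 2 ≠ 0) (d2 : q - s * x ^ 2 ≠ 0) (d3 : q ^ 2 - s * x ^ 2 ≠ 0)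
    (d4 : 1 - a * q * x ≠ 0) (d5 : a * q ^ 2 - s * x ≠ 0) (d6 : a - s * x ≠ 0)
    (d7 : q - a * x ≠ 0) (f g : ℂ → ℂ)
    (hf : ∀ y, f y = 1 - e₁ * y + e₂ * y ^ 2 - e₃ * y ^ 3 + e₄ * y ^ 4 - e₅ * y ^ 5)
    (hg : ∀ y, g y = e₅⁻¹ * (e₅ - e₄ * y + e₃ * y ^ 2 - e₂ * y ^ 3 + e₁ * y ^ 4 - y ^ 5)) :
    (q - s * x) * (a * q - s * x) / (a * q * (q - s * x ^ 2) * (1 - s * x ^ 2) * (1 - a * q * x)) *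
        g (a * q * x) +
      a * q ^ 6 * (1 - x) * (1 - a * x) /
        ((q - s * x ^ 2) * (q ^ 2 - s * x ^ 2) * (a * q ^ 2 - s * x)) * f (s * x / (a * q ^ 2)) +
      s * x ^ 2 * (a * q ^ 2 - s) / (a * q * (a * q ^ 2 - s * x) * (1 - a * q * x)) * f 1 =
    a * q * (1 - q * x) * (1 - a * x) / ((a - s * x) * (q - s * x ^ 2) * (1 - s * x ^ 2)) *
        f (s * x / (a * q)) +
      q ^ 2 * (q ^ 2 - s * x) * (a * q - s * x) /
        (a * (q - s * x ^ 2) * (q ^ 2 - s * x ^ 2) * (q - a * x)) * g (a * x) -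
      a ^ 2 * x ^ 2 * (a * q - s) / (q * (a - s * x) * (q - a * x)) * g q := by
  obtain ⟨D₁, hD1⟩ : ∃ D, D = 1 - s * x ^ 2 := ⟨_, rfl⟩
  obtain ⟨D₂, hD2⟩ : ∃ D, D = q - s * x ^ 2 := ⟨_, rfl⟩
  obtain ⟨D₃, hD3⟩ : ∃ D, D = q ^ 2 - s * x ^ 2 := ⟨_, rfl⟩
  obtain ⟨D₄, hD4⟩ : ∃ D, D = 1 - a * q * x := ⟨_, rfl⟩
  obtain ⟨D₅, hD5⟩ : ∃ D, D = a * q ^ 2 - s * x := ⟨_, rfl⟩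
  obtain ⟨D₆, hD6⟩ : ∃ D, D = a - s * x := ⟨_, rfl⟩
  obtain ⟨D₇, hD7⟩ : ∃ D, D = q - a * x := ⟨_, rfl⟩
  rw [← hD1] at d1 ⊢
  rw [← hD2] at d2 ⊢
  rw [← hD3] at d3 ⊢
  rw [← hD4] at d4 ⊢
  rw [← hD5] at d5 ⊢
  rw [← hD6] at d6 ⊢
  rw [← hD7] at d7 ⊢
  simp only [hf, hg, h5, one_pow, mul_one]
  clear hf hg h5
  field_simp
  rw [hD1, hD2, hD3, hD4, hD5, hD6, hD7]
  ring

section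
variable {q s a x : ℂ} {p : Fin 5 → ℂ} (P : Params q s a p) (g : Generic q s a p x)
include P g

omit P in
theorem Generic.one_sub_sxx : 1 - s * x ^ 2 ≠ 0 := g.sxx_notPow.one_sub_ne_zero 0 (by simp)
theorem Generic.q_sub_sxx : q - s * x ^ 2 ≠ 0 := by
  have := P.q_ne_zero
  exact g.sxx_notPow.sub_ne_zero (-1) this (by field_simp)
theorem Generic.q_sq_sub_sxx : q ^ 2 - s * x ^ 2 ≠ 0 := by
  have := P.q_ne_zero
  exact g.sxx_notPow.sub_ne_zero (-2) (pow_ne_zero 2 this) (by field_simp)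
theorem Generic.q_cube_sub_sxx : q ^ 3 - s * x ^ 2 ≠ 0 := by
  have := P.q_ne_zero
  exact g.sxx_notPow.sub_ne_zero (-3) (pow_ne_zero 3 this) (by field_simp)
omit P in
theorem Generic.one_sub_aqx : 1 - a * q * x ≠ 0 :=
  g.ax_notPow.one_sub_ne_zero 1 (by rw [zpow_one]; ring)
theorem Generic.aq_sq_sub_sx : a * q ^ 2 - s * x ≠ 0 := by
  have h1 := P.q_ne_zero
  have h2 := P.a_ne_zero
  exact g.sxa_notPow.sub_ne_zero (-2) (by positivity) (by field_simp)
theorem Generic.aq_sub_sx : a * q - s * x ≠ 0 := by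
  have h1 := P.q_ne_zero
  have h2 := P.a_ne_zero
  exact g.sxa_notPow.sub_ne_zero (-1) (by positivity) (by field_simp)
theorem Generic.a_sub_sx : a - s * x ≠ 0 := by
  have h2 := P.a_ne_zero
  exact g.sxa_notPow.sub_ne_zero 0 h2 (by field_simp)
theorem Generic.q_sub_ax : q - a * x ≠ 0 := by
  have h2 := P.q_ne_zero
  exact g.ax_notPow.sub_ne_zero (-1) h2 (by field_simp)
omit P in
theorem Generic.one_sub_ax : 1 - a * x ≠ 0 := g.ax_notPow.one_sub_ne_zero 0 (by simp)
omit P in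
theorem Generic.one_sub_x : 1 - x ≠ 0 := g.x_notPow.one_sub_ne_zero 0 (by simp)
omit P in
theorem Generic.one_sub_qx : 1 - q * x ≠ 0 :=
  g.x_notPow.one_sub_ne_zero 1 (by rw [zpow_one]; ring)
theorem Generic.q_sub_sx : q - s * x ≠ 0 := by
  have h2 := P.q_ne_zero
  exact g.sx_notPow.sub_ne_zero (-1) h2 (by field_simp)
theorem Generic.q_sq_sub_sx : q ^ 2 - s * x ≠ 0 := by
  have h2 := P.q_ne_zero
  exact g.sx_notPow.sub_ne_zero (-2) (pow_ne_zero 2 h2) (by field_simp)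

omit g in
theorem Params.aq_sq_sub_s : a * q ^ 2 - s ≠ 0 := by
  have h1 := P.q_ne_zero
  have h2 := P.a_ne_zero
  exact P.sa_notPow.sub_ne_zero (-2) (by positivity) (by field_simp)
omit g in
theorem Params.aq_sub_s : a * q - s ≠ 0 := by
  have h1 := P.q_ne_zero
  have h2 := P.a_ne_zero
  exact P.sa_notPow.sub_ne_zero (-1) (by positivity) (by field_simp)

theorem contigGeneric₁ : ContigGeneric q a (s * x / q ^ 2) (1 / (q * x)) := by
  have hq := P.q_ne_zero
  have hs := P.s_ne_zero
  have ha := P.a_ne_zero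
  have hx := g.ne_zero
  have hG : s * x / q ^ 2 ≠ 0 := by positivity
  have hH : 1 / (q * x) ≠ 0 := one_div_ne_zero (mul_ne_zero hq hx)
  exact
  { G_ne_zero := hG
    H_ne_zero := hH
    G_ne_one := (g.sx_notPow.ne (-2) one_ne_zero (by field_simp)).symm
    H_ne_one := g.x_notPow.ne 1 hH (by field_simp)
    Gq_ne_one := (g.sx_notPow.ne (-1) one_ne_zero (by field_simp)).symm
    Hq_ne_one := g.x_notPow.ne 0 (mul_ne_zero hH hq) (by field_simp)
    a_ne_Gq := g.sxa_notPow.ne (-1) ha (by field_simp)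
    a_ne_Hq := (g.ax_notPow.ne 0 (mul_ne_zero hH hq) (by field_simp)).symm
    a_ne_G := g.sxa_notPow.ne (-2) ha (by field_simp)
    a_ne_H := (g.ax_notPow.ne 1 hH (by field_simp)).symm
    a_ne_G_sq := g.ssxxa_notPow.ne (-4) ha (by field_simp)
    a_ne_H_sq := (g.axx_notPow.ne 2 (pow_ne_zero 2 hH) (by field_simp)).symm
    a_ne_GH := P.sa_notPow.ne (-3) ha (by field_simp)
    a_ne_GHq := P.sa_notPow.ne (-2) ha (by field_simp)
    H_ne_G := g.sxx_notPow.ne (-1) hH (by field_simp)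
    H_ne_Gq := g.sxx_notPow.ne 0 hH (by field_simp)
    G_ne_Hq := (g.sxx_notPow.ne (-2) (mul_ne_zero hH hq) (by field_simp)).symm }

theorem contigGeneric₂ : ContigGeneric q (q / a) (q / (s * x)) x := by
  have hq := P.q_ne_zero
  have hs := P.s_ne_zero
  have ha := P.a_ne_zero
  have hx := g.ne_zero
  have hG : q / (s * x) ≠ 0 := by positivity
  exact
  { G_ne_zero := hG
    H_ne_zero := hx
    G_ne_one := g.sx_notPow.ne (-1) hG (by field_simp)
    H_ne_one := (g.x_notPow.ne 0 one_ne_zero (by field_simp)).symm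
    Gq_ne_one := g.sx_notPow.ne (-2) (by positivity) (by field_simp)
    Hq_ne_one := (g.x_notPow.ne 1 one_ne_zero (by field_simp)).symm
    a_ne_Gq := (g.sxa_notPow.ne (-1) (by positivity) (by field_simp)).symm
    a_ne_Hq := g.ax_notPow.ne 0 (by positivity) (by field_simp)
    a_ne_G := (g.sxa_notPow.ne 0 hG (by field_simp)).symm
    a_ne_H := g.ax_notPow.ne (-1) (by positivity) (by field_simp)
    a_ne_G_sq := (g.ssxxa_notPow.ne (-1) (by positivity) (by field_simp)).symm
    a_ne_H_sq := g.axx_notPow.ne (-1) (by positivity) (by field_simp)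
    a_ne_GH := (P.sa_notPow.ne 0 (by positivity) (by field_simp)).symm
    a_ne_GHq := (P.sa_notPow.ne (-1) (by positivity) (by field_simp)).symm
    H_ne_G := (g.sxx_notPow.ne (-1) hG (by field_simp)).symm
    H_ne_Gq := (g.sxx_notPow.ne (-2) (by positivity) (by field_simp)).symm
    G_ne_Hq := g.sxx_notPow.ne 0 hG (by field_simp) }

end

section
variable {q s a x : ℂ} {p : Fin 5 → ℂ} (P : Params q s a p) (g : Generic q s a p x)
include P g

/-- The coefficient in the form that the contiguous relation gives for the first solution. -/
theorem recA_eq : recA q s a p x =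
    (q - s * x) * (a * q - s * x) / (a * q * (q - s * x ^ 2) * (1 - s * x ^ 2) * (1 - a * q * x)) *
        (∏ i, (1 - a * q * x / p i)) +
      a * q ^ 6 * (1 - x) * (1 - a * x) /
        ((q - s * x ^ 2) * (q ^ 2 - s * x ^ 2) * (a * q ^ 2 - s * x)) *
        (∏ i, (1 - p i * (s * x / (a * q ^ 2)))) +
      s * x ^ 2 * (a * q ^ 2 - s) / (a * q * (a * q ^ 2 - s * x) * (1 - a * q * x)) *
        ∏ i, (1 - p i) := by
  have hq := P.q_ne_zero
  have ha := P.a_ne_zero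
  have d1 := g.one_sub_sxx
  have d2 := g.q_sub_sxx P
  have d3 := g.q_sq_sub_sxx P
  have d4 := g.one_sub_aqx
  have d5 := g.aq_sq_sub_sx P
  have e2 : 1 - s * x ^ 2 / q = (q - s * x ^ 2) / q := by field_simp
  have e3 : 1 - s * x ^ 2 / q ^ 2 = (q ^ 2 - s * x ^ 2) / q ^ 2 := by field_simp
  have e5 : 1 - s * x / (a * q ^ 2) = (a * q ^ 2 - s * x) / (a * q ^ 2) := by field_simp
  have e6 : 1 - s * x / q = (q - s * x) / q := by field_simp
  have e7 : 1 - s * x / (a * q) = (a * q - s * x) / (a * q) := by field_simp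
  have e8 : 1 - s / (a * q ^ 2) = (a * q ^ 2 - s) / (a * q ^ 2) := by field_simp
  rw [recA, e2, e3, e5, e6, e7, e8]
  generalize (∏ i, (1 - a * q * x / p i)) = t₁
  generalize (∏ i, (1 - p i * (s * x / (a * q ^ 2)))) = t₂
  generalize (∏ i, (1 - p i)) = t₃
  generalize 1 - s * x ^ 2 = D₁ at *
  generalize q - s * x ^ 2 = D₂ at *
  generalize q ^ 2 - s * x ^ 2 = D₃ at *
  generalize 1 - a * q * x = D₄ at *
  generalize a * q ^ 2 - s * x = D₅ at *
  field_simp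

/-- The coefficient in the form that the contiguous relation gives for the second solution. -/
theorem recA_eq' : recA q s a p x =
    a * q * (1 - q * x) * (1 - a * x) / ((a - s * x) * (q - s * x ^ 2) * (1 - s * x ^ 2)) *
        (∏ i, (1 - p i * (s * x / (a * q)))) +
      q ^ 2 * (q ^ 2 - s * x) * (a * q - s * x) /
        (a * (q - s * x ^ 2) * (q ^ 2 - s * x ^ 2) * (q - a * x)) * (∏ i, (1 - a * x / p i)) -
      a ^ 2 * x ^ 2 * (a * q - s) / (q * (a - s * x) * (q - a * x)) * ∏ i, (1 - q / p i) := by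
  obtain ⟨e₁, e₂, e₃, e₄, h1, h2⟩ := exists_esymm P.p_ne_zero
  rw [recA_eq P g]
  have := middle_identity P.q_ne_zero P.s_ne_zero P.a_ne_zero P.prod_eq g.one_sub_sxx
    (g.q_sub_sxx P) (g.q_sq_sub_sxx P) g.one_sub_aqx (g.aq_sq_sub_sx P) (g.a_sub_sx P)
    (g.q_sub_ax P) (fun y => ∏ i, (1 - p i * y)) (fun y => ∏ i, (1 - y / p i)) h1 h2
  simpa only [mul_one] using this

omit g in
theorem prod_one_sub_inv {y z : ℂ} (hy : y ≠ 0) (e : ∀ i, z / p i = (p i * y)⁻¹) :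
    ∏ i, (1 - z / p i) = -(s / (a ^ 3 * q ^ 3 * y ^ 5)) * ∏ i, (1 - p i * y) := by
  have h : ∀ i, 1 - z / p i = (1 - p i * y) * -(p i * y)⁻¹ := fun i => by
    have := P.p_ne_zero i
    rw [e i]
    field_simp
    ring
  have hq := P.q_ne_zero
  have hs := P.s_ne_zero
  have ha := P.a_ne_zero
  rw [Finset.prod_congr rfl fun i _ => h i, Finset.prod_mul_distrib, Finset.prod_neg,
    Finset.prod_inv_distrib, Finset.prod_mul_distrib, P.prod_eq]
  simp only [Finset.prod_const, Finset.card_univ, Fintype.card_fin]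
  generalize ∏ i, (1 - p i * y) = t
  field_simp

/-- The factor that turns the contiguous relation with `G = s x / q²`, `H = 1 / (q x)` into the
recurrence for the first solution. -/
noncomputable def scale₁ (q s a x : ℂ) : ℂ :=
  s * x ^ 3 * q ^ 2 * (a * q ^ 2 - s) /
    (a * (1 - a * q * x) * (1 - q * x) * (q ^ 2 - s * x) * (a * q ^ 2 - s * x))

theorem scale₁_mul_upper :
    scale₁ q s a x * (contigOuter q a p (s * x / q ^ 2) (1 / (q * x)) *
      (pairFactor a (s * x / q ^ 2) 1 * pairFactor a (s * x / q ^ 2 * q) 1)) =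
    (q - s * x) * (a * q - s * x) / (a * q * (q - s * x ^ 2) * (1 - s * x ^ 2) * (1 - a * q * x)) *
        (∏ i, (1 - a * q * x / p i)) := by
  have hq := P.q_ne_zero
  have hs := P.s_ne_zero
  have ha := P.a_ne_zero
  have hx := g.ne_zero
  have d1 := g.one_sub_sxx
  have d2 := g.q_sub_sxx P
  have d4 := g.one_sub_aqx
  have d5 := g.aq_sq_sub_sx P
  have d6 := g.one_sub_qx
  have d7 := g.q_sq_sub_sx P
  have d8 := P.aq_sq_sub_s
  have e0 : ∀ i, 1 - a / (p i * (1 / (q * x))) = 1 - a * q * x / p i := fun i => by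
    have := P.p_ne_zero i
    field_simp
  have e1 : 1 / (q * x) - s * x / q ^ 2 = (q - s * x ^ 2) / (q ^ 2 * x) := by field_simp
  have e2 : 1 / (q * x) - s * x / q ^ 2 * q = (1 - s * x ^ 2) / (q * x) := by field_simp
  have e3 : 1 - a / (s * x / q ^ 2 * (1 / (q * x)) * q) = -(a * q ^ 2 - s) / s := by
    field_simp
    ring
  have e4 : 1 / (q * x) - 1 = (1 - q * x) / (q * x) := by field_simp
  have e5 : pairFactor a (s * x / q ^ 2) 1 =
      -((q ^ 2 - s * x) * (a * q ^ 2 - s * x)) / (q ^ 2 * (s * x)) := by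
    unfold pairFactor
    field_simp
    ring
  have e6 : pairFactor a (s * x / q ^ 2 * q) 1 =
      -((q - s * x) * (a * q - s * x)) / (q * (s * x)) := by
    unfold pairFactor
    field_simp
    ring
  simp only [contigOuter, scale₁, e0, e1, e2, e3, e4, e5, e6]
  generalize (∏ i, (1 - a * q * x / p i)) = t₁
  generalize 1 - s * x ^ 2 = D₁ at *
  generalize q - s * x ^ 2 = D₂ at *
  generalize 1 - a * q * x = D₄ at *
  generalize a * q ^ 2 - s * x = D₅ at *
  generalize 1 - q * x = D₆ at *
  generalize q ^ 2 - s * x = D₇ at *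
  generalize a * q ^ 2 - s = D₈ at *
  field_simp

theorem scale₁_mul_lower :
    scale₁ q s a x * (contigOuter q a p (1 / (q * x)) (s * x / q ^ 2) *
      (pairFactor a (1 / (q * x)) 1 * pairFactor a (1 / (q * x) * q) 1)) =
    a * q ^ 6 * (1 - x) * (1 - a * x) /
        ((q - s * x ^ 2) * (q ^ 2 - s * x ^ 2) * (a * q ^ 2 - s * x)) *
        (∏ i, (1 - p i * (s * x / (a * q ^ 2)))) := by
  have hq := P.q_ne_zero
  have hs := P.s_ne_zero
  have ha := P.a_ne_zero
  have hx := g.ne_zero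
  have d2 := g.q_sub_sxx P
  have d3 := g.q_sq_sub_sxx P
  have d4 := g.one_sub_aqx
  have d5 := g.aq_sq_sub_sx P
  have d6 := g.one_sub_qx
  have d7 := g.q_sq_sub_sx P
  have d8 := P.aq_sq_sub_s
  have e0 : ∏ i, (1 - a / (p i * (s * x / q ^ 2))) =
      -(s / (a ^ 3 * q ^ 3 * (s * x / (a * q ^ 2)) ^ 5)) *
        ∏ i, (1 - p i * (s * x / (a * q ^ 2))) := by
    rw [← prod_one_sub_inv P (z := a * q ^ 2 / (s * x)) (by positivity) fun i => by
      have := P.p_ne_zero i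
      field_simp]
    refine Finset.prod_congr rfl fun i _ => ?_
    have := P.p_ne_zero i
    field_simp
  have e1 : s * x / q ^ 2 - 1 / (q * x) = -(q - s * x ^ 2) / (q ^ 2 * x) := by
    field_simp
    ring
  have e2 : s * x / q ^ 2 - 1 / (q * x) * q = -(q ^ 2 - s * x ^ 2) / (q ^ 2 * x) := by
    field_simp
    ring
  have e3 : 1 - a / (1 / (q * x) * (s * x / q ^ 2) * q) = -(a * q ^ 2 - s) / s := by
    field_simp
    ring
  have e4 : s * x / q ^ 2 - 1 = -(q ^ 2 - s * x) / q ^ 2 := by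
    field_simp
    ring
  have e5 : pairFactor a (1 / (q * x)) 1 = -((1 - q * x) * (1 - a * q * x)) / (q * x) := by
    unfold pairFactor
    field_simp
    ring
  have e6 : pairFactor a (1 / (q * x) * q) 1 = -((1 - x) * (1 - a * x)) / x := by
    unfold pairFactor
    field_simp
    ring
  simp only [contigOuter, scale₁, e0, e1, e2, e3, e4, e5, e6]
  generalize (∏ i, (1 - p i * (s * x / (a * q ^ 2)))) = t₁
  generalize q - s * x ^ 2 = D₂ at *
  generalize q ^ 2 - s * x ^ 2 = D₃ at *
  generalize 1 - a * q * x = D₄ at *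
  generalize a * q ^ 2 - s * x = D₅ at *
  generalize 1 - q * x = D₆ at *
  generalize q ^ 2 - s * x = D₇ at *
  generalize a * q ^ 2 - s = D₈ at *
  field_simp

theorem scale₁_mul_middle :
    scale₁ q s a x * contigMiddle q a p (s * x / q ^ 2) (1 / (q * x)) = -recA q s a p x := by
  have hu := scale₁_mul_upper P g
  have hl := scale₁_mul_lower P g
  have hm : scale₁ q s a x * ((1 - s * x / q ^ 2) * (1 - 1 / (q * x))) =
      -(s * x ^ 2 * (a * q ^ 2 - s) / (a * q * (a * q ^ 2 - s * x) * (1 - a * q * x))) := by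
    have hq := P.q_ne_zero
    have ha := P.a_ne_zero
    have hx := g.ne_zero
    have d4 := g.one_sub_aqx
    have d5 := g.aq_sq_sub_sx P
    have d6 := g.one_sub_qx
    have d7 := g.q_sq_sub_sx P
    have e4 : 1 - 1 / (q * x) = -(1 - q * x) / (q * x) := by
      field_simp
      ring
    have e5 : 1 - s * x / q ^ 2 = (q ^ 2 - s * x) / q ^ 2 := by field_simp
    rw [scale₁, e4, e5]
    generalize 1 - a * q * x = D₄ at *
    generalize a * q ^ 2 - s * x = D₅ at *
    generalize 1 - q * x = D₆ at *
    generalize q ^ 2 - s * x = D₇ at *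
    field_simp
  rw [recA_eq P g, contigMiddle]
  linear_combination (∏ i, (1 - p i)) * hm - hu - hl

/-- The factor that turns the contiguous relation for the dual parameters `q / a`, `q / p` with
`G = q / (s x)`, `H = x` into the recurrence for the second solution. -/
noncomputable def scale₂ (q s a x : ℂ) : ℂ :=
  -(a ^ 2 * s * x ^ 3 * (a * q - s)) /
    (q * (a - s * x) * (q - s * x) * (1 - x) * (q - a * x))

theorem scale₂_mul_upper :
    scale₂ q s a x * (contigOuter q (q / a) (fun i => q / p i) (q / (s * x)) x *
      (pairFactor (q / a) (q / (s * x)) 1 * pairFactor (q / a) (q / (s * x) * q) 1)) =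
    q ^ 2 * (q ^ 2 - s * x) * (a * q - s * x) /
        (a * (q - s * x ^ 2) * (q ^ 2 - s * x ^ 2) * (q - a * x)) * (∏ i, (1 - a * x / p i)) := by
  have hq := P.q_ne_zero
  have hs := P.s_ne_zero
  have ha := P.a_ne_zero
  have hx := g.ne_zero
  have d2 := g.q_sub_sxx P
  have d3 := g.q_sq_sub_sxx P
  have d4 := g.a_sub_sx P
  have d5 := g.q_sub_sx P
  have d6 := g.one_sub_x
  have d7 := g.q_sub_ax P
  have d8 := P.aq_sub_s
  have e0 : ∏ i, (1 - q / a / (q / p i * x)) =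
      -(a ^ 3 * q ^ 3 * (1 / (a * x)) ^ 5 / s) * ∏ i, (1 - a * x / p i) := by
    rw [prod_one_sub_inv P (y := 1 / (a * x)) (z := a * x) (one_div_ne_zero (by positivity))
      fun i => by
        have := P.p_ne_zero i
        field_simp]
    have : ∀ i, 1 - q / a / (q / p i * x) = 1 - p i * (1 / (a * x)) := fun i => by
      have := P.p_ne_zero i
      field_simp
    rw [Finset.prod_congr rfl fun i _ => this i]
    generalize (∏ i, (1 - p i * (1 / (a * x)))) = t₁
    field_simp
  have e1 : x - q / (s * x) = -(q - s * x ^ 2) / (s * x) := by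
    field_simp
    ring
  have e2 : x - q / (s * x) * q = -(q ^ 2 - s * x ^ 2) / (s * x) := by
    field_simp
    ring
  have e3 : 1 - q / a / (q / (s * x) * x * q) = (a * q - s) / (a * q) := by field_simp
  have e4 : x - 1 = -(1 - x) := by ring
  have e5 : pairFactor (q / a) (q / (s * x)) 1 = -((q - s * x) * (a - s * x)) / (a * (s * x)) := by
    unfold pairFactor
    field_simp
    ring
  have e6 : pairFactor (q / a) (q / (s * x) * q) 1 =
      -((q ^ 2 - s * x) * (a * q - s * x)) / (a * q * (s * x)) := by
    unfold pairFactor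
    field_simp
    ring
  simp only [contigOuter, scale₂, e0, e1, e2, e3, e4, e5, e6]
  generalize (∏ i, (1 - a * x / p i)) = t₁
  generalize q - s * x ^ 2 = D₂ at *
  generalize q ^ 2 - s * x ^ 2 = D₃ at *
  generalize a - s * x = D₄ at *
  generalize q - s * x = D₅ at *
  generalize 1 - x = D₆ at *
  generalize q - a * x = D₇ at *
  generalize a * q - s = D₈ at *
  field_simp

theorem scale₂_mul_lower :
    scale₂ q s a x * (contigOuter q (q / a) (fun i => q / p i) x (q / (s * x)) *
      (pairFactor (q / a) x 1 * pairFactor (q / a) (x * q) 1)) =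
    a * q * (1 - q * x) * (1 - a * x) / ((a - s * x) * (q - s * x ^ 2) * (1 - s * x ^ 2)) *
        (∏ i, (1 - p i * (s * x / (a * q)))) := by
  have hq := P.q_ne_zero
  have hs := P.s_ne_zero
  have ha := P.a_ne_zero
  have hx := g.ne_zero
  have d1 := g.one_sub_sxx
  have d2 := g.q_sub_sxx P
  have d4 := g.a_sub_sx P
  have d5 := g.q_sub_sx P
  have d6 := g.one_sub_x
  have d7 := g.q_sub_ax P
  have d8 := P.aq_sub_s
  have e0 : ∀ i, 1 - q / a / (q / p i * (q / (s * x))) = 1 - p i * (s * x / (a * q)) := fun i => by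
    have := P.p_ne_zero i
    field_simp
  have e1 : q / (s * x) - x = (q - s * x ^ 2) / (s * x) := by field_simp
  have e2 : q / (s * x) - x * q = q * (1 - s * x ^ 2) / (s * x) := by field_simp
  have e3 : 1 - q / a / (x * (q / (s * x)) * q) = (a * q - s) / (a * q) := by field_simp
  have e4 : q / (s * x) - 1 = (q - s * x) / (s * x) := by field_simp
  have e5 : pairFactor (q / a) x 1 = -((1 - x) * (q - a * x)) / (a * x) := by
    unfold pairFactor
    field_simp
    ring
  have e6 : pairFactor (q / a) (x * q) 1 = -((1 - q * x) * (1 - a * x)) / (a * x) := by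
    unfold pairFactor
    field_simp
    ring
  simp only [contigOuter, scale₂, e0, e1, e2, e3, e4, e5, e6]
  generalize (∏ i, (1 - p i * (s * x / (a * q)))) = t₁
  generalize 1 - s * x ^ 2 = D₁ at *
  generalize q - s * x ^ 2 = D₂ at *
  generalize a - s * x = D₄ at *
  generalize q - s * x = D₅ at *
  generalize 1 - x = D₆ at *
  generalize q - a * x = D₇ at *
  generalize a * q - s = D₈ at *
  field_simp

theorem scale₂_mul_middle :
    scale₂ q s a x * contigMiddle q (q / a) (fun i => q / p i) (q / (s * x)) x =
      -recA q s a p x := by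
  have hu := scale₂_mul_upper P g
  have hl := scale₂_mul_lower P g
  have hm : scale₂ q s a x * ((1 - q / (s * x)) * (1 - x)) =
      a ^ 2 * x ^ 2 * (a * q - s) / (q * (a - s * x) * (q - a * x)) := by
    have hq := P.q_ne_zero
    have hs := P.s_ne_zero
    have hx := g.ne_zero
    have d4 := g.a_sub_sx P
    have d5 := g.q_sub_sx P
    have d6 := g.one_sub_x
    have d7 := g.q_sub_ax P
    have e4 : 1 - q / (s * x) = -(q - s * x) / (s * x) := by
      field_simp
      ring
    rw [scale₂, e4]
    generalize a - s * x = D₄ at *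
    generalize q - s * x = D₅ at *
    generalize 1 - x = D₆ at *
    generalize q - a * x = D₇ at *
    field_simp
  rw [recA_eq' P g, contigMiddle]
  linear_combination (∏ i, (1 - q / p i)) * hm - hu - hl

end

theorem Generic.div_q {q s a x : ℂ} {p : Fin 5 → ℂ} (hq0 : q ≠ 0) (g : Generic q s a p x) :
    Generic q s a p (x / q) := by
  refine ⟨div_ne_zero g.ne_zero hq0, ?_, ?_, ?_, ?_, ?_, ?_, ?_, fun i => ?_, fun i => ?_⟩
  · exact (by field_simp : x / q = x * q ^ (-1 : ℤ)) ▸ g.x_notPow.mul_zpow hq0 (-1)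
  · exact (by field_simp : s * (x / q) = s * x * q ^ (-1 : ℤ)) ▸ g.sx_notPow.mul_zpow hq0 (-1)
  · exact (by field_simp : s * (x / q) ^ 2 = s * x ^ 2 * q ^ (-2 : ℤ)) ▸
      g.sxx_notPow.mul_zpow hq0 (-2)
  · exact (by field_simp : a * (x / q) = a * x * q ^ (-1 : ℤ)) ▸ g.ax_notPow.mul_zpow hq0 (-1)
  · exact (by field_simp : s * (x / q) / a = s * x / a * q ^ (-1 : ℤ)) ▸
      g.sxa_notPow.mul_zpow hq0 (-1)
  · exact (by field_simp : a * (x / q) ^ 2 = a * x ^ 2 * q ^ (-2 : ℤ)) ▸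
      g.axx_notPow.mul_zpow hq0 (-2)
  · exact (by field_simp : s ^ 2 * (x / q) ^ 2 / a = s ^ 2 * x ^ 2 / a * q ^ (-2 : ℤ)) ▸
      g.ssxxa_notPow.mul_zpow hq0 (-2)
  · exact (by field_simp : a * (x / q) / p i = a * x / p i * q ^ (-1 : ℤ)) ▸
      (g.axp_notPow i).mul_zpow hq0 (-1)
  · exact (by field_simp : p i * s * (x / q) / a = p i * s * x / a * q ^ (-1 : ℤ)) ▸
      (g.psxa_notPow i).mul_zpow hq0 (-1)

section
variable {q s a x : ℂ} {p : Fin 5 → ℂ} (P : Params q s a p) (g : Generic q s a p x)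
include P g

omit P in
theorem Generic.one_sub_aqx_div (i : Fin 5) : 1 - a * q * x / p i ≠ 0 :=
  (g.axp_notPow i).one_sub_ne_zero 1 (by rw [zpow_one]; ring)

theorem Generic.one_sub_psx (i : Fin 5) : 1 - p i * (s * x / (a * q)) ≠ 0 := by
  have hq := P.q_ne_zero
  have ha := P.a_ne_zero
  exact (g.psxa_notPow i).one_sub_ne_zero (-1) (by field_simp)

theorem factor₁_mul_q : factor₁ q s a p (x * q) =
    (q - s * x) * (a * q - s * x) / (a * q * (q - s * x ^ 2) * (1 - s * x ^ 2) * (1 - a * q * x)) *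
        (∏ i, (1 - a * q * x / p i)) * factor₁ q s a p x := by
  have hq := P.q_ne_zero
  have ha := P.a_ne_zero
  have hq1 := P.norm_q
  have d1 := g.one_sub_sxx
  have d2 := g.q_sub_sxx P
  have d4 := g.one_sub_aqx
  have d5 := g.aq_sub_sx P
  have d6 := g.q_sub_sx P
  have d7 : ∏ i, (1 - a * q * x / p i) ≠ 0 :=
    Finset.prod_ne_zero_iff.2 fun i _ => g.one_sub_aqx_div i
  have e1 : qPochInf q (s * x ^ 2 / q) = (q - s * x ^ 2) / q * (1 - s * x ^ 2) *
      qPochInf q (s * (x * q) ^ 2 / q) := by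
    rw [qPochInf_eq hq1, qPochInf_eq hq1 (s * x ^ 2 / q * q),
      show s * x ^ 2 / q * q = s * x ^ 2 by field_simp,
      show s * (x * q) ^ 2 / q = s * x ^ 2 * q by field_simp]
    field_simp
  have e2 : qPochInf q (a * q * x) = (1 - a * q * x) * qPochInf q (a * q * (x * q)) := by
    rw [qPochInf_eq hq1, mul_assoc (a * q)]
  have e3 : qPochInf q (s * x / q) = (q - s * x) / q * qPochInf q (s * (x * q) / q) := by
    rw [qPochInf_eq hq1, show s * (x * q) / q = s * x / q * q by field_simp]
    field_simp
  have e4 : qPochInf q (s * x / (a * q)) =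
      (a * q - s * x) / (a * q) * qPochInf q (s * (x * q) / (a * q)) := by
    rw [qPochInf_eq hq1, show s * (x * q) / (a * q) = s * x / (a * q) * q by field_simp]
    field_simp
  have e5 : ∏ i, qPochInf q (a * q * x / p i) =
      (∏ i, (1 - a * q * x / p i)) * ∏ i, qPochInf q (a * q * (x * q) / p i) := by
    rw [← Finset.prod_mul_distrib]
    refine Finset.prod_congr rfl fun i _ => ?_
    rw [qPochInf_eq hq1, div_mul_eq_mul_div, mul_assoc (a * q)]
  rw [factor₁, factor₁, e1, e2, e3, e4, e5]
  generalize (∏ i, (1 - a * q * x / p i)) = t₁ at *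
  generalize ∏ i, qPochInf q (a * q * (x * q) / p i) = t₂ at *
  generalize 1 - s * x ^ 2 = D₁ at *
  generalize q - s * x ^ 2 = D₂ at *
  generalize 1 - a * q * x = D₄ at *
  generalize a * q - s * x = D₅ at *
  generalize q - s * x = D₆ at *
  field_simp

theorem factor₂_mul_q : factor₂ q s a p (x * q) =
    a * q * (1 - q * x) * (1 - a * x) / ((a - s * x) * (q - s * x ^ 2) * (1 - s * x ^ 2)) *
        (∏ i, (1 - p i * (s * x / (a * q)))) * factor₂ q s a p x := by
  have hq := P.q_ne_zero
  have ha := P.a_ne_zero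
  have hq1 := P.norm_q
  have d1 := g.one_sub_sxx
  have d2 := g.q_sub_sxx P
  have d4 := g.one_sub_ax
  have d5 := g.a_sub_sx P
  have d6 := g.one_sub_qx
  have d7 : ∏ i, (1 - p i * (s * x / (a * q))) ≠ 0 :=
    Finset.prod_ne_zero_iff.2 fun i _ => g.one_sub_psx P i
  have e1 : qPochInf q (s * x ^ 2 / q) = (q - s * x ^ 2) / q * (1 - s * x ^ 2) *
      qPochInf q (s * (x * q) ^ 2 / q) := by
    rw [qPochInf_eq hq1, qPochInf_eq hq1 (s * x ^ 2 / q * q),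
      show s * x ^ 2 / q * q = s * x ^ 2 by field_simp,
      show s * (x * q) ^ 2 / q = s * x ^ 2 * q by field_simp]
    field_simp
  have e2 : qPochInf q (a * x) = (1 - a * x) * qPochInf q (a * (x * q)) := by
    rw [qPochInf_eq hq1, mul_assoc a]
  have e3 : qPochInf q (q * x) = (1 - q * x) * qPochInf q (q * (x * q)) := by
    rw [qPochInf_eq hq1, mul_assoc q]
  have e4 : qPochInf q (s * x / a) = (a - s * x) / a * qPochInf q (s * (x * q) / a) := by
    rw [qPochInf_eq hq1, show s * (x * q) / a = s * x / a * q by field_simp]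
    field_simp
  have e5 : ∏ i, qPochInf q (p i * (s * x / (a * q))) =
      (∏ i, (1 - p i * (s * x / (a * q)))) * ∏ i, qPochInf q (p i * (s * (x * q) / (a * q))) := by
    rw [← Finset.prod_mul_distrib]
    refine Finset.prod_congr rfl fun i _ => ?_
    rw [qPochInf_eq hq1,
      show p i * (s * (x * q) / (a * q)) = p i * (s * x / (a * q)) * q by field_simp]
  rw [factor₂, factor₂, e1, e2, e3, e4, e5]
  generalize (∏ i, (1 - p i * (s * x / (a * q)))) = t₁ at *
  generalize ∏ i, qPochInf q (p i * (s * (x * q) / (a * q))) = t₂ at *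
  generalize 1 - s * x ^ 2 = D₁ at *
  generalize q - s * x ^ 2 = D₂ at *
  generalize 1 - a * x = D₄ at *
  generalize a - s * x = D₅ at *
  generalize 1 - q * x = D₆ at *
  field_simp

/-- The first solution satisfies the recurrence up to an inhomogeneous term, a multiple of the tail
of the contiguous relation. -/
theorem sol₁_recurrence :
    sol₁ q s a p (x * q) - recA q s a p x * sol₁ q s a p x +
        q * recB q s a p x * sol₁ q s a p (x / q) =
      factor₁ q s a p x *
        (scale₁ q s a x * contigTail q a p (s * x / q ^ 2) (1 / (q * x))) := by
  have hq := P.q_ne_zero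
  have ha := P.a_ne_zero
  have hs := P.s_ne_zero
  have hx := g.ne_zero
  have g' := g.div_q hq
  have hc := phi_contiguous P.norm_q hq ha P.a_ne_one P.p_ne_zero
    (G := s * x / q ^ 2) (H := 1 / (q * x)) (by rw [P.prod_eq]; field_simp)
    (contigGeneric₁ P g) P.well_poised
    (fun j => g.sxa_notPow.inv.mul_pow_ne_one hq 1 (by field_simp) j)
    (fun j => g.ax_notPow.mul_pow_ne_one hq 0 (by field_simp) j)
  have hu := scale₁_mul_upper P g
  have hl := scale₁_mul_lower P g
  have hm := scale₁_mul_middle P g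
  have f1 := factor₁_mul_q P g
  have f2 := factor₁_mul_q P g'
  rw [div_mul_cancel₀ x hq] at f2
  have hB : q * recB q s a p x =
      (a * q ^ 6 * (1 - x) * (1 - a * x) /
        ((q - s * x ^ 2) * (q ^ 2 - s * x ^ 2) * (a * q ^ 2 - s * x)) *
        (∏ i, (1 - p i * (s * x / (a * q ^ 2))))) *
      ((q - s * (x / q)) * (a * q - s * (x / q)) / (a * q * (q - s * (x / q) ^ 2) *
        (1 - s * (x / q) ^ 2) * (1 - a * q * (x / q))) *
        (∏ i, (1 - a * q * (x / q) / p i))) := by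
    have d2 := g.q_sub_sxx P
    have d3 := g.q_sq_sub_sxx P
    have d3' := g.q_cube_sub_sxx P
    have d5 := g.aq_sq_sub_sx P
    have d7 := g.one_sub_ax
    have e0 : a * q * (x / q) = a * x := by field_simp
    have e1 : q - s * (x / q) = (q ^ 2 - s * x) / q := by field_simp
    have e2 : a * q - s * (x / q) = (a * q ^ 2 - s * x) / q := by field_simp
    have e3 : q - s * (x / q) ^ 2 = (q ^ 3 - s * x ^ 2) / q ^ 2 := by field_simp
    have e4 : 1 - s * (x / q) ^ 2 = (q ^ 2 - s * x ^ 2) / q ^ 2 := by field_simp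
    have e5 : 1 - s * x ^ 2 / q = (q - s * x ^ 2) / q := by field_simp
    have e6 : 1 - s * x ^ 2 / q ^ 2 = (q ^ 2 - s * x ^ 2) / q ^ 2 := by field_simp
    have e7 : 1 - s * x ^ 2 / q ^ 3 = (q ^ 3 - s * x ^ 2) / q ^ 3 := by field_simp
    have e8 : 1 - s * x / q ^ 2 = (q ^ 2 - s * x) / q ^ 2 := by field_simp
    rw [recB, e0, e1, e2, e3, e4, e5, e6, e7, e8]
    generalize (∏ i, (1 - p i * (s * x / (a * q ^ 2)))) = t₁
    generalize (∏ i, (1 - a * x / p i)) = t₂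
    generalize q - s * x ^ 2 = D₂ at *
    generalize q ^ 2 - s * x ^ 2 = D₃ at *
    generalize q ^ 3 - s * x ^ 2 = D₄ at *
    generalize a * q ^ 2 - s * x = D₅ at *
    generalize 1 - a * x = D₇ at *
    field_simp
  rw [← hl] at hB
  have a1 : s * (x * q) / q = s * x / q ^ 2 * q * q := by field_simp
  have a2 : 1 / (x * q) = 1 / (q * x) := by rw [mul_comm]
  have a3 : s * x / q = s * x / q ^ 2 * q := by field_simp
  have a4 : 1 / x = 1 / (q * x) * q := by field_simp
  have a5 : s * (x / q) / q = s * x / q ^ 2 := by field_simp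
  have a6 : 1 / (x / q) = 1 / (q * x) * q * q := by field_simp
  rw [sol₁, sol₁, sol₁, f1, a1, a2, a3, a4, a5, a6, ← hc, hB, ← hu]
  linear_combination (-scale₁ q s a x * (contigOuter q a p (1 / (q * x)) (s * x / q ^ 2) *
      (pairFactor a (1 / (q * x)) 1 * pairFactor a (1 / (q * x) * q) 1)) *
      phi q a p (s * x / q ^ 2) (1 / (q * x) * q * q)) * f2 -
    factor₁ q s a p x * phi q a p (s * x / q ^ 2 * q) (1 / (q * x) * q) * hm

/-- The second solution satisfies the recurrence up to an inhomogeneous term, a multiple of the tail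
of the contiguous relation. -/
theorem sol₂_recurrence :
    sol₂ q s a p (x * q) - recA q s a p x * sol₂ q s a p x +
        q * recB q s a p x * sol₂ q s a p (x / q) =
      factor₂ q s a p x *
        (scale₂ q s a x * contigTail q (q / a) (fun i => q / p i) (q / (s * x)) x) := by
  have hq := P.q_ne_zero
  have ha := P.a_ne_zero
  have hs := P.s_ne_zero
  have hx := g.ne_zero
  have g' := g.div_q hq
  have P' := P.dual
  have hc := phi_contiguous P.norm_q hq P'.a_ne_zero P'.a_ne_one P'.p_ne_zero
    (G := q / (s * x)) (H := x) (by rw [P'.prod_eq]; field_simp)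
    (contigGeneric₂ P g) P'.well_poised
    (fun j => g.sxa_notPow.mul_pow_ne_one hq (-1) (by field_simp) j)
    (fun j => g.ax_notPow.inv.mul_pow_ne_one hq 0 (by field_simp) j)
  have hu := scale₂_mul_upper P g
  have hl := scale₂_mul_lower P g
  have hm := scale₂_mul_middle P g
  have f1 := factor₂_mul_q P g
  have f2 := factor₂_mul_q P g'
  rw [div_mul_cancel₀ x hq] at f2
  have hB : q * recB q s a p x =
      (q ^ 2 * (q ^ 2 - s * x) * (a * q - s * x) /
        (a * (q - s * x ^ 2) * (q ^ 2 - s * x ^ 2) * (q - a * x)) * (∏ i, (1 - a * x / p i))) *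
      (a * q * (1 - q * (x / q)) * (1 - a * (x / q)) / ((a - s * (x / q)) *
        (q - s * (x / q) ^ 2) * (1 - s * (x / q) ^ 2)) *
        (∏ i, (1 - p i * (s * (x / q) / (a * q))))) := by
    have d2 := g.q_sub_sxx P
    have d3 := g.q_sq_sub_sxx P
    have d3' := g.q_cube_sub_sxx P
    have d5 := g.aq_sub_sx P
    have d7 := g.q_sub_ax P
    have e0 : s * (x / q) / (a * q) = s * x / (a * q ^ 2) := by field_simp
    have e1 : 1 - q * (x / q) = 1 - x := by field_simp
    have e2 : 1 - a * (x / q) = (q - a * x) / q := by field_simp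
    have e3 : q - s * (x / q) ^ 2 = (q ^ 3 - s * x ^ 2) / q ^ 2 := by field_simp
    have e4 : 1 - s * (x / q) ^ 2 = (q ^ 2 - s * x ^ 2) / q ^ 2 := by field_simp
    have e5 : 1 - s * x ^ 2 / q = (q - s * x ^ 2) / q := by field_simp
    have e6 : 1 - s * x ^ 2 / q ^ 2 = (q ^ 2 - s * x ^ 2) / q ^ 2 := by field_simp
    have e7 : 1 - s * x ^ 2 / q ^ 3 = (q ^ 3 - s * x ^ 2) / q ^ 3 := by field_simp
    have e8 : 1 - s * x / q ^ 2 = (q ^ 2 - s * x) / q ^ 2 := by field_simp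
    have e9 : a - s * (x / q) = (a * q - s * x) / q := by field_simp
    rw [recB, e0, e1, e2, e3, e4, e5, e6, e7, e8, e9]
    generalize (∏ i, (1 - p i * (s * x / (a * q ^ 2)))) = t₁
    generalize (∏ i, (1 - a * x / p i)) = t₂
    generalize q - s * x ^ 2 = D₂ at *
    generalize q ^ 2 - s * x ^ 2 = D₃ at *
    generalize q ^ 3 - s * x ^ 2 = D₄ at *
    generalize a * q - s * x = D₅ at *
    generalize q - a * x = D₇ at *
    field_simp
  rw [← hu] at hB
  have a1 : q ^ 2 / (s * (x * q)) = q / (s * x) := by field_simp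
  have a2 : q * (x * q) = x * q * q := by ring
  have a3 : q ^ 2 / (s * x) = q / (s * x) * q := by field_simp
  have a4 : q * x = x * q := by ring
  have a5 : q ^ 2 / (s * (x / q)) = q / (s * x) * q * q := by field_simp
  have a6 : q * (x / q) = x := by field_simp
  rw [sol₂, sol₂, sol₂, f1, ← hl, a1, a2, a3, a4, a5, a6, ← hc, hB]
  linear_combination (-scale₂ q s a x *
      (contigOuter q (q / a) (fun i => q / p i) (q / (s * x)) x *
      (pairFactor (q / a) (q / (s * x)) 1 * pairFactor (q / a) (q / (s * x) * q) 1)) *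
      phi q (q / a) (fun i => q / p i) (q / (s * x) * q * q) x) * f2 -
    factor₂ q s a p x * phi q (q / a) (fun i => q / p i) (q / (s * x) * q) (x * q) * hm

end

/-! ### Analytic continuation by repeated differencing -/

/-- The sequence `c` is bounded by `B`, and `c k = C (q ^ k)` for large `k`, where `C` is analytic
and bounded by `B` on the disc of radius `R`. -/
def QAnalytic (q : ℂ) (R B : ℝ) (c : ℕ → ℂ) : Prop :=
  ∃ C : ℂ → ℂ, DifferentiableOn ℂ C (Metric.ball 0 R) ∧ (∀ X ∈ Metric.ball (0 : ℂ) R, ‖C X‖ ≤ B) ∧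
    (∀ k : ℕ, ‖q ^ k‖ < R → c k = C (q ^ k)) ∧ ∀ k, ‖c k‖ ≤ B

/-- A family of sequences that are analytic functions of `q ^ k` on a common disc, with a common
bound. -/
def UniformlyQAnalytic {ι : Type*} (q : ℂ) (c : ι → ℕ → ℂ) : Prop :=
  ∃ R B : ℝ, 0 < R ∧ R ≤ 1 ∧ ∀ i, QAnalytic q R B (c i)

/-- The differences of the sequence `c` divided by `q ^ k`. If the power series with coefficients
`c` has sum `f`, then `(1 - z) f z` is the sum at `q z` of the series with these coefficients. -/
noncomputable def qDiff (q : ℂ) (c : ℕ → ℂ) (k : ℕ) : ℂ :=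
  (c k - if k = 0 then 0 else c (k - 1)) / q ^ k

theorem UniformlyQAnalytic.mul {ι : Type*} {q : ℂ} {c d : ι → ℕ → ℂ}
    (hc : UniformlyQAnalytic q c) (hd : UniformlyQAnalytic q d) :
    UniformlyQAnalytic q fun i k => c i k * d i k := by
  obtain ⟨R, B, hR, hR1, h⟩ := hc
  obtain ⟨R', B', hR', hR1', h'⟩ := hd
  refine ⟨min R R', B * B', lt_min hR hR', (min_le_left _ _).trans hR1, fun i => ?_⟩
  obtain ⟨C, h1, h2, h3, h4⟩ := h i
  obtain ⟨D, k1, k2, k3, k4⟩ := h' i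
  have s1 : Metric.ball (0 : ℂ) (min R R') ⊆ Metric.ball 0 R :=
    Metric.ball_subset_ball (min_le_left _ _)
  have s2 : Metric.ball (0 : ℂ) (min R R') ⊆ Metric.ball 0 R' :=
    Metric.ball_subset_ball (min_le_right _ _)
  have hB : 0 ≤ B := (norm_nonneg _).trans (h4 0)
  refine ⟨fun X => C X * D X, (h1.mono s1).mul (k1.mono s2), fun X hX => ?_, fun k hk => ?_,
    fun k => ?_⟩
  · dsimp only
    rw [norm_mul]
    exact mul_le_mul (h2 X (s1 hX)) (k2 X (s2 hX)) (norm_nonneg _) hB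
  · dsimp only
    rw [h3 k (hk.trans_le (min_le_left _ _)), k3 k (hk.trans_le (min_le_right _ _))]
  · dsimp only
    rw [norm_mul]
    exact mul_le_mul (h4 k) (k4 k) (norm_nonneg _) hB

theorem uniformlyQAnalytic_of_differentiable {ι : Type*} {q : ℂ} (hq : ‖q‖ < 1) {C : ℂ → ℂ}
    (hC : Differentiable ℂ C) : UniformlyQAnalytic q fun (_ : ι) k => C (q ^ k) := by
  obtain ⟨B, hB⟩ := (isCompact_closedBall (0 : ℂ) 1).exists_bound_of_continuousOn
    hC.continuous.continuousOn
  refine ⟨1, B, one_pos, le_rfl, fun _ => ⟨C, hC.differentiableOn, fun X hX =>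
    hB X (Metric.ball_subset_closedBall hX), fun _ _ => rfl, fun k => hB _ ?_⟩⟩
  rw [mem_closedBall_zero_iff, norm_pow]
  exact pow_le_one₀ (norm_nonneg _) hq.le

theorem UniformlyQAnalytic.prod {ι κ : Type*} {q : ℂ} (hq : ‖q‖ < 1) {c : κ → ι → ℕ → ℂ}
    (s : Finset κ) (hc : ∀ j, UniformlyQAnalytic q (c j)) :
    UniformlyQAnalytic q fun i k => ∏ j ∈ s, c j i k := by
  classical
  induction s using Finset.induction_on with
  | empty => simpa using uniformlyQAnalytic_of_differentiable hq (differentiable_const (1 : ℂ))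
  | insert j s hj ih =>
    simp_rw [Finset.prod_insert hj]
    exact (hc j).mul ih

theorem uniformlyQAnalytic_qPoch {ι : Type*} {q : ℂ} (hq : ‖q‖ < 1) {y : ι → ℂ} {Y : ℝ}
    (hy : ∀ i, ‖y i‖ ≤ Y) : UniformlyQAnalytic q fun i => qPoch q (y i) := by
  rcases isEmpty_or_nonempty ι with hι | ⟨⟨i₀⟩⟩
  · exact ⟨1, 0, one_pos, le_rfl, fun i => (hι.false i).elim⟩
  have hY : 0 ≤ Y := (norm_nonneg _).trans (hy i₀)
  obtain ⟨δ, hδ, hδ1⟩ : ∃ δ > 0, ∀ t : ℂ, ‖t‖ < δ → 1 / 2 < ‖qPochInf q t‖ := by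
    have h := (continuous_qPochInf hq).norm.continuousAt (x := 0)
    have h2 : ∀ᶠ t in 𝓝 (0 : ℂ), 1 / 2 < ‖qPochInf q t‖ := by
      refine h.eventually_const_lt ?_
      simp only [qPochInf_zero, norm_one]
      norm_num
    obtain ⟨δ, hδ, h3⟩ := Metric.eventually_nhds_iff.1 h2
    exact ⟨δ, hδ, fun t ht => h3 (by simpa using ht)⟩
  have hsmall : ∀ i, ∀ X : ℂ, ‖X‖ < min 1 (δ / (Y + 1)) → 1 / 2 < ‖qPochInf q (y i * X)‖ := by
    intro i X hX
    apply hδ1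
    have h1 : ‖X‖ < δ / (Y + 1) := hX.trans_le (min_le_right _ _)
    rw [lt_div_iff₀ (by positivity)] at h1
    rw [norm_mul]
    nlinarith [hy i, norm_nonneg X]
  have hexp : ∀ i, Real.exp (‖y i‖ / (1 - ‖q‖)) ≤ Real.exp (Y / (1 - ‖q‖)) := by
    intro i
    have : 0 < 1 - ‖q‖ := by linarith
    gcongr
    exact hy i
  refine ⟨min 1 (δ / (Y + 1)), 2 * Real.exp (Y / (1 - ‖q‖)), by positivity, min_le_left _ _,
    fun i => ⟨fun X => qPochInf q (y i) / qPochInf q (y i * X), ?_, fun X hX => ?_, fun k hk => ?_,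
      fun k => ?_⟩⟩
  · refine DifferentiableOn.div (differentiableOn_const _) ?_ fun X hX h0 => ?_
    · exact ((differentiable_qPochInf hq).comp (differentiable_id.const_mul _)).differentiableOn
    · have := hsmall i X (by simpa using hX)
      rw [h0, norm_zero] at this
      norm_num at this
  · dsimp only
    have h1 := hsmall i X (by simpa using hX)
    rw [norm_div, div_le_iff₀ (by linarith)]
    have h2 := (norm_qPochInf_le hq (y i)).trans (hexp i)
    nlinarith [Real.exp_pos (Y / (1 - ‖q‖))]
  · have h1 := hsmall i _ hk
    have h0 : qPochInf q (y i * q ^ k) ≠ 0 := by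
      intro h0
      rw [h0, norm_zero] at h1
      norm_num at h1
    rw [eq_div_iff h0, ← qPochInf_eq_qPoch_mul hq]
  · have := (norm_qPoch_le hq (y i) k).trans (hexp i)
    linarith [Real.exp_pos (Y / (1 - ‖q‖))]

theorem uniformlyQAnalytic_inv_qPoch {ι : Type*} {q : ℂ} (hq : ‖q‖ < 1) {y : ι → ℂ} {Y η : ℝ}
    (hy : ∀ i, ‖y i‖ ≤ Y) (hη : 0 < η) (hy' : ∀ i, η ≤ ‖qPochInf q (y i)‖) :
    UniformlyQAnalytic q fun i k => (qPoch q (y i) k)⁻¹ := by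
  have hq' : 0 < 1 - ‖q‖ := by linarith
  have h0 : ∀ i, qPochInf q (y i) ≠ 0 := fun i h => by
    have := hy' i
    rw [h, norm_zero] at this
    linarith
  have hrep : ∀ i k, (qPoch q (y i) k)⁻¹ = qPochInf q (y i * q ^ k) / qPochInf q (y i) := by
    intro i k
    have h1 := h0 i
    rw [qPochInf_eq_qPoch_mul hq (y i) k] at h1 ⊢
    have h2 := left_ne_zero_of_mul h1
    have h3 := right_ne_zero_of_mul h1
    field_simp
  have hbound : ∀ i X, ‖X‖ ≤ 1 →
      ‖qPochInf q (y i * X) / qPochInf q (y i)‖ ≤ Real.exp (Y / (1 - ‖q‖)) / η := by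
    intro i X hX
    rw [norm_div]
    gcongr
    · refine (norm_qPochInf_le hq _).trans ?_
      gcongr
      rw [norm_mul]
      exact (mul_le_of_le_one_right (norm_nonneg _) hX).trans (hy i)
    · exact hy' i
  refine ⟨1, Real.exp (Y / (1 - ‖q‖)) / η, one_pos, le_rfl, fun i =>
    ⟨fun X => qPochInf q (y i * X) / qPochInf q (y i), ?_, fun X hX => ?_, fun k _ => hrep i k,
      fun k => ?_⟩⟩
  · exact (((differentiable_qPochInf hq).comp
      (differentiable_id.const_mul (y i))).div_const _).differentiableOn
  · exact hbound i X (by simpa using (mem_ball_zero_iff.1 hX).le)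
  · dsimp only
    rw [hrep]
    refine hbound i _ ?_
    rw [norm_pow]
    exact pow_le_one₀ (norm_nonneg _) hq.le

/-- Differencing preserves analyticity: `(C X - C (X / q)) / X` is analytic at `0`, and is bounded
by the Schwarz lemma. -/
theorem UniformlyQAnalytic.qDiff {ι : Type*} {q : ℂ} (hq : ‖q‖ < 1) (hq0 : q ≠ 0)
    {c : ι → ℕ → ℂ} (hc : UniformlyQAnalytic q c) :
    UniformlyQAnalytic q fun i => qDiff q (c i) := by
  obtain ⟨R, B, hR, hR1, h⟩ := hc
  have hqn : 0 < ‖q‖ := norm_pos_iff.2 hq0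
  refine ⟨‖q‖ * R, 2 * B / (‖q‖ * R), by positivity, by nlinarith, fun i => ?_⟩
  obtain ⟨C, h1, h2, h3, h4⟩ := h i
  have hr : 0 < ‖q‖ * R := by positivity
  have hB : 0 ≤ B := (norm_nonneg _).trans (h4 0)
  set f : ℂ → ℂ := fun X => C X - C (X / q) with hf
  have m1 : ∀ X ∈ Metric.ball (0 : ℂ) (‖q‖ * R), X ∈ Metric.ball (0 : ℂ) R := fun X hX => by
    rw [mem_ball_zero_iff] at hX ⊢
    nlinarith
  have m2 : ∀ X ∈ Metric.ball (0 : ℂ) (‖q‖ * R), X / q ∈ Metric.ball (0 : ℂ) R := fun X hX => by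
    rw [mem_ball_zero_iff] at hX ⊢
    rwa [norm_div, div_lt_iff₀' hqn]
  have f0 : f 0 = 0 := by simp [hf]
  have hfd : DifferentiableOn ℂ f (Metric.ball 0 (‖q‖ * R)) :=
    (h1.mono m1).sub (h1.comp (differentiable_id.div_const q).differentiableOn m2)
  have hmap : Set.MapsTo f (Metric.ball 0 (‖q‖ * R)) (Metric.closedBall (f 0) (2 * B)) := by
    intro X hX
    rw [f0, mem_closedBall_zero_iff]
    refine (norm_sub_le _ _).trans ?_
    linarith [h2 X (m1 X hX), h2 _ (m2 X hX)]
  refine ⟨dslope f 0, (Complex.differentiableOn_dslope (Metric.ball_mem_nhds _ hr)).2 hfd,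
    fun X hX => Complex.norm_dslope_le_div_of_mapsTo_ball hfd hmap hX, fun k hk => ?_, fun k => ?_⟩
  · have hk0 : k ≠ 0 := by
      rintro rfl
      rw [pow_zero, norm_one] at hk
      nlinarith
    obtain ⟨j, rfl⟩ := Nat.exists_eq_succ_of_ne_zero hk0
    have hk' : q ^ (j + 1) ∈ Metric.ball (0 : ℂ) (‖q‖ * R) := by simpa using hk
    have e : q ^ (j + 1) / q = q ^ j := by rw [pow_succ, mul_div_cancel_right₀ _ hq0]
    have hj := m2 _ hk'
    rw [e] at hj
    rw [dslope_of_ne _ (pow_ne_zero _ hq0), slope_def_field, f0, sub_zero, sub_zero, hf]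
    simp only [e]
    rw [← h3 (j + 1) (by simpa using m1 _ hk'), ← h3 j (by simpa using hj)]
    simp [QCF.qDiff]
  · have hnum : ‖c i k - if k = 0 then 0 else c i (k - 1)‖ ≤ 2 * B := by
      refine (norm_sub_le _ _).trans ?_
      split_ifs
      · rw [norm_zero]
        linarith [h4 k]
      · linarith [h4 k, h4 (k - 1)]
    rcases lt_or_ge ‖q ^ k‖ (‖q‖ * R) with hk | hk
    · have hk0 : k ≠ 0 := by
        rintro rfl
        rw [pow_zero, norm_one] at hk
        nlinarith
      obtain ⟨j, rfl⟩ := Nat.exists_eq_succ_of_ne_zero hk0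
      have hk' : q ^ (j + 1) ∈ Metric.ball (0 : ℂ) (‖q‖ * R) := by simpa using hk
      have e : q ^ (j + 1) / q = q ^ j := by rw [pow_succ, mul_div_cancel_right₀ _ hq0]
      have hj := m2 _ hk'
      rw [e] at hj
      have := Complex.norm_dslope_le_div_of_mapsTo_ball hfd hmap hk'
      rw [dslope_of_ne _ (pow_ne_zero _ hq0), slope_def_field, f0, sub_zero, sub_zero, hf] at this
      simp only [e] at this
      rw [← h3 (j + 1) (by simpa using m1 _ hk'), ← h3 j (by simpa using hj)] at this
      simpa [QCF.qDiff] using this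
    · dsimp only [QCF.qDiff]
      rw [norm_div]
      gcongr

/-- The coefficients of a very-well-poised series are an analytic function of `q ^ k`. -/
theorem uniformlyQAnalytic_vwpCoeff {r : ℕ} {ι : Type*} {q : ℂ} (hq : ‖q‖ < 1) {a : ℂ}
    {p : Fin r → ℂ} (h : ∀ i, ∀ j : ℕ, a * q / p i * q ^ j ≠ 1) :
    UniformlyQAnalytic q fun (_ : ι) => vwpCoeff q a p := by
  have h1 : ∀ y : ℂ, UniformlyQAnalytic q fun (_ : ι) => qPoch q y := fun y =>
    uniformlyQAnalytic_qPoch hq fun _ => le_rfl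
  have h2 : ∀ y : ℂ, (∀ j : ℕ, y * q ^ j ≠ 1) →
      UniformlyQAnalytic q fun (_ : ι) k => (qPoch q y k)⁻¹ := fun y hy =>
    uniformlyQAnalytic_inv_qPoch hq (fun _ => le_rfl) (norm_pos_iff.2 (qPochInf_ne_zero hq hy))
      fun _ => le_rfl
  have h3 : UniformlyQAnalytic q fun (_ : ι) k => (1 - a * (q ^ k) ^ 2) / (1 - a) :=
    uniformlyQAnalytic_of_differentiable hq (C := fun X => (1 - a * X ^ 2) / (1 - a)) (by fun_prop)
  have := (((h1 a).mul h3).mul (UniformlyQAnalytic.prod hq Finset.univ fun i =>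
    (h1 (p i)).mul (h2 _ (h i)))).mul (h2 q (q_mul_pow_ne_one hq))
  have e : (fun _ : ι => vwpCoeff q a p) = fun _ k => qPoch q a k *
      ((1 - a * (q ^ k) ^ 2) / (1 - a)) * (∏ i, qPoch q (p i) k * (qPoch q (a * q / p i) k)⁻¹) *
        (qPoch q q k)⁻¹ := by
    funext _ k
    simp only [vwpCoeff, div_eq_mul_inv, pow_mul']
  rw [e]
  exact this

/-- The weights of the terminating series: for `k ≤ N` this is
`q ^ k (q ^ (-N))_k / (q ^ (1 - N) / z)_k`, and it tends to `z ^ k` as `N → ∞`. -/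
noncomputable def terminatingWeight (q z : ℂ) (N k : ℕ) : ℂ :=
  z ^ k * (qPoch q q N * qPoch q z (N - k)) / (qPoch q z N * qPoch q q (N - k))

/-- A terminating analogue of the power series with coefficients `c`, at the point `z`. -/
noncomputable def terminatingSum (q z : ℂ) (N : ℕ) (c : ℕ → ℂ) : ℂ :=
  ∑ k ∈ Finset.range (N + 1), c k * terminatingWeight q z N k

theorem sum_mul_sub_succ (c S : ℕ → ℂ) (n : ℕ) :
    ∑ k ∈ Finset.range (n + 1), c k * (S k - S (k + 1)) =
      ∑ k ∈ Finset.range (n + 1), (c k - if k = 0 then 0 else c (k - 1)) * S k - c n * S (n + 1) := by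
  induction n with
  | zero => simp [mul_sub]
  | succ n ih =>
    rw [Finset.sum_range_succ, ih, Finset.sum_range_succ _ (n + 1)]
    simp only [Nat.succ_ne_zero, if_false, Nat.add_sub_cancel]
    ring

/-- Summation by parts moves `z` to `q z`. -/
theorem terminatingSum_eq {q z : ℂ} (hq : ‖q‖ < 1) (hq0 : q ≠ 0) (hz : ∀ j : ℕ, z * q ^ j ≠ 1)
    (N : ℕ) (c : ℕ → ℂ) :
    terminatingSum q z N c =
      (1 - z * q ^ N) / (1 - z) * terminatingSum q (q * z) N (qDiff q c) := by
  have hqk : ∀ k, qPoch q q k ≠ 0 := qPoch_ne_zero (q_mul_pow_ne_one hq)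
  have hzk : ∀ k, qPoch q z k ≠ 0 := qPoch_ne_zero hz
  have hz' : ∀ j : ℕ, q * z * q ^ j ≠ 1 := fun j => by
    have := hz (j + 1)
    rwa [pow_succ', ← mul_assoc, mul_comm z] at this
  have hqzk : ∀ k, qPoch q (q * z) k ≠ 0 := qPoch_ne_zero hz'
  have hz1 : 1 - z ≠ 0 := by simpa using sub_ne_zero.2 (hz 0).symm
  set S : ℕ → ℂ := fun k => if k ≤ N then
    (1 - z * q ^ N) / (1 - z) * (terminatingWeight q (q * z) N k / q ^ k) else 0 with hS
  have hshift := qPoch_shift q z N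
  have hsk : ∀ k ≤ N, S k = z ^ k * qPoch q q N * qPoch q (q * z) (N - k) /
      (qPoch q z N * qPoch q q (N - k)) := by
    intro k hk
    simp only [hS, hk, if_true, terminatingWeight]
    have h1 := hqzk N
    have h2 := hqk (N - k)
    have h3 := hzk N
    have e : (1 - z * q ^ N) / (1 - z) = qPoch q (q * z) N / qPoch q z N := by
      rw [div_eq_div_iff hz1 h3]
      linear_combination -hshift
    rw [e, mul_pow]
    field_simp
  have hw : ∀ k ≤ N, terminatingWeight q z N k = S k - S (k + 1) := by
    intro k hk
    rcases hk.lt_or_eq with hk' | rfl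
    · obtain ⟨j, hj⟩ : ∃ j, N - k = j + 1 := ⟨N - k - 1, by omega⟩
      have hj' : N - (k + 1) = j := by omega
      rw [hsk k hk, hsk (k + 1) hk', hj, hj', terminatingWeight, hj, qPoch_succ q q,
        qPoch_succ q (q * z), qPoch_succ' q z j, mul_comm z q]
      have h1 := hqk (j + 1)
      rw [qPoch_succ] at h1
      have h2 := left_ne_zero_of_mul h1
      have h3 := right_ne_zero_of_mul h1
      have h4 := hzk N
      obtain ⟨D, hD⟩ : ∃ D, D = 1 - q * q ^ j := ⟨_, rfl⟩
      rw [← hD] at h3 ⊢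
      field_simp
      rw [hD]
      ring
    · have : S (k + 1) = 0 := by simp [hS]
      rw [hsk _ le_rfl, this, Nat.sub_self, terminatingWeight, Nat.sub_self]
      simp [qPoch_zero]
  unfold terminatingSum
  rw [Finset.sum_congr rfl fun k hk => by
    rw [hw k (Nat.lt_succ_iff.1 (Finset.mem_range.1 hk))], sum_mul_sub_succ]
  have : S (N + 1) = 0 := by simp [hS]
  rw [this, mul_zero, sub_zero, Finset.mul_sum]
  refine Finset.sum_congr rfl fun k hk => ?_
  have hk' := Nat.lt_succ_iff.1 (Finset.mem_range.1 hk)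
  simp only [hS, hk', if_true, qDiff]
  ring

/-- The `M`-th expression for the analytic continuation of the power series with coefficients `c`:
it is valid where `‖q ^ M * z‖ < 1`. -/
noncomputable def continuationAux (q : ℂ) : ℕ → (ℕ → ℂ) → ℂ → ℂ
  | 0, c, z => ∑' k, c k * z ^ k
  | M + 1, c, z => continuationAux q M (qDiff q c) (q * z) / (1 - z)

theorem QAnalytic.summable {q : ℂ} {R B : ℝ} {c : ℕ → ℂ} (hc : QAnalytic q R B c) {z : ℂ}
    (hz : ‖z‖ < 1) : Summable fun k => c k * z ^ k := by
  obtain ⟨_, _, _, _, h⟩ := hc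
  refine Summable.of_norm_bounded ((summable_geometric_of_lt_one (norm_nonneg z) hz).mul_left B)
    fun k => ?_
  rw [norm_mul, norm_pow]
  gcongr
  exact h k

theorem UniformlyQAnalytic.summable {q : ℂ} {c : ℕ → ℂ}
    (hc : UniformlyQAnalytic q fun _ : Unit => c) {z : ℂ} (hz : ‖z‖ < 1) :
    Summable fun k => c k * z ^ k := by
  obtain ⟨R, B, _, _, h⟩ := hc
  exact (h ()).summable hz

theorem tsum_qDiff {q : ℂ} (hq0 : q ≠ 0) {c : ℕ → ℂ}  {z : ℂ} (hc : Summable fun k => c k * z ^ k) :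
    ∑' k, qDiff q c k * (q * z) ^ k = (1 - z) * ∑' k, c k * z ^ k := by
  have h1 : ∀ k, qDiff q c k * (q * z) ^ k = (c k - if k = 0 then 0 else c (k - 1)) * z ^ k := by
    intro k
    rw [qDiff, mul_pow]
    field_simp
  have h2 : HasSum (fun k => c k * z ^ (k + 1)) (z * ∑' k, c k * z ^ k) := by
    refine (hc.hasSum.mul_left z).congr_fun fun k => ?_
    ring
  have h3 : HasSum (fun k => (if k = 0 then 0 else c (k - 1)) * z ^ k)
      (z * ∑' k, c k * z ^ k) := by
    rw [← hasSum_nat_add_iff' 1]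
    simpa using h2
  rw [tsum_congr h1, sub_mul, one_mul]
  simp_rw [sub_mul]
  exact (hc.hasSum.sub h3).tsum_eq

theorem continuationAux_succ {q : ℂ} (hq : ‖q‖ < 1) (hq0 : q ≠ 0) (M : ℕ) :
    ∀ {c : ℕ → ℂ} {z : ℂ}, (UniformlyQAnalytic q fun _ : Unit => c) → (∀ j : ℕ, z * q ^ j ≠ 1) →
      ‖q ^ M * z‖ < 1 → continuationAux q (M + 1) c z = continuationAux q M c z := by
  induction M with
  | zero =>
    intro c z hc hz h
    have hz1 : 1 - z ≠ 0 := by simpa using sub_ne_zero.2 (hz 0).symm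
    rw [pow_zero, one_mul] at h
    simp only [continuationAux]
    rw [tsum_qDiff hq0 (hc.summable h), mul_div_cancel_left₀ _ hz1]
  | succ M ih =>
    intro c z hc hz h
    have hz' : ∀ j : ℕ, q * z * q ^ j ≠ 1 := fun j => by
      have := hz (j + 1)
      rwa [pow_succ', ← mul_assoc, mul_comm z] at this
    rw [continuationAux, ih (hc.qDiff hq hq0) hz', continuationAux]
    · rwa [← mul_assoc, ← pow_succ]

theorem continuationAux_of_le {q : ℂ} (hq : ‖q‖ < 1) (hq0 : q ≠ 0) {M M' : ℕ} (hM : M ≤ M')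
    {c : ℕ → ℂ} {z : ℂ} (hc : UniformlyQAnalytic q fun _ : Unit => c)
    (hz : ∀ j : ℕ, z * q ^ j ≠ 1) (h : ‖q ^ M * z‖ < 1) :
    continuationAux q M' c z = continuationAux q M c z := by
  induction M', hM using Nat.le_induction with
  | base => rfl
  | succ n hn ih =>
    rw [continuationAux_succ hq hq0 n hc hz, ih]
    refine lt_of_le_of_lt ?_ h
    rw [norm_mul, norm_mul, norm_pow, norm_pow]
    gcongr ?_ * _
    exact pow_le_pow_of_le_one (norm_nonneg _) hq.le hn

theorem differentiableAt_continuationAux {q : ℂ} (hq : ‖q‖ < 1) (hq0 : q ≠ 0) (M : ℕ) :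
    ∀ {c : ℕ → ℂ} {z : ℂ}, (UniformlyQAnalytic q fun _ : Unit => c) → (∀ j : ℕ, z * q ^ j ≠ 1) →
      ‖q ^ M * z‖ < 1 → DifferentiableAt ℂ (continuationAux q M c) z := by
  induction M with
  | zero =>
    intro c z hc hz h
    rw [pow_zero, one_mul] at h
    obtain ⟨r, hr, hr1⟩ := exists_between h
    obtain ⟨R, B, _, _, h'⟩ := hc
    obtain ⟨_, _, _, _, hB⟩ := h' ()
    have hr0 : 0 ≤ r := (norm_nonneg _).trans hr.le
    have hd := Complex.differentiableOn_tsum_of_summable_norm (F := fun k z => c k * z ^ k)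
      ((summable_geometric_of_lt_one hr0 hr1).mul_left B)
      (fun k => by fun_prop) (Metric.isOpen_ball (x := (0 : ℂ)) (ε := r)) fun k w hw => by
        rw [norm_mul, norm_pow]
        rw [mem_ball_zero_iff] at hw
        have hB0 : 0 ≤ B := (norm_nonneg _).trans (hB k)
        gcongr
        exact hB k
    exact hd.differentiableAt (Metric.isOpen_ball.mem_nhds (mem_ball_zero_iff.2 hr))
  | succ M ih =>
    intro c z hc hz h
    have hz1 : 1 - z ≠ 0 := by simpa using sub_ne_zero.2 (hz 0).symm
    have h1 : DifferentiableAt ℂ (continuationAux q M (qDiff q c)) (q * z) := by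
      refine ih (hc.qDiff hq hq0) (fun j => ?_) ?_
      · have := hz (j + 1)
        rwa [pow_succ', ← mul_assoc, mul_comm z] at this
      · rwa [← mul_assoc, ← pow_succ]
    exact (h1.comp z (differentiableAt_id.const_mul q)).div
      (differentiableAt_id.const_sub 1) hz1

theorem exists_norm_pow_mul_lt_one {q : ℂ} (hq : ‖q‖ < 1) (z : ℂ) : ∃ M : ℕ, ‖q ^ M * z‖ < 1 := by
  have := (tendsto_mul_pow_atTop hq z).norm
  rw [norm_zero] at this
  obtain ⟨M, hM⟩ := (this.eventually_lt_const one_pos).exists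
  exact ⟨M, by rwa [mul_comm]⟩

open Classical in
/-- The analytic continuation of the power series with coefficients `c` to the complement of
`{1, q⁻¹, q⁻², …}`, for coefficients that are analytic functions of `q ^ k`. -/
noncomputable def continuation (q : ℂ) (c : ℕ → ℂ) (z : ℂ) : ℂ :=
  if h : ∃ M : ℕ, ‖q ^ M * z‖ < 1 then continuationAux q (Nat.find h) c z else 0

theorem continuation_eq {q : ℂ} (hq : ‖q‖ < 1) (hq0 : q ≠ 0) {M : ℕ} {c : ℕ → ℂ} {z : ℂ}
    (hc : UniformlyQAnalytic q fun _ : Unit => c) (hz : ∀ j : ℕ, z * q ^ j ≠ 1)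
    (h : ‖q ^ M * z‖ < 1) : continuation q c z = continuationAux q M c z := by
  classical
  have h' := exists_norm_pow_mul_lt_one hq z
  rw [continuation, dif_pos h',
    continuationAux_of_le hq hq0 (Nat.find_min' h' h) hc hz (Nat.find_spec h')]

theorem mul_pow_ne_one_of_norm_lt_one {q : ℂ} (hq : ‖q‖ < 1) {z : ℂ} (hz : ‖z‖ < 1) (j : ℕ) :
    z * q ^ j ≠ 1 := by
  intro h
  have := congrArg norm h
  rw [norm_mul, norm_pow, norm_one] at this
  have h2 : ‖q‖ ^ j ≤ 1 := pow_le_one₀ (norm_nonneg _) hq.le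
  nlinarith [norm_nonneg z]

theorem isOpen_setOf_mul_pow_ne_one {q : ℂ} (hq : ‖q‖ < 1) :
    IsOpen {z : ℂ | ∀ j : ℕ, z * q ^ j ≠ 1} := by
  have : {z : ℂ | ∀ j : ℕ, z * q ^ j ≠ 1} = {z | qPochInf q z ≠ 0} := by
    ext z
    exact ⟨fun h => qPochInf_ne_zero hq h, fun h => mul_pow_ne_one_of_qPochInf_ne_zero hq h⟩
  rw [this]
  exact isOpen_ne_fun (continuous_qPochInf hq) continuous_const

theorem isContinuation_continuation {q a : ℂ} {p : Fin 5 → ℂ} (hq : ‖q‖ < 1) (hq0 : q ≠ 0)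
    (hp : ∀ i, ∀ j : ℕ, a * q / p i * q ^ j ≠ 1) :
    IsContinuation q a p (continuation q (vwpCoeff q a p)) := by
  have hc : UniformlyQAnalytic q fun _ : Unit => vwpCoeff q a p := uniformlyQAnalytic_vwpCoeff hq hp
  refine ⟨fun z hz => ?_, fun z hz => ?_⟩
  · obtain ⟨M, hM⟩ := exists_norm_pow_mul_lt_one hq z
    refine ((differentiableAt_continuationAux hq hq0 M hc hz hM).congr_of_eventuallyEq
      ?_).differentiableWithinAt
    have h1 : ∀ᶠ w in 𝓝 z, ‖q ^ M * w‖ < 1 :=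
      ((continuous_id.const_mul (q ^ M)).norm.continuousAt).eventually_lt_const hM
    filter_upwards [h1, (isOpen_setOf_mul_pow_ne_one hq).mem_nhds hz] with w h1 h2
    exact continuation_eq hq hq0 hc h2 h1
  · rw [continuation_eq hq hq0 hc (mul_pow_ne_one_of_norm_lt_one hq hz) (M := 0) (by simpa using hz)]
    exact (hc.summable hz).hasSum

theorem tendsto_terminatingWeight {q z : ℂ} (hq : ‖q‖ < 1) (hz : ∀ j : ℕ, z * q ^ j ≠ 1) (k : ℕ) :
    Tendsto (fun N => terminatingWeight q z N k) atTop (𝓝 (z ^ k)) := by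
  have h1 := qPochInf_ne_zero hq hz
  have h2 := qPochInf_ne_zero hq (q_mul_pow_ne_one hq)
  have hk : Tendsto (fun N => N - k) atTop atTop := tendsto_sub_atTop_nat k
  have := (((tendsto_qPoch hq q).mul ((tendsto_qPoch hq z).comp hk)).const_mul (z ^ k)).div
    ((tendsto_qPoch hq z).mul ((tendsto_qPoch hq q).comp hk)) (mul_ne_zero h1 h2)
  rw [mul_comm (qPochInf q q), mul_div_cancel_right₀ _ (mul_ne_zero h1 h2)] at this
  exact this

theorem exists_norm_terminatingWeight_le {q z : ℂ} (hq : ‖q‖ < 1) (hz : ∀ j : ℕ, z * q ^ j ≠ 1) :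
    ∃ K : ℝ, 0 ≤ K ∧ ∀ N k, ‖terminatingWeight q z N k‖ ≤ K * ‖z‖ ^ k := by
  have h1 := norm_pos_iff.2 (qPochInf_ne_zero hq hz)
  have h2 := norm_pos_iff.2 (qPochInf_ne_zero hq (q_mul_pow_ne_one hq))
  set Eq := Real.exp (‖q‖ / (1 - ‖q‖))
  set Ez := Real.exp (‖z‖ / (1 - ‖q‖))
  refine ⟨Eq * Ez / ((‖qPochInf q z‖ / Ez) * (‖qPochInf q q‖ / Eq)), by positivity, fun N k => ?_⟩
  rw [terminatingWeight, norm_div, norm_mul, norm_mul, norm_mul, norm_pow, mul_comm (‖z‖ ^ k),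
    mul_div_right_comm]
  gcongr
  · exact norm_qPoch_le hq q N
  · exact norm_qPoch_le hq z _
  · exact div_le_of_le_mul₀ (Real.exp_pos _).le (norm_nonneg _) (by
      rw [mul_comm]; exact norm_qPochInf_le_mul_norm_qPoch hq z N)
  · exact div_le_of_le_mul₀ (Real.exp_pos _).le (norm_nonneg _) (by
      rw [mul_comm]; exact norm_qPochInf_le_mul_norm_qPoch hq q _)

/-- By induction on `M`: `terminatingSum_eq` replaces `z` by `q z`, and dominated convergence
applies once `‖q ^ M * z‖ < 1`. -/
theorem tendsto_terminatingSum_aux {q : ℂ} (hq : ‖q‖ < 1) (hq0 : q ≠ 0) (M : ℕ) :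
    ∀ {c : ℕ → ℕ → ℂ} {c' : ℕ → ℂ} {z : ℂ}, UniformlyQAnalytic q c →
      (∀ k, Tendsto (fun N => c N k) atTop (𝓝 (c' k))) → (∀ j : ℕ, z * q ^ j ≠ 1) →
      ‖q ^ M * z‖ < 1 →
      Tendsto (fun N => terminatingSum q z N (c N)) atTop (𝓝 (continuationAux q M c' z)) := by
  induction M with
  | zero =>
    intro c c' z hc hcc hz h
    rw [pow_zero, one_mul] at h
    obtain ⟨R, B, _, _, h'⟩ := hc
    have hB : ∀ N k, ‖c N k‖ ≤ B := fun N k => by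
      obtain ⟨_, _, _, _, hB⟩ := h' N
      exact hB k
    have hB0 : 0 ≤ B := (norm_nonneg _).trans (hB 0 0)
    obtain ⟨K, hK0, hK⟩ := exists_norm_terminatingWeight_le hq hz
    have e : ∀ N, terminatingSum q z N (c N) =
        ∑' k, if k ∈ Finset.range (N + 1) then c N k * terminatingWeight q z N k else 0 := by
      intro N
      rw [tsum_eq_sum (s := Finset.range (N + 1)) fun k hk => if_neg hk, terminatingSum]
      exact Finset.sum_congr rfl fun k hk => (if_pos hk).symm
    simp_rw [e, continuationAux]
    refine tendsto_tsum_of_dominated_convergence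
      ((summable_geometric_of_lt_one (norm_nonneg z) h).mul_left (B * K)) (fun k => ?_)
      (Eventually.of_forall fun N k => ?_)
    · refine ((hcc k).mul (tendsto_terminatingWeight hq hz k)).congr' ?_
      filter_upwards [eventually_ge_atTop k] with N hN
      rw [if_pos (Finset.mem_range.2 (by omega))]
    · split_ifs
      · rw [norm_mul, mul_assoc]
        exact mul_le_mul (hB N k) (hK N k) (norm_nonneg _) hB0
      · rw [norm_zero]
        positivity
  | succ M ih =>
    intro c c' z hc hcc hz h
    have hz1 : 1 - z ≠ 0 := by simpa using sub_ne_zero.2 (hz 0).symm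
    simp_rw [terminatingSum_eq hq hq0 hz]
    have h1 : Tendsto (fun N => terminatingSum q (q * z) N (qDiff q (c N))) atTop
        (𝓝 (continuationAux q M (qDiff q c') (q * z))) := by
      refine ih (hc.qDiff hq hq0) (fun k => ?_) (fun j => ?_) ?_
      · unfold qDiff
        split_ifs
        · exact ((hcc k).sub_const 0).div_const _
        · exact ((hcc k).sub (hcc (k - 1))).div_const _
      · have := hz (j + 1)
        rwa [pow_succ', ← mul_assoc, mul_comm z] at this
      · rwa [← mul_assoc, ← pow_succ]
    have h2 : Tendsto (fun N : ℕ => (1 - z * q ^ N) / (1 - z)) atTop (𝓝 ((1 - 0) / (1 - z))) :=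
      ((tendsto_mul_pow_atTop hq z).const_sub 1).div_const _
    convert h2.mul h1 using 2
    rw [continuationAux, sub_zero]
    ring

/-- The terminating sums converge to the analytic continuation of the power series. -/
theorem tendsto_terminatingSum {q z : ℂ} (hq : ‖q‖ < 1) (hq0 : q ≠ 0) {c : ℕ → ℕ → ℂ} {c' : ℕ → ℂ}
    (hc : UniformlyQAnalytic q c) (hc' : UniformlyQAnalytic q fun _ : Unit => c')
    (hcc : ∀ k, Tendsto (fun N => c N k) atTop (𝓝 (c' k))) (hz : ∀ j : ℕ, z * q ^ j ≠ 1) :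
    Tendsto (fun N => terminatingSum q z N (c N)) atTop (𝓝 (continuation q c' z)) := by
  obtain ⟨M, hM⟩ := exists_norm_pow_mul_lt_one hq z
  rw [continuation_eq hq hq0 hc' hz hM]
  exact tendsto_terminatingSum_aux hq hq0 M hc hcc hz hM

/-! ### Asymptotics of the two solutions -/

/-- Reversal of the factors of `(q ^ (-N))_k` and `(q ^ (1 - N) / z)_k`. -/
theorem q_pow_mul_qPoch_neg {q z : ℂ} (hq0 : q ≠ 0) (hz0 : z ≠ 0) (N : ℕ) {k : ℕ} (hk : k ≤ N) :
    q ^ k * qPoch q (1 / q ^ N) k * (qPoch q z N * qPoch q q (N - k)) =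
      z ^ k * (qPoch q q N * qPoch q z (N - k)) * qPoch q (q / (z * q ^ N)) k := by
  induction k with
  | zero => simp [qPoch_zero, mul_comm]
  | succ k ih =>
    have h := ih (by omega)
    obtain ⟨j, hj⟩ : ∃ j, N - k = j + 1 := ⟨N - k - 1, by omega⟩
    have hj' : N - (k + 1) = j := by omega
    have hN : N = k + (j + 1) := by omega
    rw [hj, qPoch_succ q q j, qPoch_succ q z j] at h
    rw [hj', qPoch_succ q (1 / q ^ N), qPoch_succ q (q / (z * q ^ N))]
    have e1 : q * (1 - 1 / q ^ N * q ^ k) = -(1 / q ^ j) * (1 - q * q ^ j) := by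
      rw [hN]
      field_simp
      ring
    have e2 : z * (1 - q / (z * q ^ N) * q ^ k) = -(1 / q ^ j) * (1 - z * q ^ j) := by
      rw [hN]
      field_simp
      ring
    calc _ = q ^ k * qPoch q (1 / q ^ N) k * (qPoch q z N * qPoch q q j) *
          (q * (1 - 1 / q ^ N * q ^ k)) := by ring
      _ = z ^ k * (qPoch q q N * qPoch q z j) * qPoch q (q / (z * q ^ N)) k *
          (z * (1 - q / (z * q ^ N) * q ^ k)) := by
        rw [e1, e2]
        linear_combination -(1 / q ^ j) * h
      _ = _ := by ring

theorem qPoch_inv_pow_eq_zero {q : ℂ} (hq0 : q ≠ 0) {N k : ℕ} (hk : N < k) :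
    qPoch q (1 / q ^ N) k = 0 :=
  Finset.prod_eq_zero (Finset.mem_range.2 hk) (by field_simp; ring)

/-- The coefficients of the terminating series `φ(a; p, s q ^ (N - 1), q ^ (-N))` with respect to
`terminatingWeight`. -/
noncomputable def terminatingCoeff (q s a : ℂ) (p : Fin 5 → ℂ) (N k : ℕ) : ℂ :=
  vwpCoeff q a p k * (qPoch q (s * q ^ N / q) k * (qPoch q (a * q * q ^ N) k)⁻¹)

/-- At `x = q ^ N` the series of the first solution terminates. -/
theorem phi_eq_terminatingSum {q s a : ℂ} {p : Fin 5 → ℂ} (P : Params q s a p) (N : ℕ) :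
    phi q a p (s * q ^ N / q) (1 / q ^ N) =
      terminatingSum q (s / (a * q)) N (terminatingCoeff q s a p N) := by
  have hq := P.q_ne_zero
  have hs := P.s_ne_zero
  have ha := P.a_ne_zero
  rw [phi_eq, terminatingSum, tsum_eq_sum (s := Finset.range (N + 1))]
  · refine Finset.sum_congr rfl fun k hk => ?_
    have hk' := Nat.lt_succ_iff.1 (Finset.mem_range.1 hk)
    have hz0 : s / (a * q) ≠ 0 := by positivity
    have h := q_pow_mul_qPoch_neg hq hz0 N hk'
    have n1 : qPoch q (s / (a * q)) N ≠ 0 :=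
      qPoch_ne_zero (P.sa_notPow.mul_pow_ne_one hq (-1) (by field_simp)) N
    have n2 := qPoch_ne_zero (q_mul_pow_ne_one P.norm_q) (N - k)
    have e1 : a * q / (s * q ^ N / q) = q / (s / (a * q) * q ^ N) := by field_simp
    have e2 : a * q / (1 / q ^ N) = a * q * q ^ N := by field_simp
    have n3 : qPoch q (q / (s / (a * q) * q ^ N)) k ≠ 0 :=
      qPoch_ne_zero (P.sa_notPow.inv.mul_pow_ne_one hq (2 - N) (by
        rw [zpow_sub₀ hq, zpow_natCast, zpow_ofNat]
        field_simp)) k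
    rw [terminatingCoeff, wellPoised, wellPoised, e1, e2, terminatingWeight]
    rw [← eq_div_iff (mul_ne_zero n1 n2)] at h
    rw [show ∀ u v w z t y : ℂ, u * (v / w * (z / t)) * y = u * (v * t⁻¹) * (y * z / w) by
      intros; ring, h]
    generalize qPoch q (q / (s / (a * q) * q ^ N)) k = T at n3 ⊢
    generalize qPoch q (s / (a * q)) N = U at n1 ⊢
    generalize qPoch q q (N - k) = V at n2 ⊢
    congr 1
    rw [div_right_comm, mul_div_cancel_right₀ _ n3]
  · intro k hk
    have hk' : N < k := by simpa using hk
    rw [wellPoised, wellPoised, qPoch_inv_pow_eq_zero hq hk']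
    simp

theorem uniformlyQAnalytic_terminatingCoeff {q s a : ℂ} {p : Fin 5 → ℂ} (P : Params q s a p) :
    UniformlyQAnalytic q (terminatingCoeff q s a p) := by
  have hq := P.norm_q
  have h1 : ∀ N : ℕ, ‖q ^ N‖ ≤ 1 := fun N => by
    rw [norm_pow]
    exact pow_le_one₀ (norm_nonneg _) hq.le
  have haq : qPochInf q (a * q) ≠ 0 := qPochInf_ne_zero hq
    (P.a_notPow.mul_pow_ne_one P.q_ne_zero 1 (by rw [zpow_one]))
  refine (uniformlyQAnalytic_vwpCoeff hq P.well_poised).mul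
    ((uniformlyQAnalytic_qPoch (Y := ‖s / q‖) hq fun N => ?_).mul
      (uniformlyQAnalytic_inv_qPoch (Y := ‖a * q‖)
        (η := ‖qPochInf q (a * q)‖ / Real.exp (‖a * q‖ / (1 - ‖q‖))) hq (fun N => ?_) (by positivity)
        fun N => ?_))
  · rw [mul_div_right_comm, norm_mul]
    exact mul_le_of_le_one_right (norm_nonneg _) (h1 N)
  · rw [norm_mul]
    exact mul_le_of_le_one_right (norm_nonneg _) (h1 N)
  · refine div_le_of_le_mul₀ (Real.exp_pos _).le (norm_nonneg _) ?_
    rw [qPochInf_eq_qPoch_mul hq (a * q) N, norm_mul, mul_comm]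
    gcongr
    exact norm_qPoch_le hq _ _

theorem tendsto_terminatingCoeff {q s a : ℂ} {p : Fin 5 → ℂ} (P : Params q s a p) (k : ℕ) :
    Tendsto (fun N => terminatingCoeff q s a p N k) atTop (𝓝 (vwpCoeff q a p k)) := by
  have hq := P.norm_q
  have h0 : qPoch q 0 k = 1 := by simp [qPoch]
  have h1 : Tendsto (fun N : ℕ => qPoch q (s * q ^ N / q) k) atTop (𝓝 1) := by
    have := (continuous_qPoch q k).continuousAt (x := 0)
    rw [← h0]
    refine this.tendsto.comp ?_
    simpa using (tendsto_mul_pow_atTop hq s).div_const q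
  have h2 : Tendsto (fun N : ℕ => qPoch q (a * q * q ^ N) k) atTop (𝓝 1) := by
    have := (continuous_qPoch q k).continuousAt (x := 0)
    rw [← h0]
    exact this.tendsto.comp (tendsto_mul_pow_atTop hq (a * q))
  simpa [terminatingCoeff] using (h1.mul (h2.inv₀ one_ne_zero)).const_mul (vwpCoeff q a p k)

/-- The value of the very-well-poised series `W(a; p)`, where `s = a³ q³ / ∏ p`. -/
noncomputable def wValue (q s a : ℂ) (p : Fin 5 → ℂ) : ℂ :=
  continuation q (vwpCoeff q a p) (s / (a * q))

theorem wArg_eq {q s a : ℂ} {p : Fin 5 → ℂ} (P : Params q s a p) : wArg q a p = s / (a * q) := by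
  have hq := P.q_ne_zero
  have hs := P.s_ne_zero
  have ha := P.a_ne_zero
  rw [wArg, P.prod_eq]
  field_simp

theorem tendsto_phi_terminating {q s a : ℂ} {p : Fin 5 → ℂ} (P : Params q s a p) :
    Tendsto (fun N : ℕ => phi q a p (s * q ^ N / q) (1 / q ^ N)) atTop (𝓝 (wValue q s a p)) := by
  have hq := P.q_ne_zero
  have ha := P.a_ne_zero
  simp_rw [phi_eq_terminatingSum P]
  exact tendsto_terminatingSum P.norm_q hq (uniformlyQAnalytic_terminatingCoeff P)
    (uniformlyQAnalytic_vwpCoeff P.norm_q P.well_poised) (tendsto_terminatingCoeff P)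
    (P.sa_notPow.mul_pow_ne_one hq (-1) (by field_simp))

theorem continuousAt_qPochInf_comp {q : ℂ} (hq : ‖q‖ < 1) {f : ℂ → ℂ} {x : ℂ}
    (hf : ContinuousAt f x) : ContinuousAt (fun y => qPochInf q (f y)) x :=
  ContinuousAt.comp (f := f) (continuous_qPochInf hq).continuousAt hf

theorem continuousAt_factor₁ {q s a x : ℂ} {p : Fin 5 → ℂ} (hq : ‖q‖ < 1)
    (h1 : qPochInf q (s * x / q) ≠ 0) (h2 : qPochInf q (s * x / (a * q)) ≠ 0)
    (h3 : ∀ i, qPochInf q (a * q * x / p i) ≠ 0) : ContinuousAt (factor₁ q s a p) x := by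
  have c : ContinuousAt (fun x => ∏ i, qPochInf q (a * q * x / p i)) x :=
    tendsto_finsetProd _ fun i _ => continuousAt_qPochInf_comp hq (by fun_prop)
  exact ((continuousAt_qPochInf_comp hq (by fun_prop)).mul
    (continuousAt_qPochInf_comp hq (by fun_prop))).div
    (((continuousAt_qPochInf_comp hq (by fun_prop)).mul
      (continuousAt_qPochInf_comp hq (by fun_prop))).mul c)
    (mul_ne_zero (mul_ne_zero h1 h2) (Finset.prod_ne_zero_iff.2 fun i _ => h3 i))

theorem continuousAt_factor₂ {q s a x : ℂ} {p : Fin 5 → ℂ} (hq : ‖q‖ < 1)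
    (h1 : qPochInf q (q * x) ≠ 0) (h2 : qPochInf q (a * x) ≠ 0)
    (h3 : ∀ i, qPochInf q (p i * (s * x / (a * q))) ≠ 0) : ContinuousAt (factor₂ q s a p) x := by
  have c : ContinuousAt (fun x => ∏ i, qPochInf q (p i * (s * x / (a * q)))) x :=
    tendsto_finsetProd _ fun i _ => continuousAt_qPochInf_comp hq (by fun_prop)
  exact ((continuousAt_qPochInf_comp hq (by fun_prop)).mul
    (continuousAt_qPochInf_comp hq (by fun_prop))).div
    (((continuousAt_qPochInf_comp hq (by fun_prop)).mul
      (continuousAt_qPochInf_comp hq (by fun_prop))).mul c)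
    (mul_ne_zero (mul_ne_zero h1 h2) (Finset.prod_ne_zero_iff.2 fun i _ => h3 i))

/-- As `N → ∞`, the terminating series in the first solution tends to `W(a; p)`. -/
theorem tendsto_sol₁_pow {q s a : ℂ} {p : Fin 5 → ℂ} (P : Params q s a p) :
    Tendsto (fun N : ℕ => sol₁ q s a p (q ^ N)) atTop (𝓝 (wValue q s a p)) := by
  have h1 : ContinuousAt (factor₁ q s a p) 0 :=
    continuousAt_factor₁ P.norm_q (by simp [qPochInf_zero]) (by simp [qPochInf_zero])
      fun i => by simp [qPochInf_zero]
  have h2 : factor₁ q s a p 0 = 1 := by simp [factor₁, qPochInf_zero]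
  have h3 := h1.tendsto.comp (tendsto_pow_atTop_nhds_zero_of_norm_lt_one P.norm_q)
  rw [h2] at h3
  simpa [sol₁] using h3.mul (tendsto_phi_terminating P)

/-- As `N → ∞`, the second solution tends to `W(q / a; q / p)`. Since `s = q ^ m`, its series
terminates too: it is `φ` with the dual parameters at the index `N + m - 2`. -/
theorem tendsto_sol₂_pow {q s a : ℂ} {p : Fin 5 → ℂ} {m : ℕ} (P : Params q s a p)
    (hs : s = q ^ m) :
    Tendsto (fun N : ℕ => sol₂ q s a p (q ^ N)) atTop
      (𝓝 (wValue q (q ^ 4 / s) (q / a) fun i => q / p i)) := by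
  have hq := P.q_ne_zero
  have hs0 := P.s_ne_zero
  have h1 : ContinuousAt (factor₂ q s a p) 0 :=
    continuousAt_factor₂ P.norm_q (by simp [qPochInf_zero]) (by simp [qPochInf_zero])
      fun i => by simp [qPochInf_zero]
  have h2 : factor₂ q s a p 0 = 1 := by simp [factor₂, qPochInf_zero]
  have h3 := h1.tendsto.comp (tendsto_pow_atTop_nhds_zero_of_norm_lt_one P.norm_q)
  rw [h2] at h3
  have h4 : Tendsto (fun N : ℕ => phi q (q / a) (fun i => q / p i) (q ^ 2 / (s * q ^ N))
      (q * q ^ N)) atTop (𝓝 (wValue q (q ^ 4 / s) (q / a) fun i => q / p i)) := by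
    have hN : Tendsto (fun N : ℕ => N + m - 2) atTop atTop :=
      (tendsto_sub_atTop_nat 2).comp (tendsto_add_atTop_nat m)
    refine ((tendsto_phi_terminating P.dual).comp hN).congr' ?_
    filter_upwards [eventually_ge_atTop 2] with N hN2
    have e : q ^ N * s = q ^ (N + m - 2) * q ^ 2 := by
      rw [hs, ← pow_add, ← pow_add]
      congr 1
      omega
    have e' : q ^ (N + m - 2) = q ^ N * s / q ^ 2 := by rw [e]; field_simp
    simp only [Function.comp_apply]
    rw [phi_comm, e']
    congr 1
    · field_simp
    · field_simp
  simpa [sol₂] using h3.mul h4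

/-! ### Limits at the points `q ^ N` -/

/-- The integer powers of `q` do not accumulate away from `0` and `∞`. -/
theorem eventually_notPow {q w : ℂ} (hq : ‖q‖ < 1) (hq0 : q ≠ 0) (hw : w ≠ 0) :
    ∀ᶠ y in 𝓝[≠] w, NotPow q y := by
  have hw' : 0 < ‖w‖ := norm_pos_iff.2 hw
  have h1 := tendsto_pow_atTop_nhds_zero_of_lt_one (norm_nonneg q) hq
  have h2 := h1.const_mul (2 * ‖w‖)
  rw [mul_zero] at h2
  obtain ⟨K, hK1, hK2⟩ := ((h1.eventually_lt_const (half_pos hw')).and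
    (h2.eventually_lt_const one_pos)).exists
  have e1 : ∀ᶠ y in 𝓝[≠] w, ‖w‖ / 2 < ‖y‖ ∧ ‖y‖ < 2 * ‖w‖ := by
    have c : ContinuousAt (fun y : ℂ => ‖y‖) w := continuous_norm.continuousAt
    exact ((c.eventually_const_lt (by linarith)).and
      (c.eventually_lt_const (by linarith))).filter_mono nhdsWithin_le_nhds
  have e2 : ∀ᶠ y in 𝓝[≠] w, ∀ k ∈ Set.Ioo (-(K : ℤ)) K, y * q ^ k ≠ 1 := by
    refine (eventually_all_finite (Set.finite_Ioo _ _)).2 fun k _ => ?_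
    rcases eq_or_ne (w * q ^ k) 1 with h | h
    · filter_upwards [self_mem_nhdsWithin] with y hy h'
      exact hy (mul_right_cancel₀ (zpow_ne_zero k hq0) (h'.trans h.symm))
    · have c : ContinuousAt (fun y : ℂ => y * q ^ k) w := by fun_prop
      exact (c.eventually_ne h).filter_mono nhdsWithin_le_nhds
  filter_upwards [e1, e2] with y hy1 hy2 k hk
  by_cases hk' : k ∈ Set.Ioo (-(K : ℤ)) K
  · exact hy2 k hk' hk
  rw [Set.mem_Ioo, not_and_or, not_lt, not_lt] at hk'
  have hn := congrArg norm hk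
  rw [norm_mul, norm_zpow, norm_one] at hn
  have hqn : 0 < ‖q‖ := norm_pos_iff.2 hq0
  rcases hk' with h | h
  · have h3 : ‖y‖ = ‖q‖ ^ (-k) := by
      rw [zpow_neg]
      exact eq_inv_of_mul_eq_one_left hn
    have h4 : ‖q‖ ^ (-k) ≤ ‖q‖ ^ (K : ℤ) := zpow_le_zpow_right_of_le_one₀ hqn hq.le (by omega)
    rw [zpow_natCast] at h4
    linarith
  · have h4 : ‖q‖ ^ k ≤ ‖q‖ ^ (K : ℤ) := zpow_le_zpow_right_of_le_one₀ hqn hq.le h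
    rw [zpow_natCast] at h4
    have h5 : 0 < ‖q‖ ^ K := pow_pos hqn K
    nlinarith

theorem eventually_notPow_mul {q w c : ℂ} (hq : ‖q‖ < 1) (hq0 : q ≠ 0) (hw : w ≠ 0) (hc : c ≠ 0) :
    ∀ᶠ x in 𝓝[≠] w, NotPow q (c * x) := by
  have h : HasDerivAt (fun x : ℂ => c * x) c w := by simpa using (hasDerivAt_id w).const_mul c
  exact (h.tendsto_nhdsNE hc).eventually (eventually_notPow hq hq0 (mul_ne_zero hc hw))

theorem eventually_notPow_mul_sq {q w c : ℂ} (hq : ‖q‖ < 1) (hq0 : q ≠ 0) (hw : w ≠ 0)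
    (hc : c ≠ 0) : ∀ᶠ x in 𝓝[≠] w, NotPow q (c * x ^ 2) := by
  have h : HasDerivAt (fun x : ℂ => c * x ^ 2) (c * (2 * w)) w := by
    simpa using ((hasDerivAt_id w).pow 2).const_mul c
  exact (h.tendsto_nhdsNE (mul_ne_zero hc (mul_ne_zero two_ne_zero hw))).eventually
    (eventually_notPow hq hq0 (mul_ne_zero hc (pow_ne_zero 2 hw)))

theorem eventually_generic {q s a : ℂ} {p : Fin 5 → ℂ} (P : Params q s a p) {w : ℂ} (hw : w ≠ 0) :
    ∀ᶠ x in 𝓝[≠] w, Generic q s a p x := by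
  have hq := P.norm_q
  have hq0 := P.q_ne_zero
  have hs := P.s_ne_zero
  have ha := P.a_ne_zero
  have hp := P.p_ne_zero
  have e0 : ∀ᶠ x in 𝓝[≠] w, x ≠ 0 := (eventually_ne_nhds hw).filter_mono nhdsWithin_le_nhds
  have e1 : ∀ᶠ x in 𝓝[≠] w, ∀ i, NotPow q (a / p i * x) := eventually_all.2 fun i =>
    eventually_notPow_mul hq hq0 hw (div_ne_zero ha (hp i))
  have e2 : ∀ᶠ x in 𝓝[≠] w, ∀ i, NotPow q (p i * s / a * x) := eventually_all.2 fun i =>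
    eventually_notPow_mul hq hq0 hw (div_ne_zero (mul_ne_zero (hp i) hs) ha)
  filter_upwards [e0, eventually_notPow hq hq0 hw, eventually_notPow_mul hq hq0 hw hs,
    eventually_notPow_mul_sq hq hq0 hw hs, eventually_notPow_mul hq hq0 hw ha,
    eventually_notPow_mul hq hq0 hw (div_ne_zero hs ha), eventually_notPow_mul_sq hq hq0 hw ha,
    eventually_notPow_mul_sq hq hq0 hw (div_ne_zero (pow_ne_zero 2 hs) ha), e1, e2]
    with x h0 h1 h2 h3 h4 h5 h6 h7 h8 h9
  refine ⟨h0, h1, h2, h3, h4, ?_, h6, ?_, fun i => ?_, fun i => ?_⟩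
  · rwa [div_mul_eq_mul_div] at h5
  · rwa [div_mul_eq_mul_div] at h7
  · have := h8 i
    rwa [div_mul_eq_mul_div] at this
  · have := h9 i
    rwa [div_mul_eq_mul_div] at this

section

variable {q s a : ℂ} {p : Fin 5 → ℂ} (P : Params q s a p)
include P

theorem Params.one_sub_pow_ne_zero {k : ℕ} (hk : k ≠ 0) : 1 - q ^ k ≠ 0 := by
  obtain ⟨j, rfl⟩ := Nat.exists_eq_succ_of_ne_zero hk
  have := q_mul_pow_ne_one P.norm_q j
  rw [← pow_succ'] at this
  exact sub_ne_zero.2 this.symm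

theorem Params.qPochInf_pow_ne_zero {k : ℕ} (hk : k ≠ 0) : qPochInf q (q ^ k) ≠ 0 := by
  obtain ⟨j, rfl⟩ := Nat.exists_eq_succ_of_ne_zero hk
  refine qPochInf_ne_zero P.norm_q fun i => ?_
  rw [← pow_add]
  have := q_mul_pow_ne_one P.norm_q (j + i)
  rw [← pow_succ'] at this
  convert this using 2
  omega

end

/-- The nonvanishing conditions of `Generic` that persist at the points `x = q ^ N` when `s` is a
power of `q`. -/
structure SemiGeneric (q s a : ℂ) (p : Fin 5 → ℂ) (x : ℂ) : Prop where
  ne_zero : x ≠ 0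
  ax_notPow : NotPow q (a * x)
  sxa_notPow : NotPow q (s * x / a)
  axp_notPow : ∀ i, NotPow q (a * x / p i)
  psxa_notPow : ∀ i, NotPow q (p i * s * x / a)

theorem semiGeneric_pow {q s a : ℂ} {p : Fin 5 → ℂ} {m : ℕ} (P : Params q s a p) (hs : s = q ^ m)
    (N : ℕ) : SemiGeneric q s a p (q ^ N) := by
  have hq0 := P.q_ne_zero
  refine ⟨pow_ne_zero _ hq0, ?_, ?_, fun i => ?_, fun i => ?_⟩
  · simpa using P.a_notPow.mul_zpow hq0 N
  · have := P.sa_notPow.mul_zpow hq0 N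
    rwa [zpow_natCast, div_mul_eq_mul_div] at this
  · have := (P.p_notPow i).inv.mul_zpow hq0 N
    rwa [zpow_natCast, inv_div, div_mul_eq_mul_div] at this
  · have := (P.p_notPow i).mul_zpow hq0 (m + N : ℕ)
    rwa [zpow_natCast, pow_add, ← hs, div_mul_eq_mul_div, ← mul_assoc] at this

/-- A simple zero over a simple zero. -/
theorem tendsto_one_sub_div_one_sub_sq {c : ℂ} (hc : c ≠ 0) :
    Tendsto (fun x : ℂ => (1 - x / c) / (1 - (x / c) ^ 2)) (𝓝[≠] c) (𝓝 (1 / 2)) := by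
  have h : Tendsto (fun x : ℂ => 1 / (1 + x / c)) (𝓝[≠] c) (𝓝 (1 / 2)) := by
    have e : (1 : ℂ) + c / c = 2 := by rw [div_self hc]; norm_num
    have : ContinuousAt (fun x : ℂ => 1 / (1 + x / c)) c :=
      ContinuousAt.div (by fun_prop) (by fun_prop) (by rw [e]; norm_num)
    have := this.tendsto
    rw [e] at this
    exact this.mono_left nhdsWithin_le_nhds
  refine h.congr' ?_
  filter_upwards [self_mem_nhdsWithin] with x hx
  have h1 : 1 - x / c ≠ 0 := by
    intro h0
    apply hx
    rw [sub_eq_zero, eq_div_iff hc, one_mul] at h0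
    exact h0.symm
  rw [show 1 - (x / c) ^ 2 = (1 - x / c) * (1 + x / c) by ring, div_mul_eq_div_div, div_self h1]

theorem exists_tendsto_mul {r u f : ℂ → ℂ} {w : ℂ} (hr : ∃ l, Tendsto r (𝓝[≠] w) (𝓝 l))
    (hu : ContinuousAt u w) (hf : ∀ x, f x = r x * u x) : ∃ l, Tendsto f (𝓝[≠] w) (𝓝 l) := by
  obtain ⟨l, hl⟩ := hr
  rw [funext hf]
  exact ⟨_, hl.mul (hu.tendsto.mono_left nhdsWithin_le_nhds)⟩

theorem exists_tendsto_of_continuousAt {r : ℂ → ℂ} {w : ℂ} (hr : ContinuousAt r w) :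
    ∃ l, Tendsto r (𝓝[≠] w) (𝓝 l) := ⟨_, hr.tendsto.mono_left nhdsWithin_le_nhds⟩

section

variable {q s a : ℂ} {p : Fin 5 → ℂ} {m : ℕ} (P : Params q s a p) (hs : s = q ^ m) (hm : 1 ≤ m)
include P hs hm

omit hm in
theorem Params.s_mul_sq_div {N j : ℕ} (i : ℕ) (h : j + i = m + 2 * N) :
    s * (q ^ N) ^ 2 / q ^ i = q ^ j := by
  rw [div_eq_iff (pow_ne_zero _ P.q_ne_zero), hs, ← pow_mul, ← pow_add, ← pow_add, h, mul_comm N]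

omit hm in
theorem Params.s_mul_div {N j : ℕ} (i : ℕ) (h : j + i = m + N) :
    s * q ^ N / q ^ i = q ^ j := by
  rw [div_eq_iff (pow_ne_zero _ P.q_ne_zero), hs, ← pow_add, ← pow_add, h]

theorem exists_tendsto_recA (N : ℕ) : ∃ l, Tendsto (recA q s a p) (𝓝[≠] (q ^ N)) (𝓝 l) := by
  have hq0 := P.q_ne_zero
  have ha := P.a_ne_zero
  have g := semiGeneric_pow P hs N
  have d1 : 1 - s * q ^ N / (a * q ^ 2) ≠ 0 :=
    g.sxa_notPow.one_sub_ne_zero (-2) (by field_simp)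
  have d2 : 1 - a * q * q ^ N ≠ 0 := g.ax_notPow.one_sub_ne_zero 1 (by rw [zpow_one]; ring)
  have d3 : 1 - s * (q ^ N) ^ 2 ≠ 0 := by
    have := P.s_mul_sq_div hs (N := N) 0 (j := m + 2 * N) (by omega)
    rw [pow_zero, div_one] at this
    rw [this]
    exact P.one_sub_pow_ne_zero (by omega)
  have r1 : ∃ l, Tendsto (fun x => (1 - s * x / q) / (1 - s * x ^ 2 / q)) (𝓝[≠] (q ^ N)) (𝓝 l) := by
    by_cases h : m = 1 ∧ N = 0
    · obtain ⟨rfl, rfl⟩ := h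
      refine ⟨1 / 2, ?_⟩
      have := tendsto_one_sub_div_one_sub_sq one_ne_zero
      simp only [div_one] at this
      rw [hs]
      simpa [mul_div_cancel_left₀ _ hq0] using this
    · refine exists_tendsto_of_continuousAt (ContinuousAt.div (by fun_prop) (by fun_prop) ?_)
      have := P.s_mul_sq_div hs (N := N) 1 (j := m + 2 * N - 1) (by omega)
      rw [pow_one] at this
      rw [this]
      exact P.one_sub_pow_ne_zero (by omega)
  have r2 : ∃ l, Tendsto (fun x => (1 - x) / ((1 - s * x ^ 2 / q ^ 2) * (1 - s * x ^ 2 / q)))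
      (𝓝[≠] (q ^ N)) (𝓝 l) := by
    have hq1 : 1 - q ≠ 0 := by simpa using P.one_sub_pow_ne_zero one_ne_zero
    have hlim := tendsto_one_sub_div_one_sub_sq one_ne_zero
    simp only [div_one] at hlim
    by_cases h : m = 1 ∧ N = 0
    · obtain ⟨rfl, rfl⟩ := h
      rw [pow_zero]
      have hc : ContinuousAt (fun x => 1 / (1 - x ^ 2 / q)) 1 :=
        ContinuousAt.div (by fun_prop) (by fun_prop) (by
          rw [one_pow]
          intro h0
          apply hq1
          field_simp at h0
          linear_combination -h0)
      refine exists_tendsto_mul ⟨_, hlim⟩ hc fun x => ?_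
      rw [hs, pow_one, mul_div_cancel_left₀ _ hq0, pow_two q, mul_div_mul_left _ _ hq0,
        mul_comm (1 - x ^ 2 / q), ← div_div, mul_one_div]
    by_cases h' : m = 2 ∧ N = 0
    · obtain ⟨rfl, rfl⟩ := h'
      rw [pow_zero]
      have hc : ContinuousAt (fun x => 1 / (1 - q * x ^ 2)) 1 :=
        ContinuousAt.div (by fun_prop) (by fun_prop) (by rwa [one_pow, mul_one])
      refine exists_tendsto_mul ⟨_, hlim⟩ hc fun x => ?_
      rw [hs, mul_div_cancel_left₀ _ (pow_ne_zero 2 hq0), pow_two q, mul_assoc,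
        mul_div_cancel_left₀ _ hq0, ← div_div, mul_one_div]
    refine exists_tendsto_of_continuousAt (ContinuousAt.div (by fun_prop) (by fun_prop)
      (mul_ne_zero ?_ ?_))
    · rw [P.s_mul_sq_div hs (N := N) 2 (j := m + 2 * N - 2) (by omega)]
      exact P.one_sub_pow_ne_zero (by omega)
    · have := P.s_mul_sq_div hs (N := N) 1 (j := m + 2 * N - 1) (by omega)
      rw [pow_one] at this
      rw [this]
      exact P.one_sub_pow_ne_zero (by omega)
  have r3 : ∃ l, Tendsto (fun x => (1 - s * x ^ 2 / q) / (1 - s * x ^ 2 / q))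
      (𝓝[≠] (q ^ N)) (𝓝 l) := by
    refine ⟨1, tendsto_const_nhds.congr' ?_⟩
    filter_upwards [eventually_generic P g.ne_zero] with x hx
    have := hx.q_sub_sxx P
    rw [div_self]
    intro h0
    apply this
    field_simp at h0
    simpa using h0
  obtain ⟨l1, h1⟩ := exists_tendsto_mul (u := fun x => (1 - s * x / (a * q)) *
    (1 - s * x / (a * q ^ 2)) * (∏ i, (1 - a * q * x / p i)) / ((1 - s * x ^ 2) *
      ((1 - s * x / (a * q ^ 2)) * (1 - a * q * x)))) r1 (ContinuousAt.div (by fun_prop)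
        (by fun_prop) (mul_ne_zero d3 (mul_ne_zero d1 d2))) fun _ => rfl
  obtain ⟨l2, h2⟩ := exists_tendsto_mul (u := fun x => q * (1 - a * x) * (1 - a * q * x) *
    (∏ i, (1 - p i * (s * x / (a * q ^ 2)))) / ((1 - s * x / (a * q ^ 2)) * (1 - a * q * x)))
      r2 (ContinuousAt.div (by fun_prop) (by fun_prop) (mul_ne_zero d1 d2)) fun _ => rfl
  obtain ⟨l3, h3⟩ := exists_tendsto_mul (u := fun x => s * x ^ 2 / (a * q) *
    (1 - s / (a * q ^ 2)) * (∏ i, (1 - p i)) / ((1 - s * x / (a * q ^ 2)) * (1 - a * q * x)))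
      r3 (ContinuousAt.div (by fun_prop) (by fun_prop) (mul_ne_zero d1 d2)) fun _ => rfl
  refine ⟨l1 + l2 + l3, ((h1.add h2).add h3).congr fun x => ?_⟩
  rw [recA]
  generalize 1 - s * x / q = A₁
  generalize 1 - s * x / (a * q) = A₂
  generalize 1 - s * x / (a * q ^ 2) = A₃
  generalize 1 - s * x ^ 2 = A₄
  generalize 1 - s * x ^ 2 / q ^ 2 = A₅
  generalize 1 - s * x ^ 2 / q = A₆
  generalize 1 - a * q * x = A₇
  generalize ∏ i, (1 - a * q * x / p i) = A₈
  generalize ∏ i, (1 - p i * (s * x / (a * q ^ 2))) = A₉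
  generalize ∏ i, (1 - p i) = A₁₀
  ring

theorem exists_tendsto_recB {N : ℕ} (hN : 1 ≤ N) :
    ∃ l, l ≠ 0 ∧ Tendsto (recB q s a p) (𝓝[≠] (q ^ N)) (𝓝 l) := by
  have hq0 := P.q_ne_zero
  have ha := P.a_ne_zero
  have g := semiGeneric_pow P hs N
  have r : ∃ l, l ≠ 0 ∧ Tendsto (fun x => (1 - s * x / q ^ 2) / (1 - s * x ^ 2 / q ^ 3))
      (𝓝[≠] (q ^ N)) (𝓝 l) := by
    by_cases h : m = 1 ∧ N = 1
    · obtain ⟨rfl, rfl⟩ := h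
      refine ⟨1 / 2, by norm_num, ?_⟩
      have := tendsto_one_sub_div_one_sub_sq hq0
      rw [pow_one q, hs]
      refine this.congr fun x => ?_
      congr 2
      · field_simp
      · field_simp
    · have e1 := P.s_mul_sq_div hs (N := N) 3 (j := m + 2 * N - 3) (by omega)
      have e2 := P.s_mul_div hs (N := N) 2 (j := m + N - 2) (by omega)
      have n1 : 1 - s * (q ^ N) ^ 2 / q ^ 3 ≠ 0 := by
        rw [e1]
        exact P.one_sub_pow_ne_zero (by omega)
      have n2 : 1 - s * q ^ N / q ^ 2 ≠ 0 := by
        rw [e2]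
        exact P.one_sub_pow_ne_zero (by omega)
      have hc : ContinuousAt (fun x => (1 - s * x / q ^ 2) / (1 - s * x ^ 2 / q ^ 3)) (q ^ N) :=
        ContinuousAt.div (by fun_prop) (by fun_prop) n1
      exact ⟨_, div_ne_zero n2 n1, hc.tendsto.mono_left nhdsWithin_le_nhds⟩
  obtain ⟨l, hl0, hl⟩ := r
  have n1 : 1 - s * (q ^ N) ^ 2 / q ≠ 0 := by
    have := P.s_mul_sq_div hs (N := N) 1 (j := m + 2 * N - 1) (by omega)
    rw [pow_one] at this
    rw [this]
    exact P.one_sub_pow_ne_zero (by omega)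
  have n2 : 1 - s * (q ^ N) ^ 2 / q ^ 2 ≠ 0 := by
    rw [P.s_mul_sq_div hs (N := N) 2 (j := m + 2 * N - 2) (by omega)]
    exact P.one_sub_pow_ne_zero (by omega)
  have hc : ContinuousAt (fun x => (1 - x) * (∏ i, (1 - a * x / p i)) *
      (∏ i, (1 - p i * (s * x / (a * q ^ 2)))) /
        ((1 - s * x ^ 2 / q) * (1 - s * x ^ 2 / q ^ 2) ^ 2)) (q ^ N) :=
    ContinuousAt.div (by fun_prop) (by fun_prop) (mul_ne_zero n1 (pow_ne_zero 2 n2))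
  refine ⟨_, mul_ne_zero hl0 (div_ne_zero (mul_ne_zero (mul_ne_zero
    (P.one_sub_pow_ne_zero (by omega : N ≠ 0)) (Finset.prod_ne_zero_iff.2 fun i _ => ?_))
    (Finset.prod_ne_zero_iff.2 fun i _ => ?_)) (mul_ne_zero n1 (pow_ne_zero 2 n2))),
    (hl.mul (hc.tendsto.mono_left nhdsWithin_le_nhds)).congr fun x => ?_⟩
  · exact (g.axp_notPow i).one_sub_ne_zero 0 (by simp)
  · exact (g.psxa_notPow i).one_sub_ne_zero (-2) (by field_simp)
  · rw [recB]
    generalize 1 - s * x / q ^ 2 = A₁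
    generalize 1 - s * x ^ 2 / q ^ 2 = A₅
    generalize 1 - s * x ^ 2 / q ^ 3 = A₇
    generalize 1 - s * x ^ 2 / q = A₆
    generalize ∏ i, (1 - a * x / p i) = A₈
    generalize ∏ i, (1 - p i * (s * x / (a * q ^ 2))) = A₉
    ring

end

section

variable {q s a : ℂ} {p : Fin 5 → ℂ} {m : ℕ} (P : Params q s a p) (hs : s = q ^ m) (hm : 1 ≤ m)
include P hs hm

/-- For `s = q` and `N = 0` the numerator and the denominator of `factor₁` both vanish at
`x = q ^ N`. -/
theorem exists_tendsto_factor₁ (N : ℕ) :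
    ∃ l, l ≠ 0 ∧ Tendsto (factor₁ q s a p) (𝓝[≠] (q ^ N)) (𝓝 l) := by
  have hq := P.norm_q
  have hq0 := P.q_ne_zero
  have ha := P.a_ne_zero
  have g := semiGeneric_pow P hs N
  have n1 : qPochInf q (s * (q ^ N) ^ 2 / q * q) ≠ 0 := by
    have := P.s_mul_sq_div hs (N := N) 0 (j := m + 2 * N) (by omega)
    rw [pow_zero, div_one] at this
    rw [div_mul_cancel₀ _ hq0, this]
    exact P.qPochInf_pow_ne_zero (by omega)
  have n2 : qPochInf q (s * q ^ N / q * q) ≠ 0 := by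
    have := P.s_mul_div hs (N := N) 0 (j := m + N) (by omega)
    rw [pow_zero, div_one] at this
    rw [div_mul_cancel₀ _ hq0, this]
    exact P.qPochInf_pow_ne_zero (by omega)
  -- for `s = q` and `N = 0` both products vanish at `x = 1`
  have r : ∃ l, l ≠ 0 ∧ Tendsto (fun x => (1 - s * x ^ 2 / q) / (1 - s * x / q))
      (𝓝[≠] (q ^ N)) (𝓝 l) := by
    by_cases h : m = 1 ∧ N = 0
    · obtain ⟨rfl, rfl⟩ := h
      refine ⟨(1 / 2)⁻¹, by norm_num, ?_⟩
      have := (tendsto_one_sub_div_one_sub_sq one_ne_zero).inv₀ (by norm_num)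
      simp only [div_one, inv_div] at this
      rw [hs]
      simpa [mul_div_cancel_left₀ _ hq0] using this
    · have n3 : 1 - s * q ^ N / q ≠ 0 := by
        have := P.s_mul_div hs (N := N) 1 (j := m + N - 1) (by omega)
        rw [pow_one] at this
        rw [this]
        exact P.one_sub_pow_ne_zero (by omega)
      have n4 : 1 - s * (q ^ N) ^ 2 / q ≠ 0 := by
        have := P.s_mul_sq_div hs (N := N) 1 (j := m + 2 * N - 1) (by omega)
        rw [pow_one] at this
        rw [this]
        exact P.one_sub_pow_ne_zero (by omega)
      have hc : ContinuousAt (fun x => (1 - s * x ^ 2 / q) / (1 - s * x / q)) (q ^ N) :=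
        ContinuousAt.div (by fun_prop) (by fun_prop) n3
      exact ⟨_, div_ne_zero n4 n3, hc.tendsto.mono_left nhdsWithin_le_nhds⟩
  obtain ⟨l, hl0, hl⟩ := r
  have n5 : qPochInf q (s * q ^ N / (a * q)) ≠ 0 :=
    qPochInf_ne_zero hq (g.sxa_notPow.mul_pow_ne_one hq0 (-1) (by field_simp))
  have n6 : ∏ i, qPochInf q (a * q * q ^ N / p i) ≠ 0 := Finset.prod_ne_zero_iff.2 fun i _ =>
    qPochInf_ne_zero hq ((g.axp_notPow i).mul_pow_ne_one hq0 1 (by rw [zpow_one]; ring))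
  have n7 : qPochInf q (a * q * q ^ N) ≠ 0 :=
    qPochInf_ne_zero hq (g.ax_notPow.mul_pow_ne_one hq0 1 (by rw [zpow_one]; ring))
  have c : ContinuousAt (fun x => ∏ i, qPochInf q (a * q * x / p i)) (q ^ N) :=
    tendsto_finsetProd _ fun i _ => continuousAt_qPochInf_comp hq (by fun_prop)
  have hc := ((continuousAt_qPochInf_comp hq (f := fun x => s * x ^ 2 / q * q) (x := q ^ N)
    (by fun_prop)).mul (continuousAt_qPochInf_comp hq (f := fun x => a * q * x) (by fun_prop))).div
    (((continuousAt_qPochInf_comp hq (f := fun x => s * x / q * q) (by fun_prop)).mul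
      (continuousAt_qPochInf_comp hq (f := fun x => s * x / (a * q)) (by fun_prop))).mul c)
    (mul_ne_zero (mul_ne_zero n2 n5) n6)
  refine ⟨_, mul_ne_zero hl0 (div_ne_zero (mul_ne_zero n1 n7) (mul_ne_zero (mul_ne_zero n2 n5) n6)),
    (hl.mul (hc.tendsto.mono_left nhdsWithin_le_nhds)).congr fun x => ?_⟩
  simp only [factor₁, Pi.div_apply, Pi.mul_apply]
  rw [qPochInf_eq hq (s * x ^ 2 / q), qPochInf_eq hq (s * x / q), div_mul_div_comm, mul_assoc,
    mul_assoc, mul_assoc, mul_assoc, mul_assoc]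

omit hm in
theorem tendsto_sol₁ (N : ℕ) {l : ℂ} (hl : Tendsto (factor₁ q s a p) (𝓝[≠] (q ^ N)) (𝓝 l)) :
    Tendsto (sol₁ q s a p) (𝓝[≠] (q ^ N)) (𝓝 (l * phi q a p (s * q ^ N / q) (1 / q ^ N))) := by
  have hq := P.norm_q
  have hq0 := P.q_ne_zero
  have ha := P.a_ne_zero
  have hs0 := P.s_ne_zero
  have g := semiGeneric_pow P hs N
  have hw := g.ne_zero
  refine hl.mul (tendsto_phi hq P.well_poised (by positivity) (one_div_ne_zero hw)
    (g.sxa_notPow.inv.mul_pow_ne_one hq0 2 (by field_simp))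
    (g.ax_notPow.mul_pow_ne_one hq0 1 (by rw [zpow_one]; field_simp)) ?_ ?_)
  · have c : ContinuousAt (fun x => s * x / q) (q ^ N) := by fun_prop
    exact c.tendsto.mono_left nhdsWithin_le_nhds
  · have c : ContinuousAt (fun x : ℂ => 1 / x) (q ^ N) :=
      continuousAt_const.div continuousAt_id hw
    exact c.tendsto.mono_left nhdsWithin_le_nhds

omit hm in
theorem tendsto_sol₂ (N : ℕ) :
    Tendsto (sol₂ q s a p) (𝓝[≠] (q ^ N)) (𝓝 (sol₂ q s a p (q ^ N))) := by
  have hq := P.norm_q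
  have hq0 := P.q_ne_zero
  have ha := P.a_ne_zero
  have hs0 := P.s_ne_zero
  have g := semiGeneric_pow P hs N
  have hw := g.ne_zero
  have h1 : ContinuousAt (factor₂ q s a p) (q ^ N) := continuousAt_factor₂ hq
    (by rw [← pow_succ']; exact P.qPochInf_pow_ne_zero (by omega))
    (qPochInf_ne_zero hq (g.ax_notPow.mul_pow_ne_one hq0 0 (by simp)))
    (fun i => qPochInf_ne_zero hq ((g.psxa_notPow i).mul_pow_ne_one hq0 (-1) (by field_simp)))
  refine (h1.tendsto.mono_left nhdsWithin_le_nhds).mul (tendsto_phi hq P.dual.well_poised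
    (by positivity) (by positivity)
    (g.sxa_notPow.mul_pow_ne_one hq0 0 (by rw [zpow_zero]; field_simp))
    (g.ax_notPow.inv.mul_pow_ne_one hq0 1 (by rw [zpow_one]; field_simp)) ?_ ?_)
  · have c : ContinuousAt (fun x => q ^ 2 / (s * x)) (q ^ N) :=
      continuousAt_const.div (by fun_prop) (mul_ne_zero hs0 hw)
    exact c.tendsto.mono_left nhdsWithin_le_nhds
  · have c : ContinuousAt (fun x => q * x) (q ^ N) := by fun_prop
    exact c.tendsto.mono_left nhdsWithin_le_nhds

omit hs hm in
/-- The inhomogeneous term for the first solution, with the factor `(1 / (q x))_∞` that vanishes at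
`x = q ^ N` taken out and the possible zeros `(s x / q)_∞` of the denominator cancelled. -/
theorem tail₁_eq {x : ℂ} (hx : Generic q s a p x) : factor₁ q s a p x *
    (scale₁ q s a x * contigTail q a p (s * x / q ^ 2) (1 / (q * x))) =
      qPochInf q a * (∏ i, qPochInf q (p i) / qPochInf q (a * q / p i)) / qPochInf q q / (1 - a) *
      (qPochInf q (1 / (q * x)) *
        (qPochInf q (s * x ^ 2 / q) * qPochInf q (a * q * x) *
        (s * x ^ 3 * (a * q ^ 2 - s)) /
        (qPochInf q (s * x / (a * q)) * (∏ i, qPochInf q (a * q * x / p i)) *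
          (a * (1 - a * q * x) * (1 - q * x) * (a * q ^ 2 - s * x)) *
          (qPochInf q (a * q / (s * x / q ^ 2)) * qPochInf q (a * q / (1 / (q * x))))))) := by
  have hq := P.norm_q
  have hq0 := P.q_ne_zero
  have ha := P.a_ne_zero
  have d1 := hx.q_sq_sub_sx P
  have d2 : qPochInf q (s * x / q) ≠ 0 :=
    qPochInf_ne_zero hq (hx.sx_notPow.mul_pow_ne_one hq0 (-1) (by field_simp))
  have e : s * x / q ^ 2 * q = s * x / q := by field_simp
  have e1 : 1 - s * x / q ^ 2 = (q ^ 2 - s * x) / q ^ 2 := by field_simp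
  simp only [factor₁, scale₁, contigTail]
  rw [qPochInf_eq hq (s * x / q ^ 2), e, e1]
  generalize qPochInf q (a * q / (s * x / q ^ 2)) = A₁
  generalize qPochInf q (a * q / (1 / (q * x))) = A₂
  generalize qPochInf q (1 / (q * x)) = A₃
  generalize qPochInf q (s * x / (a * q)) = A₄
  generalize qPochInf q (s * x / q) = A₅ at d2 ⊢
  generalize qPochInf q (s * x ^ 2 / q) = A₆
  generalize qPochInf q (a * q * x) = A₇
  generalize ∏ i, qPochInf q (a * q * x / p i) = A₈
  generalize ∏ i, qPochInf q (p i) / qPochInf q (a * q / p i) = A₉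
  generalize q ^ 2 - s * x = D₁ at d1 ⊢
  generalize 1 - a * q * x = D₂
  generalize 1 - q * x = D₃
  generalize a * q ^ 2 - s * x = D₄
  generalize a * q ^ 2 - s = D₅
  -- the factors that cancel, written as a quotient equal to `1`
  have h1 : D₁ / D₁ * (A₅ / A₅) * (q ^ 2 / q ^ 2) = 1 := by
    rw [div_self d1, div_self d2, div_self (pow_ne_zero 2 hq0), one_mul, one_mul]
  rw [← mul_one (_ / _ / (1 - a) * _), ← h1]
  ring

omit hm in
/-- The inhomogeneous term of the recurrence for the first solution vanishes in the limit, because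
`(q ^ (-N - 1))_∞ = 0`. -/
theorem tendsto_tail₁ (N : ℕ) : Tendsto (fun x => factor₁ q s a p x *
    (scale₁ q s a x * contigTail q a p (s * x / q ^ 2) (1 / (q * x)))) (𝓝[≠] (q ^ N)) (𝓝 0) := by
  have hq := P.norm_q
  have hq0 := P.q_ne_zero
  have ha := P.a_ne_zero
  have hs0 := P.s_ne_zero
  have g := semiGeneric_pow P hs N
  have hw := g.ne_zero
  have n5 : qPochInf q (s * q ^ N / (a * q)) ≠ 0 :=
    qPochInf_ne_zero hq (g.sxa_notPow.mul_pow_ne_one hq0 (-1) (by field_simp))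
  have n6 : ∏ i, qPochInf q (a * q * q ^ N / p i) ≠ 0 := Finset.prod_ne_zero_iff.2 fun i _ =>
    qPochInf_ne_zero hq ((g.axp_notPow i).mul_pow_ne_one hq0 1 (by rw [zpow_one]; ring))
  have n1 : 1 - a * q * q ^ N ≠ 0 := g.ax_notPow.one_sub_ne_zero 1 (by rw [zpow_one]; ring)
  have n2 : 1 - q * q ^ N ≠ 0 := by
    rw [← pow_succ']
    exact P.one_sub_pow_ne_zero (by omega)
  have n3 : a * q ^ 2 - s * q ^ N ≠ 0 :=
    g.sxa_notPow.sub_ne_zero (-2) (by positivity) (by field_simp)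
  have n4 : qPochInf q (a * q / (s * q ^ N / q ^ 2)) ≠ 0 :=
    qPochInf_ne_zero hq (g.sxa_notPow.inv.mul_pow_ne_one hq0 3 (by field_simp))
  have n7 : qPochInf q (a * q / (1 / (q * q ^ N))) ≠ 0 :=
    qPochInf_ne_zero hq (g.ax_notPow.mul_pow_ne_one hq0 2 (by field_simp))
  have c1 : ContinuousAt (fun x => qPochInf q (a * q / (s * x / q ^ 2))) (q ^ N) :=
    continuousAt_qPochInf_comp hq (continuousAt_const.div (by fun_prop) (by positivity))
  have c0 : ContinuousAt (fun x => 1 / (q * x)) (q ^ N) :=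
    continuousAt_const.div (by fun_prop) (by positivity)
  have c2 : ContinuousAt (fun x => qPochInf q (a * q / (1 / (q * x)))) (q ^ N) :=
    continuousAt_qPochInf_comp hq (continuousAt_const.div c0
      (one_div_ne_zero (mul_ne_zero hq0 hw)))
  have c3 : ContinuousAt (fun x => ∏ i, qPochInf q (a * q * x / p i)) (q ^ N) :=
    tendsto_finsetProd _ fun i _ => continuousAt_qPochInf_comp hq (by fun_prop)
  have c4 : ContinuousAt (fun x => qPochInf q (s * x / (a * q))) (q ^ N) :=
    continuousAt_qPochInf_comp hq (by fun_prop)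
  have c5 : ContinuousAt (fun x => a * (1 - a * q * x) * (1 - q * x) * (a * q ^ 2 - s * x))
    (q ^ N) := by fun_prop
  have c6 : ContinuousAt (fun x => s * x ^ 3 * (a * q ^ 2 - s)) (q ^ N) := by fun_prop
  have c7 : ContinuousAt (fun x => qPochInf q (s * x ^ 2 / q)) (q ^ N) :=
    continuousAt_qPochInf_comp hq (by fun_prop)
  have c8 : ContinuousAt (fun x => qPochInf q (a * q * x)) (q ^ N) :=
    continuousAt_qPochInf_comp hq (by fun_prop)
  have hc : ContinuousAt (fun x => qPochInf q (s * x ^ 2 / q) * qPochInf q (a * q * x) *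
        (s * x ^ 3 * (a * q ^ 2 - s)) /
        (qPochInf q (s * x / (a * q)) * (∏ i, qPochInf q (a * q * x / p i)) *
          (a * (1 - a * q * x) * (1 - q * x) * (a * q ^ 2 - s * x)) *
          (qPochInf q (a * q / (s * x / q ^ 2)) * qPochInf q (a * q / (1 / (q * x)))))) (q ^ N) :=
    ((c7.mul c8).mul c6).div (((c4.mul c3).mul c5).mul (c1.mul c2))
    (mul_ne_zero (mul_ne_zero (mul_ne_zero n5 n6) (mul_ne_zero (mul_ne_zero (mul_ne_zero ha n1) n2)
      n3)) (mul_ne_zero n4 n7))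
  have h0 : Tendsto (fun x => qPochInf q (1 / (q * x))) (𝓝[≠] (q ^ N)) (𝓝 0) := by
    have : qPochInf q (1 / (q * q ^ N)) = 0 :=
      qPochInf_eq_zero hq (j := N + 1) (by rw [pow_succ']; field_simp)
    rw [← this]
    exact (continuousAt_qPochInf_comp hq c0).tendsto.mono_left nhdsWithin_le_nhds
  have := (h0.mul (hc.tendsto.mono_left nhdsWithin_le_nhds)).const_mul
    (qPochInf q a * (∏ i, qPochInf q (p i) / qPochInf q (a * q / p i)) / qPochInf q q / (1 - a))
  rw [zero_mul, mul_zero] at this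
  refine this.congr' ?_
  filter_upwards [eventually_generic P hw] with x hx
  exact (tail₁_eq P hx).symm

omit hs hm in
/-- The inhomogeneous term for the second solution, with the product `(q² / (s x))_∞ (s x² / q)_∞`
taken out. At `x = q ^ N` its first factor vanishes, except for `s = q` and `N = 0`, when its second
factor does. -/
theorem tail₂_eq {x : ℂ} (hx : Generic q s a p x) : factor₂ q s a p x *
    (scale₂ q s a x * contigTail q (q / a) (fun i => q / p i) (q / (s * x)) x) =
      qPochInf q (q / a) * (∏ i, qPochInf q (q / p i) / qPochInf q (q / a * q / (q / p i))) /
        qPochInf q q / (1 - q / a) *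
      (qPochInf q (q / (s * x) * q) * qPochInf q (s * x ^ 2 / q) *
        (qPochInf q (s * x / a) * (a ^ 2 * x ^ 2 * (a * q - s)) /
        (qPochInf q (a * x) * (∏ i, qPochInf q (p i * (s * x / (a * q)))) *
          (q * (a - s * x) * (q - a * x)) *
          (qPochInf q (q / a * q / (q / (s * x))) * qPochInf q (q / a * q / x))))) := by
  have hq := P.norm_q
  have hq0 := P.q_ne_zero
  have ha := P.a_ne_zero
  have hs0 := P.s_ne_zero
  have hx0 := hx.ne_zero
  have d1 := hx.q_sub_sx P
  have d2 := hx.one_sub_x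
  have d3 : qPochInf q (q * x) ≠ 0 :=
    qPochInf_ne_zero hq (hx.x_notPow.mul_pow_ne_one hq0 1 (by rw [zpow_one, mul_comm]))
  have e1 : 1 - q / (s * x) = -(q - s * x) / (s * x) := by field_simp; ring
  simp only [factor₂, scale₂, contigTail]
  rw [qPochInf_eq hq (q / (s * x)), qPochInf_eq hq x, e1, mul_comm x q]
  generalize qPochInf q (q / a * q / (q / (s * x))) = A₁
  generalize qPochInf q (q / a * q / x) = A₂
  generalize qPochInf q (q / (s * x) * q) = A₃
  generalize qPochInf q (s * x / a) = A₄
  generalize qPochInf q (q * x) = A₅ at d3 ⊢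
  generalize qPochInf q (s * x ^ 2 / q) = A₆
  generalize qPochInf q (a * x) = A₇
  generalize ∏ i, qPochInf q (p i * (s * x / (a * q))) = A₈
  generalize ∏ i, qPochInf q (q / p i) / qPochInf q (q / a * q / (q / p i)) = A₉
  generalize q - s * x = D₁ at d1 ⊢
  generalize 1 - x = D₂ at d2 ⊢
  generalize a - s * x = D₃
  generalize q - a * x = D₄
  generalize a * q - s = D₅
  generalize 1 - q / a = D₆
  -- the factors that cancel, written as a quotient equal to `1`
  have h1 : D₁ / D₁ * (A₅ / A₅) * (D₂ / D₂) * (s * x / (s * x)) = 1 := by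
    rw [div_self d1, div_self d2, div_self d3, div_self (mul_ne_zero hs0 hx0)]
    norm_num
  rw [← mul_one (_ / _ / D₆ * _), ← h1]
  ring

/-- The inhomogeneous term of the recurrence for the second solution vanishes in the limit. -/
theorem tendsto_tail₂ (N : ℕ) : Tendsto (fun x => factor₂ q s a p x * (scale₂ q s a x *
    contigTail q (q / a) (fun i => q / p i) (q / (s * x)) x)) (𝓝[≠] (q ^ N)) (𝓝 0) := by
  have hq := P.norm_q
  have hq0 := P.q_ne_zero
  have ha := P.a_ne_zero
  have hs0 := P.s_ne_zero
  have g := semiGeneric_pow P hs N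
  have hw := g.ne_zero
  have n1 : qPochInf q (a * q ^ N) ≠ 0 :=
    qPochInf_ne_zero hq (g.ax_notPow.mul_pow_ne_one hq0 0 (by simp))
  have n2 : ∏ i, qPochInf q (p i * (s * q ^ N / (a * q))) ≠ 0 :=
    Finset.prod_ne_zero_iff.2 fun i _ =>
      qPochInf_ne_zero hq ((g.psxa_notPow i).mul_pow_ne_one hq0 (-1) (by field_simp))
  have n3 : a - s * q ^ N ≠ 0 := g.sxa_notPow.sub_ne_zero 0 ha (by field_simp)
  have n4 : q - a * q ^ N ≠ 0 := g.ax_notPow.sub_ne_zero (-1) hq0 (by field_simp)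
  have n5 : qPochInf q (q / a * q / (q / (s * q ^ N))) ≠ 0 :=
    qPochInf_ne_zero hq (g.sxa_notPow.mul_pow_ne_one hq0 1 (by field_simp))
  have n6 : qPochInf q (q / a * q / q ^ N) ≠ 0 :=
    qPochInf_ne_zero hq (g.ax_notPow.inv.mul_pow_ne_one hq0 2 (by field_simp))
  have c0 : ContinuousAt (fun x => q / (s * x)) (q ^ N) :=
    continuousAt_const.div (by fun_prop) (by positivity)
  have c1 : ContinuousAt (fun x => qPochInf q (q / a * q / (q / (s * x)))) (q ^ N) :=
    continuousAt_qPochInf_comp hq (continuousAt_const.div c0 (by positivity))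
  have c2 : ContinuousAt (fun x => qPochInf q (q / a * q / x)) (q ^ N) :=
    continuousAt_qPochInf_comp hq (continuousAt_const.div continuousAt_id (by positivity))
  have c3 : ContinuousAt (fun x => ∏ i, qPochInf q (p i * (s * x / (a * q)))) (q ^ N) :=
    tendsto_finsetProd _ fun i _ => continuousAt_qPochInf_comp hq (by fun_prop)
  have c4 : ContinuousAt (fun x => qPochInf q (a * x)) (q ^ N) :=
    continuousAt_qPochInf_comp hq (by fun_prop)
  have c5 : ContinuousAt (fun x => q * (a - s * x) * (q - a * x)) (q ^ N) := by fun_prop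
  have c6 : ContinuousAt (fun x => a ^ 2 * x ^ 2 * (a * q - s)) (q ^ N) := by fun_prop
  have c7 : ContinuousAt (fun x => qPochInf q (s * x / a)) (q ^ N) :=
    continuousAt_qPochInf_comp hq (by fun_prop)
  have hc : ContinuousAt (fun x => qPochInf q (s * x / a) * (a ^ 2 * x ^ 2 * (a * q - s)) /
        (qPochInf q (a * x) * (∏ i, qPochInf q (p i * (s * x / (a * q)))) *
          (q * (a - s * x) * (q - a * x)) *
          (qPochInf q (q / a * q / (q / (s * x))) * qPochInf q (q / a * q / x)))) (q ^ N) :=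
    (c7.mul c6).div (((c4.mul c3).mul c5).mul (c1.mul c2))
    (mul_ne_zero (mul_ne_zero (mul_ne_zero n1 n2) (mul_ne_zero (mul_ne_zero hq0 n3) n4))
      (mul_ne_zero n5 n6))
  have h0 : Tendsto (fun x => qPochInf q (q / (s * x) * q) * qPochInf q (s * x ^ 2 / q))
      (𝓝[≠] (q ^ N)) (𝓝 0) := by
    have : qPochInf q (q / (s * q ^ N) * q) * qPochInf q (s * (q ^ N) ^ 2 / q) = 0 := by
      by_cases h : m + N = 1
      · refine mul_eq_zero_of_right _ (qPochInf_eq_zero hq (j := 0) ?_)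
        have h1 : m = 1 := by omega
        have h2 : N = 0 := by omega
        rw [hs, h1, h2]
        field_simp
      · refine mul_eq_zero_of_left (qPochInf_eq_zero hq (j := m + N - 2) ?_) _
        rw [hs, ← pow_add, div_mul_eq_mul_div, div_mul_eq_mul_div, ← pow_two, ← pow_add,
          div_eq_one_iff_eq (pow_ne_zero _ hq0)]
        congr 1
        omega
    rw [← this]
    exact ((continuousAt_qPochInf_comp hq (c0.mul continuousAt_const)).mul
      (continuousAt_qPochInf_comp hq (by fun_prop))).tendsto.mono_left nhdsWithin_le_nhds
  have := (h0.mul (hc.tendsto.mono_left nhdsWithin_le_nhds)).const_mul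
    (qPochInf q (q / a) * (∏ i, qPochInf q (q / p i) / qPochInf q (q / a * q / (q / p i))) /
      qPochInf q q / (1 - q / a))
  rw [zero_mul, mul_zero] at this
  refine this.congr' ?_
  filter_upwards [eventually_generic P hw] with x hx
  exact (tail₂_eq P hx).symm

end

/-! ### Initial values -/

section

variable {q s a : ℂ} {p : Fin 5 → ℂ} {m : ℕ} (P : Params q s a p)
include P

/-- The factors that vanish at `x = 1` for `s = q` or `s = q ^ 2` are collected in the first
quotient. -/
theorem recB_mul_factor₁ {x : ℂ} (hx : Generic q s a p x) :
    recB q s a p x * factor₁ q s a p (x / q) =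
      (1 - x) / ((1 - s * x ^ 2 / q ^ 2) * qPochInf q (s * x / q)) *
        (qPochInf q (s * x ^ 2) * qPochInf q (a * x) * (∏ i, (1 - p i * (s * x / (a * q ^ 2)))) /
          (qPochInf q (s * x / (a * q ^ 2)) * ∏ i, qPochInf q (a * q * x / p i))) := by
  have hq := P.norm_q
  have hq0 := P.q_ne_zero
  have ha := P.a_ne_zero
  have e1 : s * (x / q) ^ 2 / q = s * x ^ 2 / q ^ 3 := by field_simp
  have e2 : a * q * (x / q) = a * x := by field_simp
  have e3 : s * (x / q) / q = s * x / q ^ 2 := by field_simp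
  have e4 : s * (x / q) / (a * q) = s * x / (a * q ^ 2) := by field_simp
  have e5 : s * x ^ 2 / q ^ 3 * q = s * x ^ 2 / q ^ 2 := by field_simp
  have e6 : s * x ^ 2 / q ^ 2 * q = s * x ^ 2 / q := by field_simp
  have e7 : s * x ^ 2 / q * q = s * x ^ 2 := by field_simp
  have e8 : s * x / q ^ 2 * q = s * x / q := by field_simp
  have e9 : ∏ i, qPochInf q (a * x / p i) =
      (∏ i, (1 - a * x / p i)) * ∏ i, qPochInf q (a * q * x / p i) := by
    rw [← Finset.prod_mul_distrib]
    refine Finset.prod_congr rfl fun i _ => ?_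
    rw [qPochInf_eq hq, show a * x / p i * q = a * q * x / p i by ring]
  have d1 : 1 - s * x ^ 2 / q ≠ 0 := hx.sxx_notPow.one_sub_ne_zero (-1) (by field_simp)
  have d2 : 1 - s * x ^ 2 / q ^ 2 ≠ 0 := hx.sxx_notPow.one_sub_ne_zero (-2) (by field_simp)
  have d3 : 1 - s * x ^ 2 / q ^ 3 ≠ 0 := hx.sxx_notPow.one_sub_ne_zero (-3) (by field_simp)
  have d4 : 1 - s * x / q ^ 2 ≠ 0 := hx.sx_notPow.one_sub_ne_zero (-2) (by field_simp)
  have d5 : ∏ i, (1 - a * x / p i) ≠ 0 := Finset.prod_ne_zero_iff.2 fun i _ =>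
    (hx.axp_notPow i).one_sub_ne_zero 0 (by simp)
  rw [recB, factor₁, e1, e2, e3, e4, e9, qPochInf_eq hq (s * x ^ 2 / q ^ 3), e5,
    qPochInf_eq hq (s * x ^ 2 / q ^ 2), e6, qPochInf_eq hq (s * x ^ 2 / q), e7,
    qPochInf_eq hq (s * x / q ^ 2), e8]
  generalize 1 - s * x ^ 2 / q ^ 3 = D₃ at d3 ⊢
  generalize 1 - s * x ^ 2 / q ^ 2 = D₂ at d2 ⊢
  generalize 1 - s * x ^ 2 / q = D₁ at d1 ⊢
  generalize 1 - s * x / q ^ 2 = D₄ at d4 ⊢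
  generalize ∏ i, (1 - a * x / p i) = D₅ at d5 ⊢
  generalize qPochInf q (s * x ^ 2) = A₁
  generalize qPochInf q (a * x) = A₂
  generalize qPochInf q (s * x / q) = A₃
  generalize qPochInf q (s * x / (a * q ^ 2)) = A₄
  generalize ∏ i, qPochInf q (a * q * x / p i) = A₅
  generalize ∏ i, (1 - p i * (s * x / (a * q ^ 2))) = A₆
  -- the factors that cancel, written as a quotient equal to `1`
  have h1 : D₁ / D₁ * (D₂ / D₂) * (D₃ / D₃) * (D₄ / D₄) * (D₅ / D₅) = 1 := by
    rw [div_self d1, div_self d2, div_self d3, div_self d4, div_self d5]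
    norm_num
  rw [← mul_one ((1 - x) / _ * _), ← h1]
  ring

/-- The factors that vanish at `x = 1` for `s = q ^ 2` are collected in the first quotient. -/
theorem recB_mul_factor₂ {x : ℂ} (hx : Generic q s a p x) :
    recB q s a p x * factor₂ q s a p (x / q) =
      (1 - s * x / q ^ 2) / (1 - s * x ^ 2 / q ^ 2) *
        (qPochInf q (s * x ^ 2) * qPochInf q (s * x / (a * q)) * (∏ i, (1 - a * x / p i)) /
          (qPochInf q (q * x) * qPochInf q (a * x / q) *
            ∏ i, qPochInf q (p i * (s * x / (a * q))))) := by
  have hq := P.norm_q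
  have hq0 := P.q_ne_zero
  have ha := P.a_ne_zero
  have e1 : s * (x / q) ^ 2 / q = s * x ^ 2 / q ^ 3 := by field_simp
  have e2 : s * (x / q) / a = s * x / (a * q) := by field_simp
  have e3 : a * (x / q) = a * x / q := by field_simp
  have e4 : s * (x / q) / (a * q) = s * x / (a * q ^ 2) := by field_simp
  have e5 : s * x ^ 2 / q ^ 3 * q = s * x ^ 2 / q ^ 2 := by field_simp
  have e6 : s * x ^ 2 / q ^ 2 * q = s * x ^ 2 / q := by field_simp
  have e7 : s * x ^ 2 / q * q = s * x ^ 2 := by field_simp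
  have e8 : q * (x / q) = x := by field_simp
  have e9 : ∏ i, qPochInf q (p i * (s * x / (a * q ^ 2))) =
      (∏ i, (1 - p i * (s * x / (a * q ^ 2)))) * ∏ i, qPochInf q (p i * (s * x / (a * q))) := by
    rw [← Finset.prod_mul_distrib]
    refine Finset.prod_congr rfl fun i _ => ?_
    rw [qPochInf_eq hq, show p i * (s * x / (a * q ^ 2)) * q = p i * (s * x / (a * q)) by
      field_simp]
  have d1 : 1 - s * x ^ 2 / q ≠ 0 := hx.sxx_notPow.one_sub_ne_zero (-1) (by field_simp)
  have d2 : 1 - s * x ^ 2 / q ^ 2 ≠ 0 := hx.sxx_notPow.one_sub_ne_zero (-2) (by field_simp)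
  have d3 : 1 - s * x ^ 2 / q ^ 3 ≠ 0 := hx.sxx_notPow.one_sub_ne_zero (-3) (by field_simp)
  have d4 := hx.one_sub_x
  have d5 : ∏ i, (1 - p i * (s * x / (a * q ^ 2))) ≠ 0 := Finset.prod_ne_zero_iff.2 fun i _ =>
    (hx.psxa_notPow i).one_sub_ne_zero (-2) (by field_simp)
  rw [recB, factor₂, e1, e2, e3, e4, e8, e9, qPochInf_eq hq (s * x ^ 2 / q ^ 3), e5,
    qPochInf_eq hq (s * x ^ 2 / q ^ 2), e6, qPochInf_eq hq (s * x ^ 2 / q), e7,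
    qPochInf_eq hq x, mul_comm x q]
  generalize 1 - s * x ^ 2 / q ^ 3 = D₃ at d3 ⊢
  generalize 1 - s * x ^ 2 / q ^ 2 = D₂ at d2 ⊢
  generalize 1 - s * x ^ 2 / q = D₁ at d1 ⊢
  generalize 1 - x = D₄ at d4 ⊢
  generalize ∏ i, (1 - p i * (s * x / (a * q ^ 2))) = D₅ at d5 ⊢
  generalize qPochInf q (s * x ^ 2) = A₁
  generalize qPochInf q (q * x) = A₂
  generalize qPochInf q (a * x / q) = A₃
  generalize qPochInf q (s * x / (a * q)) = A₄
  generalize ∏ i, qPochInf q (p i * (s * x / (a * q))) = A₅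
  generalize ∏ i, (1 - a * x / p i) = A₆
  generalize 1 - s * x / q ^ 2 = A₇
  -- the factors that cancel, written as a quotient equal to `1`
  have h1 : D₁ / D₁ * (D₂ / D₂) * (D₃ / D₃) * (D₄ / D₄) * (D₅ / D₅) = 1 := by
    rw [div_self d1, div_self d2, div_self d3, div_self d4, div_self d5]
    norm_num
  rw [← mul_one (A₇ / _ * _), ← h1]
  ring

variable (hs : s = q ^ m) (hm : 1 ≤ m)
include hs hm

/-- The limit of `b_n X_{n-1}^{(1)}`, up to elementary factors. It vanishes for `3 ≤ m`. For
`m = 1, 2` a vanishing denominator cancels the zero `1 - x` of `b_n`. -/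
theorem exists_tendsto_recB_mul_sol₁ : ∃ l, (3 ≤ m → l = 0) ∧ (m = 2 → l = 1 / 2 / qPochInf q q) ∧
    Tendsto (fun x => recB q s a p x * sol₁ q s a p (x / q)) (𝓝[≠] 1)
      (𝓝 (l * (qPochInf q s * qPochInf q a * (∏ i, (1 - p i * (s / (a * q ^ 2)))) /
        (qPochInf q (s / (a * q ^ 2)) * ∏ i, qPochInf q (a * q / p i))) *
          phi q a p (s / q ^ 2) q)) := by
  have hq := P.norm_q
  have hq0 := P.q_ne_zero
  have ha := P.a_ne_zero
  have hs0 := P.s_ne_zero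
  have hq1 : 1 - q ≠ 0 := by simpa using P.one_sub_pow_ne_zero one_ne_zero
  have hqq : qPochInf q q ≠ 0 := by simpa using P.qPochInf_pow_ne_zero one_ne_zero
  have r : ∃ l, (3 ≤ m → l = 0) ∧ (m = 2 → l = 1 / 2 / qPochInf q q) ∧
      Tendsto (fun x => (1 - x) / ((1 - s * x ^ 2 / q ^ 2) * qPochInf q (s * x / q))) (𝓝[≠] 1)
        (𝓝 l) := by
    have hm' : m = 1 ∨ m = 2 ∨ 3 ≤ m := by omega
    rcases hm' with rfl | rfl | hm'
    · have hne : 1 - (1 : ℂ) ^ 2 / q ≠ 0 := by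
        intro h0
        apply hq1
        field_simp at h0
        linear_combination -h0
      have hc : ContinuousAt (fun x => 1 / ((1 - x ^ 2 / q) * qPochInf q (x * q))) 1 :=
        continuousAt_const.div (ContinuousAt.mul (by fun_prop)
          (continuousAt_qPochInf_comp hq (by fun_prop))) (mul_ne_zero hne (by rwa [one_mul]))
      refine ⟨_, by omega, by omega, (hc.tendsto.mono_left nhdsWithin_le_nhds).congr' ?_⟩
      filter_upwards [self_mem_nhdsWithin] with x hx
      have hx' : 1 - x ≠ 0 := sub_ne_zero.2 (Ne.symm hx)
      rw [hs, pow_one, mul_div_cancel_left₀ _ hq0, pow_two q, mul_div_mul_left _ _ hq0,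
        qPochInf_eq hq x, mul_left_comm, div_mul_eq_div_div (1 - x), div_self hx']
    · have hc : ContinuousAt (fun x => 1 / qPochInf q (q * x)) 1 :=
        continuousAt_const.div (continuousAt_qPochInf_comp hq (by fun_prop)) (by rwa [mul_one])
      have hlim := tendsto_one_sub_div_one_sub_sq one_ne_zero
      simp only [div_one] at hlim
      have := hlim.mul (hc.tendsto.mono_left nhdsWithin_le_nhds)
      rw [mul_one, mul_one_div] at this
      refine ⟨_, by omega, fun _ => rfl, this.congr fun x => ?_⟩
      rw [hs, mul_div_cancel_left₀ _ (pow_ne_zero 2 hq0), pow_two q, mul_assoc,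
        mul_div_cancel_left₀ _ hq0, ← div_div, mul_one_div]
    · have e1 := P.s_mul_sq_div hs (N := 0) 2 (j := m - 2) (by omega)
      have e2 := P.s_mul_div hs (N := 0) 1 (j := m - 1) (by omega)
      rw [pow_zero] at e1 e2
      rw [pow_one] at e2
      have hc : ContinuousAt
          (fun x => (1 - x) / ((1 - s * x ^ 2 / q ^ 2) * qPochInf q (s * x / q))) 1 :=
        ContinuousAt.div (by fun_prop) (ContinuousAt.mul (by fun_prop)
          (continuousAt_qPochInf_comp hq (by fun_prop))) (by
            rw [e1, e2]
            exact mul_ne_zero (P.one_sub_pow_ne_zero (by omega))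
              (P.qPochInf_pow_ne_zero (by omega)))
      have := hc.tendsto
      rw [sub_self, zero_div] at this
      exact ⟨0, fun _ => rfl, by omega, this.mono_left nhdsWithin_le_nhds⟩
  obtain ⟨l, hl1, hl2, hl⟩ := r
  refine ⟨l, hl1, hl2, ?_⟩
  have g := semiGeneric_pow P hs 0
  rw [pow_zero] at g
  have n1 : qPochInf q (s * 1 / (a * q ^ 2)) ≠ 0 :=
    qPochInf_ne_zero hq (g.sxa_notPow.mul_pow_ne_one hq0 (-2) (by field_simp))
  have n2 : ∏ i, qPochInf q (a * q * 1 / p i) ≠ 0 := Finset.prod_ne_zero_iff.2 fun i _ =>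
    qPochInf_ne_zero hq ((g.axp_notPow i).mul_pow_ne_one hq0 1 (by rw [zpow_one]; ring))
  have c1 : ContinuousAt (fun x => qPochInf q (s * x ^ 2)) 1 :=
    continuousAt_qPochInf_comp hq (by fun_prop)
  have c2 : ContinuousAt (fun x => qPochInf q (a * x)) 1 :=
    continuousAt_qPochInf_comp hq (by fun_prop)
  have c3 : ContinuousAt (fun x => qPochInf q (s * x / (a * q ^ 2))) 1 :=
    continuousAt_qPochInf_comp hq (by fun_prop)
  have c4 : ContinuousAt (fun x => ∏ i, qPochInf q (a * q * x / p i)) 1 :=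
    tendsto_finsetProd _ fun i _ => continuousAt_qPochInf_comp hq (by fun_prop)
  have c5 : ContinuousAt (fun x => ∏ i, (1 - p i * (s * x / (a * q ^ 2)))) 1 := by fun_prop
  have hc : Tendsto (fun x => qPochInf q (s * x ^ 2) * qPochInf q (a * x) *
      (∏ i, (1 - p i * (s * x / (a * q ^ 2)))) /
        (qPochInf q (s * x / (a * q ^ 2)) * ∏ i, qPochInf q (a * q * x / p i))) (𝓝 1) _ :=
    ((c1.mul c2).mul c5).div (c3.mul c4) (mul_ne_zero n1 n2)
  simp only [Pi.div_apply, Pi.mul_apply, one_pow, mul_one] at hc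
  have hphi : Tendsto (fun x => phi q a p (s * x / q ^ 2) (q / x)) (𝓝[≠] 1)
      (𝓝 (phi q a p (s / q ^ 2) q)) := by
    refine tendsto_phi hq P.well_poised (by positivity) hq0
      (g.sxa_notPow.inv.mul_pow_ne_one hq0 3 (by field_simp))
      (g.ax_notPow.mul_pow_ne_one hq0 0 (by field_simp)) ?_ ?_
    · have c : ContinuousAt (fun x => s * x / q ^ 2) 1 := by fun_prop
      have := c.tendsto
      rw [mul_one] at this
      exact this.mono_left nhdsWithin_le_nhds
    · have c : ContinuousAt (fun x => q / x) 1 := continuousAt_const.div continuousAt_id one_ne_zero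
      have := c.tendsto
      rw [div_one] at this
      exact this.mono_left nhdsWithin_le_nhds
  refine ((hl.mul (hc.mono_left nhdsWithin_le_nhds)).mul hphi).congr' ?_
  filter_upwards [eventually_generic P one_ne_zero] with x hx
  have hx0 := hx.ne_zero
  rw [← recB_mul_factor₁ P hx, sol₁, show s * (x / q) / q = s * x / q ^ 2 by field_simp,
    one_div_div, mul_assoc]

/-- The limit of `b_n X_{n-1}^{(2)}`, up to elementary factors. One parameter of the series tends
to `1`, so the series does not contribute. -/
theorem exists_tendsto_recB_mul_sol₂ : ∃ l, l ≠ 0 ∧ (m = 2 → l = 1 / 2) ∧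
    Tendsto (fun x => recB q s a p x * sol₂ q s a p (x / q)) (𝓝[≠] 1)
      (𝓝 (l * (qPochInf q s * qPochInf q (s / (a * q)) * (∏ i, (1 - a / p i)) /
        (qPochInf q q * qPochInf q (a / q) * ∏ i, qPochInf q (p i * (s / (a * q))))))) := by
  have hq := P.norm_q
  have hq0 := P.q_ne_zero
  have ha := P.a_ne_zero
  have hs0 := P.s_ne_zero
  have hqq : qPochInf q q ≠ 0 := by simpa using P.qPochInf_pow_ne_zero one_ne_zero
  have r : ∃ l, l ≠ 0 ∧ (m = 2 → l = 1 / 2) ∧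
      Tendsto (fun x => (1 - s * x / q ^ 2) / (1 - s * x ^ 2 / q ^ 2)) (𝓝[≠] 1) (𝓝 l) := by
    by_cases hm2 : m = 2
    · refine ⟨1 / 2, by norm_num, fun _ => rfl, ?_⟩
      have hlim := tendsto_one_sub_div_one_sub_sq one_ne_zero
      simp only [div_one] at hlim
      simpa [hs, hm2, mul_div_cancel_left₀ _ (pow_ne_zero 2 hq0)] using hlim
    · have h0 : 1 - s * 1 / q ^ 2 ≠ 0 := by
        rw [mul_one, hs]
        intro h0
        rw [sub_eq_zero, eq_div_iff (pow_ne_zero 2 hq0), one_mul] at h0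
        rcases Nat.lt_or_ge m 2 with h | h
        · have : m = 1 := by omega
          rw [this, pow_one, pow_two] at h0
          exact P.one_sub_pow_ne_zero one_ne_zero (by
            rw [pow_one, sub_eq_zero]
            exact (mul_right_cancel₀ hq0 (h0.trans (one_mul q).symm)).symm)
        · obtain ⟨j, rfl⟩ : ∃ j, m = 2 + j := ⟨m - 2, by omega⟩
          rw [pow_add] at h0
          exact P.one_sub_pow_ne_zero (by omega : j ≠ 0) (by
            rw [sub_eq_zero]
            exact mul_left_cancel₀ (pow_ne_zero 2 hq0) (by rw [mul_one]; exact h0))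
      have h0' : 1 - s * 1 ^ 2 / q ^ 2 ≠ 0 := by rwa [one_pow]
      have hc : ContinuousAt (fun x => (1 - s * x / q ^ 2) / (1 - s * x ^ 2 / q ^ 2)) 1 :=
        ContinuousAt.div (by fun_prop) (by fun_prop) h0'
      exact ⟨_, div_ne_zero h0 h0', fun h => (hm2 h).elim, hc.tendsto.mono_left nhdsWithin_le_nhds⟩
  obtain ⟨l, hl1, hl2, hl⟩ := r
  refine ⟨l, hl1, hl2, ?_⟩
  have g := semiGeneric_pow P hs 0
  rw [pow_zero] at g
  have n1 : qPochInf q (q * 1) ≠ 0 := by rwa [mul_one]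
  have n2 : qPochInf q (a * 1 / q) ≠ 0 :=
    qPochInf_ne_zero hq (g.ax_notPow.mul_pow_ne_one hq0 (-1) (by field_simp))
  have n3 : ∏ i, qPochInf q (p i * (s * 1 / (a * q))) ≠ 0 := Finset.prod_ne_zero_iff.2 fun i _ =>
    qPochInf_ne_zero hq ((g.psxa_notPow i).mul_pow_ne_one hq0 (-1) (by field_simp))
  have c1 : ContinuousAt (fun x => qPochInf q (s * x ^ 2)) 1 :=
    continuousAt_qPochInf_comp hq (by fun_prop)
  have c2 : ContinuousAt (fun x => qPochInf q (s * x / (a * q))) 1 :=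
    continuousAt_qPochInf_comp hq (by fun_prop)
  have c3 : ContinuousAt (fun x => qPochInf q (q * x)) 1 :=
    continuousAt_qPochInf_comp hq (by fun_prop)
  have c4 : ContinuousAt (fun x => qPochInf q (a * x / q)) 1 :=
    continuousAt_qPochInf_comp hq (by fun_prop)
  have c5 : ContinuousAt (fun x => ∏ i, qPochInf q (p i * (s * x / (a * q)))) 1 :=
    tendsto_finsetProd _ fun i _ => continuousAt_qPochInf_comp hq (by fun_prop)
  have c6 : ContinuousAt (fun x => ∏ i, (1 - a * x / p i)) 1 := by fun_prop
  have hc : Tendsto (fun x => qPochInf q (s * x ^ 2) * qPochInf q (s * x / (a * q)) *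
      (∏ i, (1 - a * x / p i)) / (qPochInf q (q * x) * qPochInf q (a * x / q) *
            ∏ i, qPochInf q (p i * (s * x / (a * q))))) (𝓝 1) _ :=
    ((c1.mul c2).mul c6).div ((c3.mul c4).mul c5) (mul_ne_zero (mul_ne_zero n1 n2) n3)
  simp only [Pi.div_apply, Pi.mul_apply, one_pow, mul_one] at hc
  have hphi : Tendsto (fun x => phi q (q / a) (fun i => q / p i) (q ^ 3 / (s * x)) x) (𝓝[≠] 1)
      (𝓝 1) := by
    have h1 : phi q (q / a) (fun i => q / p i) (q ^ 3 / (s * 1)) 1 = 1 :=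
      phi_one_right q _ _ P.dual.a_ne_one
    have h2 : Tendsto (fun x => phi q (q / a) (fun i => q / p i) (q ^ 3 / (s * x)) x) (𝓝[≠] 1)
        (𝓝 (phi q (q / a) (fun i => q / p i) (q ^ 3 / (s * 1)) 1)) := by
      refine tendsto_phi hq P.dual.well_poised
        (div_ne_zero (pow_ne_zero 3 hq0) (mul_ne_zero hs0 one_ne_zero)) one_ne_zero
        (g.sxa_notPow.mul_pow_ne_one hq0 (-1) (by field_simp))
        (g.ax_notPow.inv.mul_pow_ne_one hq0 2 (by field_simp)) ?_ ?_
      · have c : ContinuousAt (fun x => q ^ 3 / (s * x)) 1 :=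
          continuousAt_const.div (by fun_prop) (mul_ne_zero hs0 one_ne_zero)
        exact c.tendsto.mono_left nhdsWithin_le_nhds
      · exact tendsto_id.mono_left nhdsWithin_le_nhds
    rwa [h1] at h2
  have := (hl.mul (hc.mono_left nhdsWithin_le_nhds)).mul hphi
  rw [mul_one] at this
  refine this.congr' ?_
  filter_upwards [eventually_generic P one_ne_zero] with x hx
  have hx0 := hx.ne_zero
  rw [← recB_mul_factor₂ P hx, sol₂, show q ^ 2 / (s * (x / q)) = q ^ 3 / (s * x) by field_simp,
    show q * (x / q) = x by field_simp, mul_assoc]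

/-- The Casoratian of the two solutions at the origin does not vanish. -/
theorem exists_initial_values : ∃ Y₁ Y₂ B₁ B₂ : ℂ,
    Tendsto (sol₁ q s a p) (𝓝[≠] 1) (𝓝 Y₁) ∧ Tendsto (sol₂ q s a p) (𝓝[≠] 1) (𝓝 Y₂) ∧
    Tendsto (fun x => recB q s a p x * sol₁ q s a p (x / q)) (𝓝[≠] 1) (𝓝 B₁) ∧
    Tendsto (fun x => recB q s a p x * sol₂ q s a p (x / q)) (𝓝[≠] 1) (𝓝 B₂) ∧
    Y₁ * B₂ - Y₂ * B₁ ≠ 0 := by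
  have hq := P.norm_q
  have hq0 := P.q_ne_zero
  have ha := P.a_ne_zero
  have hs0 := P.s_ne_zero
  have hqq : qPochInf q q ≠ 0 := by simpa using P.qPochInf_pow_ne_zero one_ne_zero
  obtain ⟨f, hf0, hf⟩ := exists_tendsto_factor₁ P hs hm 0
  have hY₁ := tendsto_sol₁ P hs 0 hf
  have hY₂ := tendsto_sol₂ P hs 0
  obtain ⟨l₁, h3, h2, hB₁⟩ := exists_tendsto_recB_mul_sol₁ P hs hm
  obtain ⟨l₂, hl₂, h2', hB₂⟩ := exists_tendsto_recB_mul_sol₂ P hs hm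
  rw [pow_zero] at hf hY₁ hY₂
  rw [div_one, phi_one_right q p _ P.a_ne_one, mul_one f] at hY₁
  refine ⟨_, _, _, _, hY₁, hY₂, hB₁, hB₂, ?_⟩
  have g := semiGeneric_pow P hs 0
  rw [pow_zero] at g
  have n1 : qPochInf q s ≠ 0 := by rw [hs]; exact P.qPochInf_pow_ne_zero (by omega)
  have n2 : qPochInf q (s / (a * q)) ≠ 0 :=
    qPochInf_ne_zero hq (g.sxa_notPow.mul_pow_ne_one hq0 (-1) (by field_simp))
  have n3 : ∏ i, (1 - a / p i) ≠ 0 := Finset.prod_ne_zero_iff.2 fun i _ =>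
    (g.axp_notPow i).one_sub_ne_zero 0 (by simp)
  have n4 : qPochInf q (a / q) ≠ 0 :=
    qPochInf_ne_zero hq (g.ax_notPow.mul_pow_ne_one hq0 (-1) (by field_simp))
  have n5 : ∏ i, qPochInf q (p i * (s / (a * q))) ≠ 0 := Finset.prod_ne_zero_iff.2 fun i _ =>
    qPochInf_ne_zero hq ((g.psxa_notPow i).mul_pow_ne_one hq0 (-1) (by field_simp))
  have nB : l₂ * (qPochInf q s * qPochInf q (s / (a * q)) * (∏ i, (1 - a / p i)) /
      (qPochInf q q * qPochInf q (a / q) * ∏ i, qPochInf q (p i * (s / (a * q))))) ≠ 0 :=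
    mul_ne_zero hl₂ (div_ne_zero (mul_ne_zero (mul_ne_zero n1 n2) n3)
      (mul_ne_zero (mul_ne_zero hqq n4) n5))
  have hm' : m = 1 ∨ m = 2 ∨ 3 ≤ m := by omega
  rcases hm' with rfl | rfl | hm'
  · have : sol₂ q s a p 1 = 0 := by
      have : qPochInf q (s * 1 ^ 2 / q) = 0 :=
        qPochInf_eq_zero hq (j := 0) (by rw [hs]; field_simp)
      rw [sol₂, factor₂, this]
      simp
    rw [this, zero_mul, sub_zero]
    exact mul_ne_zero hf0 nB
  · have hf1 : f = factor₁ q s a p 1 := by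
      refine tendsto_nhds_unique hf ((continuousAt_factor₁ hq ?_ ?_ fun i => ?_).tendsto.mono_left
        nhdsWithin_le_nhds)
      · rw [hs, mul_one, pow_two, mul_div_cancel_left₀ _ hq0]
        exact hqq
      · rwa [mul_one]
      · exact qPochInf_ne_zero hq ((g.axp_notPow i).mul_pow_ne_one hq0 1
          (by rw [zpow_one]; ring))
    have hp := P.p_ne_zero
    have n6 : qPochInf q (a * q) ≠ 0 :=
      qPochInf_ne_zero hq (g.ax_notPow.mul_pow_ne_one hq0 1 (by rw [zpow_one]; ring))
    have n7 : qPochInf q (q ^ 2 / a) ≠ 0 :=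
      qPochInf_ne_zero hq (g.ax_notPow.inv.mul_pow_ne_one hq0 2 (by field_simp))
    have n8 : ∏ i, qPochInf q (a * q / p i) ≠ 0 := Finset.prod_ne_zero_iff.2 fun i _ =>
      qPochInf_ne_zero hq ((g.axp_notPow i).mul_pow_ne_one hq0 1 (by rw [zpow_one]; ring))
    have e1 : s / q = q := by rw [hs]; field_simp
    have e2 : s / (a * q) = q / a := by rw [hs]; field_simp
    have e3 : s / (a * q ^ 2) = 1 / a := by rw [hs]; field_simp
    have e4 : s / q ^ 2 = 1 := by rw [hs]; field_simp
    have e5 : q ^ 2 / s = 1 := by rw [hs]; field_simp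
    have e6 : s / a = q ^ 2 / a := by rw [hs]
    have hR : ∏ i, (1 - p i * (1 / a)) = -(q / a ^ 2) * ∏ i, (1 - a / p i) := by
      have h1 : ∀ i, 1 - p i * (1 / a) = -(p i / a) * (1 - a / p i) := fun i => by
        have := hp i
        field_simp
        ring
      have h2 : ∏ i, -(p i / a) = -(q / a ^ 2) := by
        have h3 : ∏ i, -(p i / a) = -((∏ i, p i) / a ^ 5) := by
          simp only [Fin.prod_univ_five]
          field_simp
        rw [h3, P.prod_eq, hs]
        field_simp
      rw [Finset.prod_congr rfl fun i _ => h1 i, Finset.prod_mul_distrib, h2]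
    have x1 : qPochInf q a = (1 - a) * qPochInf q (a * q) := qPochInf_eq hq a
    have x2 : qPochInf q (q / a) = (1 - q / a) * qPochInf q (q ^ 2 / a) := by
      rw [qPochInf_eq hq, show q / a * q = q ^ 2 / a by ring]
    have x3 : qPochInf q (1 / a) = (1 - 1 / a) * qPochInf q (q / a) := by
      rw [qPochInf_eq hq, show 1 / a * q = q / a by ring]
    have x4 : qPochInf q (a / q) = (1 - a / q) * qPochInf q a := by
      rw [qPochInf_eq hq, div_mul_cancel₀ _ hq0]
    rw [hf1, h2 rfl, h2' rfl, sol₂, factor₁, factor₂]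
    simp only [one_pow, mul_one, e1, e2, e3, e4, e5, e6]
    rw [phi_one_left q p q P.a_ne_one, phi_one_left q _ q P.dual.a_ne_one, hR, x3, x4, x2, x1]
    rw [e2] at n5
    have d1 : a - q ≠ 0 := by
      have := g.ax_notPow.sub_ne_zero (-1) hq0 (v := a) (by field_simp)
      rw [← neg_sub]
      exact neg_ne_zero.2 this
    have d2 : a - 1 ≠ 0 := sub_ne_zero.2 P.a_ne_one
    have y1 : 1 - a = -(a - 1) := by ring
    have y2 : 1 - a / q = -(a - q) / q := by field_simp; ring
    have y3 : 1 - q / a = (a - q) / a := by field_simp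
    have y4 : 1 - 1 / a = (a - 1) / a := by field_simp
    rw [y1, y2, y3, y4]
    generalize a - 1 = D₂ at d2 ⊢
    generalize a - q = D₁ at d1 ⊢
    generalize qPochInf q s = S₂ at n1 ⊢
    generalize qPochInf q q = S at hqq ⊢
    generalize qPochInf q (a * q) = A₁ at n6 ⊢
    generalize qPochInf q (q ^ 2 / a) = A₂ at n7 ⊢
    generalize ∏ i, qPochInf q (a * q / p i) = A₃ at n8 ⊢
    generalize ∏ i, qPochInf q (p i * (q / a)) = A₄ at n5 ⊢
    generalize ∏ i, (1 - a / p i) = R at n3 ⊢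
    have key : ∀ t : ℂ, t = S₂ * R * q / (S * A₃ * A₄ * D₁ * D₂) → t ≠ 0 := by
      rintro t rfl
      positivity
    apply key
    field_simp
    ring
  · rw [h3 hm']
    simp only [zero_mul, mul_zero, sub_zero]
    exact mul_ne_zero hf0 nB

end

/-! ### A recurrence whose solutions do not both tend to zero -/

section

variable {q : ℂ} (hq : ‖q‖ < 1) (hq0 : q ≠ 0) {A b : ℕ → ℂ} (hb : ∀ N, b N ≠ 0)
  (hb1 : (fun N => b N / q - 1) =O[atTop] fun N => q ^ N)
include hq hq0 hb hb1

/-- The Casoratian `∏ b k` is of exact order `q ^ N`. -/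
theorem exists_tendsto_prod_div_pow :
    ∃ l, l ≠ 0 ∧ Tendsto (fun N => (∏ k ∈ Finset.range N, b k) / q ^ N) atTop (𝓝 l) := by
  obtain ⟨C, hC, hC'⟩ := Asymptotics.bound_of_isBigO_nat_atTop hb1
  have hs : Summable fun k => ‖b k / q - 1‖ := by
    refine Summable.of_nonneg_of_le (fun _ => norm_nonneg _)
      (fun k => hC' (pow_ne_zero k hq0)) ?_
    simp_rw [norm_pow]
    exact (summable_geometric_of_lt_one (norm_nonneg q) hq).mul_left C
  have h1 := (multipliable_one_add_of_summable hs).hasProd.tendsto_prod_nat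
  have h2 := tprod_one_add_ne_zero_of_summable (f := fun k => b k / q - 1)
    (fun k h => hb k (by
      have : b k / q = 0 := by linear_combination h
      rwa [div_eq_zero_iff, or_iff_left hq0] at this)) hs
  refine ⟨_, h2, h1.congr fun N => ?_⟩
  simp only [add_sub_cancel]
  rw [Finset.prod_div_distrib, Finset.prod_const, Finset.card_range]

variable (hA : (fun N => A N - 1 - b N) =O[atTop] fun N => q ^ N) {y : ℕ → ℂ}
  (hy : ∀ N, y (N + 2) = A N * y (N + 1) - b N * y N) (hy0 : Tendsto y atTop (𝓝 0))
include hA hy hy0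

/-- The differences of a null solution are `O((N + 1) ∏ b k)`: in the recurrence
`y (N + 2) - y (N + 1) = b N (y (N + 1) - y N) + (A N - 1 - b N) y (N + 1)` the last term, divided
by `∏ b k`, is bounded. -/
theorem exists_norm_sub_div_prod_le :
    ∃ K : ℝ, ∀ N : ℕ, ‖(y (N + 1) - y N) / ∏ k ∈ Finset.range N, b k‖ ≤ K * (N + 1) := by
  obtain ⟨l, hl0, hl⟩ := exists_tendsto_prod_div_pow hq hq0 hb hb1
  have hP : ∀ N, ∏ k ∈ Finset.range N, b k ≠ 0 := fun N => Finset.prod_ne_zero_iff.2 fun k _ => hb k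
  have h1 : (fun N => (A N - 1 - b N) / ∏ k ∈ Finset.range (N + 1), b k) =O[atTop]
      fun _ => (1 : ℂ) := by
    have h2 := (hl.inv₀ hl0).isBigO_one ℂ
    have h3 := (hA.mul (h2.comp_tendsto (tendsto_add_atTop_nat 1)))
    have h4 : (fun N => (A N - 1 - b N) / ∏ k ∈ Finset.range (N + 1), b k) =
        fun N => (q ^ (N + 1))⁻¹ * ((A N - 1 - b N) *
          ((fun N => ((∏ k ∈ Finset.range N, b k) / q ^ N)⁻¹) ∘ fun N => N + 1) N) := by
      funext N
      have := hP (N + 1)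
      simp only [Function.comp_apply]
      field_simp
    rw [h4]
    refine ((Asymptotics.isBigO_refl _ _).mul h3).trans ?_
    refine Asymptotics.IsBigO.of_bound ‖q‖⁻¹ (Eventually.of_forall fun N => ?_)
    simp only [Function.comp_apply, mul_one, norm_mul, norm_inv, norm_pow, norm_one]
    have := norm_pos_iff.2 hq0
    rw [pow_succ]
    field_simp
    exact le_rfl
  have h2 : (fun N => (A N - 1 - b N) / (∏ k ∈ Finset.range (N + 1), b k) * y (N + 1)) =O[atTop]
      fun _ => (1 : ℂ) := by
    simpa using h1.mul ((hy0.isBigO_one ℂ).comp_tendsto (tendsto_add_atTop_nat 1))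
  obtain ⟨C, hC, hC'⟩ := Asymptotics.bound_of_isBigO_nat_atTop h2
  refine ⟨C + ‖y 1 - y 0‖, fun N => ?_⟩
  induction N with
  | zero =>
    simp
    positivity
  | succ N ih =>
    have h3 : (y (N + 1 + 1) - y (N + 1)) / ∏ k ∈ Finset.range (N + 1), b k =
        (y (N + 1) - y N) / (∏ k ∈ Finset.range N, b k) +
          (A N - 1 - b N) / (∏ k ∈ Finset.range (N + 1), b k) * y (N + 1) := by
      have h4 := hP N
      have h5 := hb N
      rw [hy, Finset.prod_range_succ]
      field_simp
      ring
    rw [h3]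
    refine (norm_add_le _ _).trans ?_
    have h6 := hC' (x := N) one_ne_zero
    rw [norm_one, mul_one] at h6
    push_cast
    nlinarith [norm_nonneg (y 1 - y 0)]

/-- A null solution is the sum of its differences, which decay like `(N + 1) q ^ N`. -/
theorem tendsto_succ_mul_norm : Tendsto (fun N : ℕ => ((N : ℝ) + 1) * ‖y N‖) atTop (𝓝 0) := by
  obtain ⟨K, hK⟩ := exists_norm_sub_div_prod_le hq hq0 hb hb1 hA hy hy0
  obtain ⟨l, hl0, hl⟩ := exists_tendsto_prod_div_pow hq hq0 hb hb1
  have hP : ∀ N, ∏ k ∈ Finset.range N, b k ≠ 0 := fun N => Finset.prod_ne_zero_iff.2 fun k _ => hb k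
  obtain ⟨C, hC⟩ := (Metric.isBounded_range_of_tendsto _ hl).exists_norm_le
  have hC' : ∀ N, ‖∏ k ∈ Finset.range N, b k‖ ≤ C * ‖q‖ ^ N := fun N => by
    have := hC _ ⟨N, rfl⟩
    rwa [norm_div, norm_pow, div_le_iff₀ (pow_pos (norm_pos_iff.2 hq0) N)] at this
  have hK0 : 0 ≤ K := by
    have := (norm_nonneg _).trans (hK 0)
    simpa using this
  have hC0 : 0 ≤ C := (norm_nonneg _).trans (hC _ ⟨0, rfl⟩)
  set e : ℕ → ℝ := fun k => K * (k + 1) * (C * ‖q‖ ^ k) with he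
  have hd : ∀ N, dist (y N) (y N.succ) ≤ e N := by
    intro N
    rw [dist_comm, dist_eq_norm, Nat.succ_eq_add_one, ← div_mul_cancel₀ (y (N + 1) - y N) (hP N),
      norm_mul]
    exact mul_le_mul (hK N) (hC' N) (norm_nonneg _) (by positivity)
  have hf : Summable fun k : ℕ => ((k : ℝ) + 1) * e k := by
    have hq' : ‖‖q‖‖ < 1 := by rwa [norm_norm]
    have h := (((summable_pow_mul_geometric_of_norm_lt_one 2 hq').add
      ((summable_pow_mul_geometric_of_norm_lt_one 1 hq').mul_left 2)).add
        (summable_pow_mul_geometric_of_norm_lt_one 0 hq')).mul_left (K * C)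
    refine h.congr fun k => ?_
    simp only [he]
    ring
  have he0 : ∀ k, 0 ≤ e k := fun k => by positivity
  have hes : Summable e := Summable.of_nonneg_of_le he0 (fun k => by
    nlinarith [he0 k, (Nat.cast_nonneg k : (0 : ℝ) ≤ k)]) hf
  have htail := tendsto_sum_nat_add fun k : ℕ => ((k : ℝ) + 1) * e k
  refine squeeze_zero (fun N => by positivity) (fun N => ?_) htail
  have h1 := dist_le_tsum_of_dist_le_of_tendsto e hd hes hy0 N
  rw [dist_zero_right] at h1
  have hes' : Summable fun k => e (N + k) := by
    simpa only [add_comm N] using (summable_nat_add_iff N).2 hes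
  have hf' := (summable_nat_add_iff N).2 hf
  calc ((N : ℝ) + 1) * ‖y N‖ ≤ ((N : ℝ) + 1) * ∑' k, e (N + k) := by gcongr
    _ = ∑' k, ((N : ℝ) + 1) * e (N + k) := tsum_mul_left.symm
    _ ≤ _ := by
      refine (hes'.mul_left _).tsum_le_tsum (fun k => ?_) hf'
      rw [add_comm N k]
      have := he0 (k + N)
      gcongr
      linarith [(Nat.cast_nonneg k : (0 : ℝ) ≤ k)]

/-- Two solutions of a recurrence with limiting characteristic roots `1` and `q`, attained at a
geometric rate, cannot both tend to zero unless their Casoratian vanishes: the Casoratian is of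
exact order `q ^ N`, while the differences of null solutions would be `O((N + 1) q ^ N)`, and the
solutions themselves `o(1 / (N + 1))`. -/
theorem casoratian_eq_zero {z : ℕ → ℂ} (hz : ∀ N, z (N + 2) = A N * z (N + 1) - b N * z N)
    (hz0 : Tendsto z atTop (𝓝 0)) : y 1 * z 0 - z 1 * y 0 = 0 := by
  have hP : ∀ N, ∏ k ∈ Finset.range N, b k ≠ 0 := fun N => Finset.prod_ne_zero_iff.2 fun k _ => hb k
  have hcas : ∀ N, y (N + 1) * z N - z (N + 1) * y N =
      (y 1 * z 0 - z 1 * y 0) * ∏ k ∈ Finset.range N, b k := by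
    intro N
    induction N with
    | zero => simp
    | succ N ih =>
      rw [hy, hz, Finset.prod_range_succ, ← mul_assoc, ← ih]
      ring
  obtain ⟨K, hK⟩ := exists_norm_sub_div_prod_le hq hq0 hb hb1 hA hy hy0
  obtain ⟨K', hK'⟩ := exists_norm_sub_div_prod_le hq hq0 hb hb1 hA hz hz0
  have h1 := (tendsto_succ_mul_norm hq hq0 hb hb1 hA hz hz0).const_mul K
  have h2 := (tendsto_succ_mul_norm hq hq0 hb hb1 hA hy hy0).const_mul K'
  have h3 := h1.add h2
  rw [mul_zero, mul_zero, add_zero] at h3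
  have h4 : ∀ N : ℕ, ‖y 1 * z 0 - z 1 * y 0‖ ≤ K * (((N : ℝ) + 1) * ‖z N‖) +
      K' * (((N : ℝ) + 1) * ‖y N‖) := by
    intro N
    have e : y 1 * z 0 - z 1 * y 0 = (y (N + 1) - y N) / (∏ k ∈ Finset.range N, b k) * z N -
        (z (N + 1) - z N) / (∏ k ∈ Finset.range N, b k) * y N := by
      have := hP N
      field_simp
      linear_combination -hcas N
    rw [e]
    refine (norm_sub_le _ _).trans ?_
    rw [norm_mul, norm_mul, ← mul_assoc, ← mul_assoc]
    gcongr
    · exact hK N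
    · exact hK' N
  exact norm_le_zero_iff.1 (ge_of_tendsto' h3 h4)

end

/-- Limits along `q ^ N` of a function that is differentiable at `0`. The limits, rather than the
values, are needed where the function is indeterminate. -/
theorem isBigO_pow_of_tendsto {q : ℂ} (hq : ‖q‖ < 1) {f : ℂ → ℂ} {v : ℕ → ℂ}
    (hf : DifferentiableAt ℂ f 0)
    (hv : ∀ N, 1 ≤ N → Tendsto f (𝓝[≠] (q ^ N)) (𝓝 (v N))) :
    (fun N => v N - f 0) =O[atTop] fun N => q ^ N := by
  obtain ⟨C, hC⟩ := hf.isBigO_sub.bound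
  obtain ⟨U, hU, hUo, hU0⟩ := eventually_nhds_iff.1 hC
  refine Asymptotics.IsBigO.of_bound C ?_
  filter_upwards [eventually_ge_atTop 1,
    (tendsto_pow_atTop_nhds_zero_of_norm_lt_one hq).eventually (hUo.mem_nhds hU0)] with N hN hNU
  have h1 : Tendsto (fun x => ‖f x - f 0‖) (𝓝[≠] (q ^ N)) (𝓝 ‖v N - f 0‖) :=
    ((hv N hN).sub_const _).norm
  have h2 : Tendsto (fun x => C * ‖x - 0‖) (𝓝[≠] (q ^ N)) (𝓝 (C * ‖q ^ N - 0‖)) := by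
    have c : ContinuousAt (fun x : ℂ => C * ‖x - 0‖) (q ^ N) := by fun_prop
    exact c.tendsto.mono_left nhdsWithin_le_nhds
  rw [sub_zero] at h2
  refine le_of_tendsto_of_tendsto h1 h2 ?_
  filter_upwards [mem_nhdsWithin_of_mem_nhds (hUo.mem_nhds hNU)] with x hx
  exact hU x hx

theorem tendsto_mul_nhdsNE {q : ℂ} (hq0 : q ≠ 0) (w : ℂ) :
    Tendsto (fun x => x * q) (𝓝[≠] w) (𝓝[≠] (w * q)) := by
  have h : HasDerivAt (fun x : ℂ => x * q) q w := by simpa using (hasDerivAt_id w).mul_const q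
  exact h.tendsto_nhdsNE hq0

theorem tendsto_div_nhdsNE {q : ℂ} (hq0 : q ≠ 0) (w : ℂ) :
    Tendsto (fun x => x / q) (𝓝[≠] w) (𝓝[≠] (w / q)) := by
  simpa only [div_eq_mul_inv] using tendsto_mul_nhdsNE (inv_ne_zero hq0) w

theorem differentiableAt_recA (q s a : ℂ) (p : Fin 5 → ℂ) :
    DifferentiableAt ℂ (recA q s a p) 0 := by
  unfold recA
  refine DifferentiableAt.div (((DifferentiableAt.div (by fun_prop) (by fun_prop) (by simp)).add
    (DifferentiableAt.div (by fun_prop) (by fun_prop) (by simp))).add (by fun_prop))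
    (by fun_prop) (by simp)

theorem differentiableAt_recB (q s a : ℂ) (p : Fin 5 → ℂ) :
    DifferentiableAt ℂ (recB q s a p) 0 := by
  unfold recB
  exact DifferentiableAt.div (by fun_prop) (by fun_prop) (by simp)

theorem recA_zero (q s a : ℂ) (p : Fin 5 → ℂ) : recA q s a p 0 = 1 + q := by simp [recA]

theorem recB_zero (q s a : ℂ) (p : Fin 5 → ℂ) : recB q s a p 0 = 1 := by simp [recB]

/-- A recurrence with vanishing inhomogeneous term, in the limit `x → w`. -/
theorem tendsto_recurrence {q : ℂ} (hq0 : q ≠ 0) {f A B R : ℂ → ℂ} {w y₁ y₀ α c : ℂ}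
    (h : ∀ᶠ x in 𝓝[≠] w, f (x * q) - A x * f x + q * B x * f (x / q) = R x)
    (hR : Tendsto R (𝓝[≠] w) (𝓝 0)) (h1 : Tendsto f (𝓝[≠] (w * q)) (𝓝 y₁))
    (h0 : Tendsto f (𝓝[≠] w) (𝓝 y₀)) (hA : Tendsto A (𝓝[≠] w) (𝓝 α))
    (hc : Tendsto (fun x => B x * f (x / q)) (𝓝[≠] w) (𝓝 c)) : y₁ = α * y₀ - q * c := by
  have h2 := ((h1.comp (tendsto_mul_nhdsNE hq0 w)).sub (hA.mul h0)).add (hc.const_mul q)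
  have h3 : Tendsto R (𝓝[≠] w) (𝓝 (y₁ - α * y₀ + q * c)) := by
    refine h2.congr' ?_
    filter_upwards [h] with x hx
    rw [← hx, Function.comp_apply]
    ring
  linear_combination tendsto_nhds_unique h3 hR

/-- The limits `α`, `β`, `Y₁`, `Y₂` at `x = q ^ N` of the coefficients and of the two solutions
of the recurrence. The limits satisfy the homogeneous recurrence, with `B₁` and `B₂` in place of the terms
with `b_0`, tend to the values of the `₈φ₇` series as `N → ∞`, and are linearly independent. By
`casoratian_eq_zero` the two `₈φ₇` series do not both vanish. -/
theorem exists_limits {q s a : ℂ} {p : Fin 5 → ℂ} {m : ℕ} (P : Params q s a p) (hs : s = q ^ m)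
    (hm : 1 ≤ m) : ∃ (α β Y₁ Y₂ : ℕ → ℂ) (B₁ B₂ : ℂ),
      (∀ N, Tendsto (recA q s a p) (𝓝[≠] (q ^ N)) (𝓝 (α N))) ∧
      (∀ N, 1 ≤ N → Tendsto (recB q s a p) (𝓝[≠] (q ^ N)) (𝓝 (β N))) ∧
      Tendsto (sol₁ q s a p) (𝓝[≠] 1) (𝓝 (Y₁ 0)) ∧
      Tendsto (sol₂ q s a p) (𝓝[≠] 1) (𝓝 (Y₂ 0)) ∧
      Tendsto (fun x => recB q s a p x * sol₁ q s a p (x / q)) (𝓝[≠] 1) (𝓝 B₁) ∧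
      Tendsto (fun x => recB q s a p x * sol₂ q s a p (x / q)) (𝓝[≠] 1) (𝓝 B₂) ∧
      (Y₁ 1 = α 0 * Y₁ 0 - q * B₁ ∧
        ∀ N, Y₁ (N + 2) = α (N + 1) * Y₁ (N + 1) - q * β (N + 1) * Y₁ N) ∧
      (Y₂ 1 = α 0 * Y₂ 0 - q * B₂ ∧
        ∀ N, Y₂ (N + 2) = α (N + 1) * Y₂ (N + 1) - q * β (N + 1) * Y₂ N) ∧
      Tendsto Y₁ atTop (𝓝 (wValue q s a p)) ∧
      Tendsto Y₂ atTop (𝓝 (wValue q (q ^ 4 / s) (q / a) fun i => q / p i)) ∧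
      Y₁ 0 * B₂ - Y₂ 0 * B₁ ≠ 0 ∧
      ¬(wValue q s a p = 0 ∧ wValue q (q ^ 4 / s) (q / a) (fun i => q / p i) = 0) := by
  have hq := P.norm_q
  have hq0 := P.q_ne_zero
  choose α hα using exists_tendsto_recA P hs hm
  have hβ' : ∀ N, ∃ l, 1 ≤ N → l ≠ 0 ∧ Tendsto (recB q s a p) (𝓝[≠] (q ^ N)) (𝓝 l) := fun N => by
    by_cases hN : 1 ≤ N
    · obtain ⟨l, hl⟩ := exists_tendsto_recB P hs hm hN
      exact ⟨l, fun _ => hl⟩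
    · exact ⟨0, fun h => (hN h).elim⟩
  choose β hβ using hβ'
  choose f hf0 hf using exists_tendsto_factor₁ P hs hm
  obtain ⟨Y₁, hY₁⟩ : ∃ Y : ℕ → ℂ, ∀ N, Tendsto (sol₁ q s a p) (𝓝[≠] (q ^ N)) (𝓝 (Y N)) :=
    ⟨_, fun N => tendsto_sol₁ P hs N (hf N)⟩
  obtain ⟨Y₂, hY₂, hY₂'⟩ : ∃ Y : ℕ → ℂ, (∀ N, Tendsto (sol₂ q s a p) (𝓝[≠] (q ^ N)) (𝓝 (Y N))) ∧
      ∀ N, Y N = sol₂ q s a p (q ^ N) := ⟨_, tendsto_sol₂ P hs, fun _ => rfl⟩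
  obtain ⟨y₁, y₂, B₁, B₂, hy₁, hy₂, hB₁, hB₂, hD⟩ := exists_initial_values P hs hm
  have hz₁ := hY₁ 0
  have hz₂ := hY₂ 0
  rw [pow_zero] at hz₁ hz₂
  obtain rfl := tendsto_nhds_unique hy₁ hz₁
  obtain rfl := tendsto_nhds_unique hy₂ hz₂
  have hdiv : ∀ N, q ^ (N + 1) / q = q ^ N := fun N => by
    rw [pow_succ, mul_div_cancel_right₀ _ hq0]
  have ev₁ : ∀ N, ∀ᶠ x in 𝓝[≠] (q ^ N), sol₁ q s a p (x * q) - recA q s a p x * sol₁ q s a p x +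
      q * recB q s a p x * sol₁ q s a p (x / q) = _ := fun N =>
    (eventually_generic P (pow_ne_zero N hq0)).mono fun x hx => sol₁_recurrence P hx
  have ev₂ : ∀ N, ∀ᶠ x in 𝓝[≠] (q ^ N), sol₂ q s a p (x * q) - recA q s a p x * sol₂ q s a p x +
      q * recB q s a p x * sol₂ q s a p (x / q) = _ := fun N =>
    (eventually_generic P (pow_ne_zero N hq0)).mono fun x hx => sol₂_recurrence P hx
  have rec₁ : Y₁ 1 = α 0 * Y₁ 0 - q * B₁ ∧
      ∀ N, Y₁ (N + 2) = α (N + 1) * Y₁ (N + 1) - q * β (N + 1) * Y₁ N := by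
    refine ⟨tendsto_recurrence hq0 (ev₁ 0) (tendsto_tail₁ P hs 0) ?_ (hY₁ 0) (hα 0) ?_, fun N => ?_⟩
    · rw [← pow_succ]
      exact hY₁ 1
    · rwa [pow_zero]
    · rw [mul_assoc]
      refine tendsto_recurrence hq0 (ev₁ (N + 1)) (tendsto_tail₁ P hs (N + 1)) ?_ (hY₁ (N + 1))
        (hα (N + 1)) ((hβ (N + 1) (by omega)).2.mul ?_)
      · rw [← pow_succ]
        exact hY₁ (N + 2)
      · have := (hY₁ N).comp (hdiv N ▸ tendsto_div_nhdsNE hq0 (q ^ (N + 1)))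
        exact this
  have rec₂ : Y₂ 1 = α 0 * Y₂ 0 - q * B₂ ∧
      ∀ N, Y₂ (N + 2) = α (N + 1) * Y₂ (N + 1) - q * β (N + 1) * Y₂ N := by
    refine ⟨tendsto_recurrence hq0 (ev₂ 0) (tendsto_tail₂ P hs hm 0) ?_ (hY₂ 0) (hα 0) ?_,
      fun N => ?_⟩
    · rw [← pow_succ]
      exact hY₂ 1
    · rwa [pow_zero]
    · rw [mul_assoc]
      refine tendsto_recurrence hq0 (ev₂ (N + 1)) (tendsto_tail₂ P hs hm (N + 1)) ?_ (hY₂ (N + 1))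
        (hα (N + 1)) ((hβ (N + 1) (by omega)).2.mul ?_)
      · rw [← pow_succ]
        exact hY₂ (N + 2)
      · have := (hY₂ N).comp (hdiv N ▸ tendsto_div_nhdsNE hq0 (q ^ (N + 1)))
        exact this
  have lim₁ : Tendsto Y₁ atTop (𝓝 (wValue q s a p)) := by
    refine (tendsto_sol₁_pow P).congr' ?_
    filter_upwards [eventually_ge_atTop 1] with N hN
    have g := semiGeneric_pow P hs N
    have ha := P.a_ne_zero
    have hc : ContinuousAt (factor₁ q s a p) (q ^ N) := by
      refine continuousAt_factor₁ hq ?_ (qPochInf_ne_zero hq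
        (g.sxa_notPow.mul_pow_ne_one hq0 (-1) (by field_simp))) fun i =>
          qPochInf_ne_zero hq ((g.axp_notPow i).mul_pow_ne_one hq0 1 (by rw [zpow_one]; ring))
      have := P.s_mul_div hs (N := N) 1 (j := m + N - 1) (by omega)
      rw [pow_one] at this
      rw [this]
      exact P.qPochInf_pow_ne_zero (by omega)
    exact tendsto_nhds_unique
      (tendsto_sol₁ P hs N (hc.tendsto.mono_left nhdsWithin_le_nhds)) (hY₁ N)
  have lim₂ : Tendsto Y₂ atTop (𝓝 (wValue q (q ^ 4 / s) (q / a) fun i => q / p i)) :=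
    (tendsto_sol₂_pow P hs).congr fun N => (hY₂' N).symm
  refine ⟨α, β, Y₁, Y₂, B₁, B₂, hα, fun N hN => (hβ N hN).2, hy₁, hy₂, hB₁, hB₂, rec₁, rec₂, lim₁,
    lim₂, hD, fun ⟨h1, h2⟩ => ?_⟩
  rw [h1] at lim₁
  rw [h2] at lim₂
  have hpow : (fun N : ℕ => q ^ (N + 1)) =O[atTop] fun N => q ^ N :=
    Asymptotics.IsBigO.of_bound 1 (Eventually.of_forall fun N => by
      rw [pow_succ, norm_mul, one_mul]
      exact mul_le_of_le_one_right (norm_nonneg _) hq.le)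
  have hb1 : (fun N => q * β (N + 1) / q - 1) =O[atTop] fun N => q ^ N := by
    have := (isBigO_pow_of_tendsto hq (differentiableAt_recB q s a p) fun N hN =>
      (hβ N hN).2).comp_tendsto (tendsto_add_atTop_nat 1)
    refine (this.trans hpow).congr_left fun N => ?_
    rw [Function.comp_apply, recB_zero, mul_div_cancel_left₀ _ hq0]
  have hA1 : (fun N => α (N + 1) - 1 - q * β (N + 1)) =O[atTop] fun N => q ^ N := by
    have := (isBigO_pow_of_tendsto hq (f := fun x => recA q s a p x - q * recB q s a p x)
      ((differentiableAt_recA q s a p).sub ((differentiableAt_recB q s a p).const_mul q))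
      fun N hN => (hα N).sub ((hβ N hN).2.const_mul q)).comp_tendsto (tendsto_add_atTop_nat 1)
    refine (this.trans hpow).congr_left fun N => ?_
    rw [Function.comp_apply, recB_zero, recA_zero]
    ring
  have := casoratian_eq_zero hq hq0 (fun N => mul_ne_zero hq0 (hβ (N + 1) (by omega)).1) hb1 hA1
    rec₁.2 lim₁ rec₂.2 lim₂
  rw [rec₁.1, rec₂.1] at this
  exact hD (mul_left_cancel₀ hq0 (by linear_combination this))

/-! ### Points of the Riemann sphere and continuants -/

theorem sphereQuot_mul_left {c : ℂ} (hc : c ≠ 0) (u v : ℂ) :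
    sphereQuot (c * u) (c * v) = sphereQuot u v := by
  unfold sphereQuot
  by_cases hv : v = 0
  · simp [hv]
  · simp [hv, hc, mul_div_mul_left]

theorem tendsto_sphereQuot {ι : Type*} {l : Filter ι} {u v : ι → ℂ} {U V : ℂ}
    (hu : Tendsto u l (𝓝 U)) (hv : Tendsto v l (𝓝 V)) (h : ¬(U = 0 ∧ V = 0)) :
    Tendsto (fun x => sphereQuot (u x) (v x)) l (𝓝 (sphereQuot U V)) := by
  by_cases hV : V = 0
  · have hU : U ≠ 0 := fun hU => h ⟨hU, hV⟩
    have e : sphereQuot U V = OnePoint.infty := if_pos hV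
    rw [e, Tendsto, OnePoint.le_nhds_infty]
    intro s _ hs
    obtain ⟨R, hR⟩ := hs.isBounded.exists_norm_le
    have h1 : Tendsto (fun x => ‖u x‖ - R * ‖v x‖) l (𝓝 ‖U‖) := by
      simpa [hV] using hu.norm.sub (hv.norm.const_mul R)
    rw [mem_map]
    filter_upwards [h1.eventually_const_lt (norm_pos_iff.2 hU)] with x hx
    by_cases hvx : v x = 0
    · right
      exact if_pos hvx
    · left
      refine ⟨u x / v x, fun hmem => ?_, (if_neg hvx).symm⟩
      have h2 := hR _ hmem
      rw [norm_div, div_le_iff₀ (norm_pos_iff.2 hvx)] at h2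
      linarith
  · have e : sphereQuot U V = ((U / V : ℂ) : OnePoint ℂ) := if_neg hV
    rw [e]
    refine ((OnePoint.continuous_coe.tendsto (U / V)).comp (hu.div hv hV)).congr' ?_
    filter_upwards [hv.eventually_ne hV] with x hx
    exact (if_neg hx).symm

theorem contFrac_get? (α β : ℕ → ℂ) (n : ℕ) :
    (contFrac α β).s.get? n = some ⟨if n = 0 then 1 else -β n, α n⟩ := rfl

/-- The continuants are the solutions of the three-term recurrence, expressed in a basis of
solutions. -/
theorem casoratian_mul_continuants {α β Z₁ Z₂ : ℕ → ℂ} {B₁ B₂ : ℂ}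
    (h₁ : Z₁ 1 = α 0 * Z₁ 0 - B₁) (h₂ : Z₂ 1 = α 0 * Z₂ 0 - B₂)
    (hZ₁ : ∀ N, Z₁ (N + 2) = α (N + 1) * Z₁ (N + 1) - β (N + 1) * Z₁ N)
    (hZ₂ : ∀ N, Z₂ (N + 2) = α (N + 1) * Z₂ (N + 1) - β (N + 1) * Z₂ N) (N : ℕ) :
    (Z₁ 0 * B₂ - Z₂ 0 * B₁) * (contFrac α β).nums N = Z₁ N * Z₂ 0 - Z₂ N * Z₁ 0 ∧
      (Z₁ 0 * B₂ - Z₂ 0 * B₁) * (contFrac α β).dens N = Z₁ N * B₂ - Z₂ N * B₁ := by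
  induction N using Nat.twoStepInduction with
  | zero =>
    rw [GenContFract.zeroth_num_eq_h, GenContFract.zeroth_den_eq_one]
    simp [contFrac, mul_comm]
  | one =>
    rw [GenContFract.first_num_eq (contFrac_get? α β 0),
      GenContFract.first_den_eq (contFrac_get? α β 0), h₁, h₂]
    have : (contFrac α β).h = 0 := rfl
    simp only [this, if_true]
    constructor <;> ring
  | more N ih ih' =>
    rw [GenContFract.nums_recurrence (contFrac_get? α β (N + 1)) rfl rfl,
      GenContFract.dens_recurrence (contFrac_get? α β (N + 1)) rfl rfl, hZ₁, hZ₂]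
    simp only [Nat.succ_ne_zero, if_false]
    constructor
    · linear_combination α (N + 1) * ih'.1 - β (N + 1) * ih.1
    · linear_combination α (N + 1) * ih'.2 - β (N + 1) * ih.2

/-! ### The passage to the index `n` -/

/-- The elementary factor `q ^ (-n² / 2 + n) s ^ (-n / 2)` of both solutions. -/
noncomputable def elemFactor (ℓ μ n : ℂ) : ℂ :=
  Complex.exp ((-n ^ 2 / 2 + n) * ℓ) / Complex.exp (n / 2 * μ)

theorem elemFactor_add_one (ℓ μ n : ℂ) : elemFactor ℓ μ (n + 1) =
    elemFactor ℓ μ n * (Complex.exp (ℓ / 2) / (Complex.exp (n * ℓ) * Complex.exp (μ / 2))) := by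
  unfold elemFactor
  rw [div_mul_div_comm, ← Complex.exp_add, ← Complex.exp_add, ← Complex.exp_add, ← Complex.exp_sub,
    ← Complex.exp_sub]
  congr 1
  ring

section

variable {ℓ μ q s : ℂ} (hℓ : Complex.exp ℓ = q) (hμ : Complex.exp μ = s)
include hℓ

theorem exp_mul_eq_mul_pow (n : ℂ) (i j k : ℕ) (t : ℂ) (ht : t = i * n + j - k) :
    Complex.exp (t * ℓ) = Complex.exp (n * ℓ) ^ i * q ^ j / q ^ k := by
  rw [← hℓ, ← Complex.exp_nat_mul, ← Complex.exp_nat_mul, ← Complex.exp_nat_mul, ← Complex.exp_add,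
    ← Complex.exp_sub, ht]
  congr 1
  ring

include hμ

theorem aCoeff_eq (a : ℂ) (p : Fin 5 → ℂ) (n : ℂ) : aCoeff ℓ μ a p n =
    Complex.exp (ℓ / 2) / (Complex.exp (n * ℓ) * Complex.exp (μ / 2)) *
      recA q s a p (Complex.exp (n * ℓ)) := by
  have hq0 : q ≠ 0 := hℓ ▸ Complex.exp_ne_zero _
  have hx0 := Complex.exp_ne_zero (n * ℓ)
  have hh0 := Complex.exp_ne_zero (ℓ / 2)
  have hr0 := Complex.exp_ne_zero (μ / 2)
  have hh : Complex.exp (ℓ / 2) ^ 2 = q := by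
    rw [← hℓ, ← Complex.exp_nat_mul]
    congr 1
    push_cast
    ring
  have hr : Complex.exp (μ / 2) ^ 2 = s := by
    rw [← hμ, ← Complex.exp_nat_mul]
    congr 1
    push_cast
    ring
  have e1 : Complex.exp ((-n + 1 / 2) * ℓ) = Complex.exp (ℓ / 2) / Complex.exp (n * ℓ) := by
    rw [← Complex.exp_sub]
    congr 1
    ring
  have e2 : Complex.exp ((-n + 3 / 2) * ℓ) = q * Complex.exp (ℓ / 2) / Complex.exp (n * ℓ) := by
    rw [← hℓ, ← Complex.exp_add, ← Complex.exp_sub]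
    congr 1
    ring
  have e3 : Complex.exp ((n - 1 / 2) * ℓ) = Complex.exp (n * ℓ) / Complex.exp (ℓ / 2) := by
    rw [← Complex.exp_sub]
    congr 1
    ring
  have f1 := exp_mul_eq_mul_pow hℓ n 1 0 1 (n - 1) (by push_cast; ring)
  have f2 := exp_mul_eq_mul_pow hℓ n 1 0 2 (n - 2) (by push_cast; ring)
  have f3 := exp_mul_eq_mul_pow hℓ n 1 1 0 (n + 1) (by push_cast; ring)
  have f4 := exp_mul_eq_mul_pow hℓ n 2 0 0 (2 * n) (by push_cast; ring)
  have f5 := exp_mul_eq_mul_pow hℓ n 2 0 2 (2 * n - 2) (by push_cast; ring)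
  have f6 := exp_mul_eq_mul_pow hℓ n 2 0 1 (2 * n - 1) (by push_cast; ring)
  have f7 := exp_mul_eq_mul_pow hℓ n 0 2 0 2 (by push_cast; ring)
  simp only [pow_one, pow_zero, mul_one, div_one, one_mul] at f1 f2 f3 f4 f5 f6 f7
  simp only [aCoeff, e1, e2, e3, f1, f2, f3, f4, f5, f6, f7, hμ]
  generalize Complex.exp (n * ℓ) = x at *
  generalize Complex.exp (ℓ / 2) = h at *
  generalize Complex.exp (μ / 2) = r at *
  have g1 : s * (x / q) = s * x / q := by ring
  have g2 : s / a * (x / q) = s * x / (a * q) := by ring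
  have g3 : s / a * (x / q ^ 2) = s * x / (a * q ^ 2) := by ring
  have g4 : a * (x * q) = a * q * x := by ring
  have g5 : ∀ i, a / p i * (x * q) = a * q * x / p i := fun i => by ring
  have g6 : ∀ i, p i * s / a * (x / q ^ 2) = p i * (s * x / (a * q ^ 2)) := fun i => by ring
  have g7 : s * (x ^ 2 / q) = s * x ^ 2 / q := by ring
  have g8 : s * (x ^ 2 / q ^ 2) = s * x ^ 2 / q ^ 2 := by ring
  have g9 : r / a * (x / h) = h / (x * r) * (s * x ^ 2 / (a * q)) := by
    rw [← hh, ← hr]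
    field_simp
  simp only [g1, g2, g3, g4, g5, g6, g7, g8, g9, recA]
  ring

theorem bCoeff_eq (a : ℂ) (p : Fin 5 → ℂ) (n : ℂ) : bCoeff ℓ μ a p n =
    q ^ 3 / (Complex.exp (n * ℓ) ^ 2 * s) * recB q s a p (Complex.exp (n * ℓ)) := by
  have e1 : Complex.exp ((-2 * n + 3) * ℓ) = q ^ 3 / Complex.exp (n * ℓ) ^ 2 := by
    rw [← hℓ, ← Complex.exp_nat_mul, ← Complex.exp_nat_mul, ← Complex.exp_sub]
    congr 1
    push_cast
    ring
  have f2 := exp_mul_eq_mul_pow hℓ n 1 0 2 (n - 2) (by push_cast; ring)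
  have f5 := exp_mul_eq_mul_pow hℓ n 2 0 2 (2 * n - 2) (by push_cast; ring)
  have f6 := exp_mul_eq_mul_pow hℓ n 2 0 1 (2 * n - 1) (by push_cast; ring)
  have f7 := exp_mul_eq_mul_pow hℓ n 2 0 3 (2 * n - 3) (by push_cast; ring)
  simp only [pow_one, pow_zero, mul_one] at f2 f5 f6 f7
  simp only [bCoeff, e1, f2, f5, f6, f7, hμ]
  generalize Complex.exp (n * ℓ) = x at *
  have g1 : s * (x / q ^ 2) = s * x / q ^ 2 := by ring
  have g2 : ∀ i, a / p i * x = a * x / p i := fun i => by ring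
  have g3 : ∀ i, p i * s / a * (x / q ^ 2) = p i * (s * x / (a * q ^ 2)) := fun i => by ring
  have g4 : s * (x ^ 2 / q) = s * x ^ 2 / q := by ring
  have g5 : s * (x ^ 2 / q ^ 2) = s * x ^ 2 / q ^ 2 := by ring
  have g6 : s * (x ^ 2 / q ^ 3) = s * x ^ 2 / q ^ 3 := by ring
  simp only [g1, g2, g3, g4, g5, g6, recB]
  ring

/-- `X_n^{(1)}` as a function of `x = q ^ n`. -/
theorem X₁_eq (a : ℂ) (p : Fin 5 → ℂ) (n : ℂ) : X₁ ℓ μ a p n =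
    elemFactor ℓ μ n * sol₁ q s a p (Complex.exp (n * ℓ)) := by
  have f1 := exp_mul_eq_mul_pow hℓ n 1 0 1 (n - 1) (by push_cast; ring)
  have f3 := exp_mul_eq_mul_pow hℓ n 1 1 0 (n + 1) (by push_cast; ring)
  have f6 := exp_mul_eq_mul_pow hℓ n 2 0 1 (2 * n - 1) (by push_cast; ring)
  have f7 : Complex.exp (-n * ℓ) = 1 / Complex.exp (n * ℓ) := by
    rw [neg_mul, Complex.exp_neg, one_div]
  simp only [pow_one, pow_zero, mul_one, div_one] at f1 f3 f6
  simp only [X₁, f1, f3, f6, f7, hμ, hℓ]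
  generalize Complex.exp (n * ℓ) = x at *
  have g1 : s * (x / q) = s * x / q := by ring
  have g2 : s / a * (x / q) = s * x / (a * q) := by ring
  have g3 : a * (x * q) = a * q * x := by ring
  have g4 : s * (x ^ 2 / q) = s * x ^ 2 / q := by ring
  simp only [g1, g2, g3, g4, sol₁, factor₁, elemFactor, mul_assoc]

/-- `X_n^{(2)}` as a function of `x = q ^ n`. -/
theorem X₂_eq (a : ℂ) (p : Fin 5 → ℂ) (n : ℂ) : X₂ ℓ μ a p n =
    elemFactor ℓ μ n * sol₂ q s a p (Complex.exp (n * ℓ)) := by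
  have f1 := exp_mul_eq_mul_pow hℓ n 1 0 1 (n - 1) (by push_cast; ring)
  have f3 := exp_mul_eq_mul_pow hℓ n 1 1 0 (n + 1) (by push_cast; ring)
  have f6 := exp_mul_eq_mul_pow hℓ n 2 0 1 (2 * n - 1) (by push_cast; ring)
  have f7 : Complex.exp ((-n + 2) * ℓ) = q ^ 2 / Complex.exp (n * ℓ) := by
    rw [← hℓ, ← Complex.exp_nat_mul, ← Complex.exp_sub]
    congr 1
    push_cast
    ring
  simp only [pow_one, pow_zero, mul_one, div_one] at f1 f3 f6
  simp only [X₂, f1, f3, f6, f7, hμ, hℓ]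
  generalize Complex.exp (n * ℓ) = x at *
  have g1 : s / a * x = s * x / a := by ring
  have g2 : ∀ i, p i * s / a * (x / q) = p i * (s * x / (a * q)) := fun i => by ring
  have g3 : x * q = q * x := by ring
  have g4 : s * (x ^ 2 / q) = s * x ^ 2 / q := by ring
  have g5 : q ^ 2 / x / s = q ^ 2 / (s * x) := by rw [div_div, mul_comm]
  simp only [g1, g2, g3, g4, g5, sol₂, factor₂, elemFactor, mul_assoc]

end

theorem tendsto_exp_mul_nhdsNE {ℓ : ℂ} (hℓ : ℓ ≠ 0) (n : ℂ) :
    Tendsto (fun y => Complex.exp (y * ℓ)) (𝓝[≠] n) (𝓝[≠] Complex.exp (n * ℓ)) := by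
  have h : HasDerivAt (fun y => Complex.exp (y * ℓ)) (Complex.exp (n * ℓ) * ℓ) n := by
    simpa using ((hasDerivAt_id n).mul_const ℓ).cexp
  exact h.tendsto_nhdsNE (mul_ne_zero (Complex.exp_ne_zero _) hℓ)

theorem continuous_elemFactor (ℓ μ : ℂ) : Continuous (elemFactor ℓ μ) := by
  unfold elemFactor
  exact Continuous.div (by fun_prop) (by fun_prop) fun _ => Complex.exp_ne_zero _

/-- The shifted solution that enters the value of the continued fraction, in the variable
`x = q ^ n`. -/
theorem bCoeff_mul_elemFactor {ℓ μ q s : ℂ} (hℓ : Complex.exp ℓ = q) (hμ : Complex.exp μ = s)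
    (a : ℂ) (p : Fin 5 → ℂ) (n : ℂ) : bCoeff ℓ μ a p n * elemFactor ℓ μ (n - 1) =
      elemFactor ℓ μ n * (Complex.exp (ℓ / 2) / (Complex.exp (n * ℓ) * Complex.exp (μ / 2)) * q) *
        recB q s a p (Complex.exp (n * ℓ)) := by
  have h := elemFactor_add_one ℓ μ (n - 1)
  rw [sub_add_cancel] at h
  have e : Complex.exp ((n - 1) * ℓ) = Complex.exp (n * ℓ) / q := by
    rw [← hℓ, ← Complex.exp_sub]
    congr 1
    ring
  have hh : Complex.exp (ℓ / 2) ^ 2 = q := by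
    rw [← hℓ, ← Complex.exp_nat_mul]
    congr 1
    push_cast
    ring
  have hr : Complex.exp (μ / 2) ^ 2 = s := by
    rw [← hμ, ← Complex.exp_nat_mul]
    congr 1
    push_cast
    ring
  have hq0 : q ≠ 0 := hℓ ▸ Complex.exp_ne_zero _
  have hx0 := Complex.exp_ne_zero (n * ℓ)
  have hh0 := Complex.exp_ne_zero (ℓ / 2)
  have hr0 := Complex.exp_ne_zero (μ / 2)
  rw [h, bCoeff_eq hℓ hμ, e, ← hr]
  generalize Complex.exp (n * ℓ) = x at *
  generalize Complex.exp (ℓ / 2) = t at *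
  generalize Complex.exp (μ / 2) = r at *
  generalize elemFactor ℓ μ (n - 1) = E at *
  generalize recB q _ a p x = B at *
  have e1 : t / (x / q * r) * (t / (x * r) * q) = q ^ 3 / (x ^ 2 * r ^ 2) := by
    rw [← hh]
    field_simp
  linear_combination -(E * B) * e1

end QCF

theorem theorem4 (q ℓ μ a : ℂ) (p : Fin 5 → ℂ) (m : ℕ)
    (hq : ‖q‖ < 1) (hℓ : Complex.exp ℓ = q)
    (ha : a ≠ 0) (hp : ∀ i, p i ≠ 0)
    (hs : Complex.exp μ = a ^ 3 * q ^ 3 / ∏ i, p i)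
    (hm : 1 ≤ m) (hsm : Complex.exp μ = q ^ m)
    (haq : ∀ k : ℤ, a ≠ q ^ k) (hpa : ∀ i, ∀ k : ℤ, p i / a ≠ q ^ k) :
    ∃ (α β : ℕ → ℂ) (F₁ F₂ : ℂ → ℂ) (L : OnePoint ℂ),
      (∀ n : ℕ, Tendsto (QCF.aCoeff ℓ μ a p) (𝓝[≠] (n : ℂ)) (𝓝 (α n))) ∧
      (∀ n : ℕ, 1 ≤ n → Tendsto (QCF.bCoeff ℓ μ a p) (𝓝[≠] (n : ℂ)) (𝓝 (β n))) ∧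
      QCF.IsContinuation q a p F₁ ∧
      QCF.IsContinuation q (q / a) (fun i => q / p i) F₂ ∧
      QCF.ContFracConverges α β L ∧
      let W₁ : ℂ := F₁ (QCF.wArg q a p)
      let W₂ : ℂ := F₂ (QCF.wArg q (q / a) (fun i => q / p i))
      Tendsto
        (fun n : ℂ =>
          QCF.sphereQuot (W₂ * QCF.X₁ ℓ μ a p n - W₁ * QCF.X₂ ℓ μ a p n)
            (QCF.bCoeff ℓ μ a p n *
              (W₂ * QCF.X₁ ℓ μ a p (n - 1) - W₁ * QCF.X₂ ℓ μ a p (n - 1))))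
        (𝓝[≠] 0) (𝓝 L) := by
  have hq0 : q ≠ 0 := hℓ ▸ Complex.exp_ne_zero _
  obtain ⟨s, hμ⟩ : ∃ s, Complex.exp μ = s := ⟨_, rfl⟩
  rw [hμ] at hs hsm
  have P : QCF.Params q s a p := by
    refine ⟨hq, hq0, hμ ▸ Complex.exp_ne_zero _, ha, hp, fun k h => haq (-k) ?_, fun k h => ?_,
      fun i k h => hpa i (-k) ?_, ?_⟩
    · rw [zpow_neg]
      exact eq_inv_of_mul_eq_one_left h
    · apply haq (m + k)
      rw [zpow_add₀ hq0, zpow_natCast, ← hsm]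
      field_simp at h
      exact h.symm
    · rw [zpow_neg]
      exact eq_inv_of_mul_eq_one_left h
    · rw [hs, div_mul_cancel₀ _ (Finset.prod_ne_zero_iff.2 fun i _ => hp i)]
  have hℓ0 : ℓ ≠ 0 := by
    rintro rfl
    rw [Complex.exp_zero] at hℓ
    rw [← hℓ, norm_one] at hq
    exact lt_irrefl _ hq
  obtain ⟨α, β, Y₁, Y₂, B₁, B₂, hα, hβ, hY₁, hY₂, hB₁, hB₂, ⟨h₁, rec₁⟩, ⟨h₂, rec₂⟩, lim₁, lim₂, hD,
    hW⟩ := QCF.exists_limits P hsm hm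
  set W₁ := QCF.wValue q s a p
  set W₂ := QCF.wValue q (q ^ 4 / s) (q / a) fun i => q / p i
  set t := Complex.exp (ℓ / 2)
  set r := Complex.exp (μ / 2)
  have ht0 : t ≠ 0 := Complex.exp_ne_zero _
  have hr0 : r ≠ 0 := Complex.exp_ne_zero _
  have hs0 := P.s_ne_zero
  have ht : t ^ 2 = q := by
    rw [← hℓ, ← Complex.exp_nat_mul]
    congr 1
    push_cast
    ring
  have hr : r ^ 2 = s := by
    rw [← hμ, ← Complex.exp_nat_mul]
    congr 1
    push_cast
    ring
  have hpow : ∀ n : ℕ, Complex.exp (n * ℓ) = q ^ n := fun n => by rw [Complex.exp_nat_mul, hℓ]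
  have hexp : ∀ n : ℕ, Tendsto (fun y => Complex.exp (y * ℓ)) (𝓝[≠] (n : ℂ)) (𝓝[≠] (q ^ n)) :=
    fun n => hpow n ▸ QCF.tendsto_exp_mul_nhdsNE hℓ0 n
  have hexp' : ∀ n : ℕ, Tendsto (fun y => Complex.exp (y * ℓ)) (𝓝[≠] (n : ℂ)) (𝓝 (q ^ n)) :=
    fun n => (hexp n).mono_right nhdsWithin_le_nhds
  have hqn : ∀ n : ℕ, q ^ n ≠ 0 := fun n => pow_ne_zero n hq0
  -- the normalization of the coefficients and of the solutions
  set γ : ℕ → ℂ := fun N => t / (q ^ N * r) with hγ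
  have hγ0 : ∀ N, γ N ≠ 0 := fun N => div_ne_zero ht0 (mul_ne_zero (hqn N) hr0)
  set e : ℕ → ℂ := fun N => ∏ k ∈ Finset.range N, γ k with he
  have he0 : ∀ N, e N ≠ 0 := fun N => Finset.prod_ne_zero_iff.2 fun k _ => hγ0 k
  have he00 : e 0 = 1 := Finset.prod_range_zero _
  have he1 : ∀ N, e (N + 1) = e N * γ N := fun N => Finset.prod_range_succ _ _
  have hγγ : ∀ N, γ N * γ (N + 1) * q = q ^ 3 / ((q ^ (N + 1)) ^ 2 * s) := fun N => by
    have := hqn N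
    simp only [hγ, pow_succ]
    rw [← hr]
    rw [show t / (q ^ N * r) * (t / (q ^ N * q * r)) * q = t ^ 2 * q / ((q ^ N * r) * (q ^ N * q * r))
      by ring, ht]
    field_simp
  refine ⟨fun N => γ N * α N, fun N => q ^ 3 / ((q ^ N) ^ 2 * s) * β N,
    QCF.continuation q (QCF.vwpCoeff q a p),
    QCF.continuation q (QCF.vwpCoeff q (q / a) fun i => q / p i),
    QCF.sphereQuot (W₂ * Y₁ 0 - W₁ * Y₂ 0) (W₂ * (γ 0 * q * B₁) - W₁ * (γ 0 * q * B₂)),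
    fun n => ?_, fun n hn => ?_, QCF.isContinuation_continuation hq hq0 P.well_poised,
    QCF.isContinuation_continuation hq hq0 P.dual.well_poised, ?_, ?_⟩
  · rw [funext (QCF.aCoeff_eq hℓ hμ a p)]
    exact (tendsto_const_nhds.div ((hexp' n).mul_const r) (mul_ne_zero (hqn n) hr0)).mul
      ((hα n).comp (hexp n))
  · rw [funext (QCF.bCoeff_eq hℓ hμ a p)]
    exact (tendsto_const_nhds.div (((hexp' n).pow 2).mul_const s)
      (mul_ne_zero (pow_ne_zero 2 (hqn n)) hs0)).mul ((hβ n hn).comp (hexp n))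
  · have hD' : Y₁ 0 * (γ 0 * q * B₂) - Y₂ 0 * (γ 0 * q * B₁) ≠ 0 := by
      have := mul_ne_zero (mul_ne_zero (hγ0 0) hq0) hD
      convert this using 1
      ring
    have hcont := QCF.casoratian_mul_continuants (α := fun N => γ N * α N)
      (β := fun N => q ^ 3 / ((q ^ N) ^ 2 * s) * β N) (Z₁ := fun N => e N * Y₁ N)
      (Z₂ := fun N => e N * Y₂ N) (B₁ := γ 0 * q * B₁) (B₂ := γ 0 * q * B₂)
      (by simp only [he1, h₁, he00]; ring)
      (by simp only [he1, h₂, he00]; ring)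
      (fun N => by
        simp only [← hγγ, he1, rec₁]
        ring)
      (fun N => by
        simp only [← hγγ, he1, rec₂]
        ring)
    have hconv : ∀ N, QCF.sphereQuot (Y₁ N * Y₂ 0 - Y₂ N * Y₁ 0)
        (Y₁ N * (γ 0 * q * B₂) - Y₂ N * (γ 0 * q * B₁)) = QCF.sphereQuot
          ((QCF.contFrac (fun N => γ N * α N) fun N => q ^ 3 / ((q ^ N) ^ 2 * s) * β N).nums N)
          ((QCF.contFrac (fun N => γ N * α N) fun N => q ^ 3 / ((q ^ N) ^ 2 * s) * β N).dens N) := by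
      intro N
      obtain ⟨c1, c2⟩ := hcont N
      simp only [he00, one_mul] at c1 c2
      rw [← QCF.sphereQuot_mul_left hD' (GenContFract.nums _ N), c1, c2,
        ← QCF.sphereQuot_mul_left (he0 N)]
      congr 1 <;> ring
    refine Tendsto.congr hconv ?_
    have hL : QCF.sphereQuot (W₂ * Y₁ 0 - W₁ * Y₂ 0)
        (W₂ * (γ 0 * q * B₁) - W₁ * (γ 0 * q * B₂)) = QCF.sphereQuot (W₁ * Y₂ 0 - W₂ * Y₁ 0)
          (W₁ * (γ 0 * q * B₂) - W₂ * (γ 0 * q * B₁)) := by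
      rw [← QCF.sphereQuot_mul_left (neg_ne_zero.2 one_ne_zero)]
      congr 1 <;> ring
    rw [hL]
    refine QCF.tendsto_sphereQuot ((lim₁.mul_const _).sub (lim₂.mul_const _))
      ((lim₁.mul_const _).sub (lim₂.mul_const _)) fun ⟨z1, z2⟩ => hW ⟨?_, ?_⟩
    · refine (mul_eq_zero.1 ?_).resolve_right hD'
      linear_combination Y₁ 0 * z2 - (γ 0 * q * B₁) * z1
    · refine (mul_eq_zero.1 ?_).resolve_right hD'
      linear_combination Y₂ 0 * z2 - (γ 0 * q * B₂) * z1
  · have w1 : QCF.continuation q (QCF.vwpCoeff q a p) (QCF.wArg q a p) = W₁ := by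
      rw [QCF.wArg_eq P]
      rfl
    have w2 : QCF.continuation q (QCF.vwpCoeff q (q / a) fun i => q / p i)
        (QCF.wArg q (q / a) fun i => q / p i) = W₂ := by
      rw [QCF.wArg_eq P.dual]
      rfl
    dsimp only
    rw [w1, w2]
    have hexp0 := hexp 0
    have hexp0' := hexp' 0
    rw [Nat.cast_zero, pow_zero] at hexp0 hexp0'
    have hE : Tendsto (QCF.elemFactor ℓ μ) (𝓝[≠] 0) (𝓝 1) := by
      have h := (QCF.continuous_elemFactor ℓ μ).tendsto 0
      have h1 : QCF.elemFactor ℓ μ 0 = 1 := by simp [QCF.elemFactor]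
      rw [h1] at h
      exact h.mono_left nhdsWithin_le_nhds
    have hX : ∀ {f : ℂ → ℂ} {y : ℂ}, Tendsto f (𝓝[≠] 1) (𝓝 y) →
        Tendsto (fun n => QCF.elemFactor ℓ μ n * f (Complex.exp (n * ℓ))) (𝓝[≠] 0) (𝓝 y) :=
      fun hf => by simpa using hE.mul (hf.comp hexp0)
    have hγ' : Tendsto (fun n => QCF.elemFactor ℓ μ n * (t / (Complex.exp (n * ℓ) * r) * q))
        (𝓝[≠] 0) (𝓝 (γ 0 * q)) := by
      have h := hE.mul ((tendsto_const_nhds.div (hexp0'.mul_const r)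
        (mul_ne_zero one_ne_zero hr0) : Tendsto (fun n => t / (Complex.exp (n * ℓ) * r)) _ _).mul_const
          q)
      simpa [hγ] using h
    have hshift : ∀ n, Complex.exp ((n - 1) * ℓ) = Complex.exp (n * ℓ) / q := fun n => by
      rw [← hℓ, ← Complex.exp_sub]
      congr 1
      ring
    have hXB : ∀ {f : ℂ → ℂ} {y : ℂ},
        Tendsto (fun x => QCF.recB q s a p x * f (x / q)) (𝓝[≠] 1) (𝓝 y) →
        Tendsto (fun n => QCF.bCoeff ℓ μ a p n *
          (QCF.elemFactor ℓ μ (n - 1) * f (Complex.exp ((n - 1) * ℓ)))) (𝓝[≠] 0)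
            (𝓝 (γ 0 * q * y)) := by
      intro f y hf
      refine (hγ'.mul (hf.comp hexp0)).congr fun n => ?_
      have hb : QCF.bCoeff ℓ μ a p n * QCF.elemFactor ℓ μ (n - 1) =
          QCF.elemFactor ℓ μ n * (t / (Complex.exp (n * ℓ) * r) * q) *
            QCF.recB q s a p (Complex.exp (n * ℓ)) := QCF.bCoeff_mul_elemFactor hℓ hμ a p n
      rw [hshift, Function.comp_apply]
      linear_combination -f (Complex.exp (n * ℓ) / q) * hb
    have hu := ((hX hY₁).const_mul W₂).sub ((hX hY₂).const_mul W₁)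
    have hv := ((hXB hB₁).const_mul W₂).sub ((hXB hB₂).const_mul W₁)
    refine (QCF.tendsto_sphereQuot hu hv fun ⟨z1, z2⟩ => hW ⟨?_, ?_⟩).congr fun n => ?_
    · have hD' := mul_ne_zero (mul_ne_zero (hγ0 0) hq0) hD
      refine (mul_eq_zero.1 ?_).resolve_right hD'
      linear_combination γ 0 * q * B₁ * z1 - Y₁ 0 * z2
    · have hD' := mul_ne_zero (mul_ne_zero (hγ0 0) hq0) hD
      refine (mul_eq_zero.1 ?_).resolve_right hD'
      linear_combination γ 0 * q * B₂ * z1 - Y₂ 0 * z2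
    · rw [QCF.X₁_eq hℓ hμ, QCF.X₂_eq hℓ hμ, QCF.X₁_eq hℓ hμ, QCF.X₂_eq hℓ hμ]
      congr 1
      ring
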